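/- **Setting.** A matching market consists of finite disjoint sets $F$ (firms) and $W$ (workers), a set $E\subseteq F\times W$ of acceptable pairs, with $W(f)=\{w:(f,w)\in E\}$ and $F(w)=\{f:(f,w)\in E\}$, and choice functions $\mathcal C_f:2^{W(f)}\to 2^{W(f)}$, $\mathcal C_w:2^{F(w)}\to 2^{F(w)}$ with $\mathcal C_a(S)\subseteq S$. A choice function $\mathcal C$ is *substitutable* if $b\in\mathcal C(S)$ implies $b\in\mathcal C(T\cup\{b\})$ for all $T\subseteq S$; *consistent* if $\mathcal C(S)\subseteq T\subseteq S$ implies $\mathcal C(S)=\mathcal C(T)$; *cardinal monotone* if $S\subseteq T$ implies $|\mathcal C(S)|\le|\mathcal C(T)|$; *quota-filling* if for some $q\in\mathbb N$, $|\mathcal C(S)|=\min(q,|S|)$ for all $S$. In the CM-Model all choice functions are substitutable, consistent (equivalently: path-independent) and cardinal monotone; in the CM-QF-Model, moreover, those of the workers are quota-filling. A matching is a set $\mu\subseteq E$; $\mu(a)$ is the set of partners of $a$. It is *stable* if $\mathcal C_a(\mu(a))=\mu(a)$ for all agents $a$ and there is no $(f,w)\in E\setminus\mu$ with $w\in\mathcal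 C_f(\mu(f)\cup\{w\})$ and $f\in\mathcal C_w(\mu(w)\cup\{f\})$. Let $\mathcal S$ be the set of stable matchings, with $\mu_1\succeq\mu_2$ iff $\mathcal C_f(\mu_1(f)\cup\mu_2(f))=\mu_1(f)$ for all $f\in F$. *Rotations* are the pairs $\rho=(\rho^+,\rho^-)=(\mu\setminus\mu',\mu'\setminus\mu)$ with $\mu'$ an immediate predecessor of $\mu$ in $(\mathcal S,\succeq)$ (that is, $\mu'\succ\mu$ with nothing strictly between); $\Pi$ is the set of rotations. Let $P(\mu)$ be the set of pairs $(f,w)$ that belong to some stable matching and satisfy $w\in\mathcal C_f(\mu(f)\cup\{w\})$, and $\mathcal P=\{P(\mu):\mu\in\mathcal S\}$. For $a\in\bigcup\mathcal P$ let $H(a)=\bigcap\{H\in\mathcal P:a\in H\}$. For $\rho_1,\rho_2\in\Pi$, $\rho_1\succeq^\star\rho_2$ means that there are $H_1\subseteq H_2$ in $\mathcal P$, each of the form $H(a)$ and different from $\bigcap\mathcal P$, with $\rho_i^+=\{a:H(a)=H_i\}$ for $i=1,2$. Let $\psi(\mu)=\{\rho\in\Pi:\rho^+\subseteq P(\mu)\}$.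 A set $U\subseteq\Pi$ is an *upper set* if $\rho\in U$ and $\rho'\succeq^\star\rho$ imply $\rho'\in U$. For a set $S$, $\chi^S$ denotes its characteristic vector. **Theorem.** (1) In the CM-Model, $(\mathcal S,\succeq)$ is a distributive lattice with a greatest element $\mu_F$, and it is affinely represented by the rotation poset: $\succeq^\star$ is a partial order on $\Pi$; $\psi$ is a bijection from $\mathcal S$ onto the upper sets of $(\Pi,\succeq^\star)$, with $\mu\succeq\nu\iff\psi(\mu)\subseteq\psi(\nu)$; and with the matrix $A\in\{0,\pm1\}^{E\times\Pi}$ whose columns are $\chi^{\rho^+}-\chi^{\rho^-}$, $\rho\in\Pi$, the affine function $g:\mathbb R^\Pi\to\mathbb R^E$, $g(u)=Au+\chi^{\mu_F}$, satisfies $g(\chi^U)=\chi^{\psi^{-1}(U)}$ for every upper set $U$. Moreover $|\Pi|\le|F||W|$, so $|\Pi|=O(|F||W|)$, and $A$ has full column rank. (2) In the CM-QF-Model with $F,W\ne\emptyset$, the poset $(\Pi,\succeq^\star)$, the representation function $\psi$ and the affine function $g$ can be computed in time $O(|F|^3|W|^3\cdot\text{oracle-call})$, where oracle-call $\ge 1$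 is the time of one query of a choice function on a set of acceptable partners. Precisely, consider fixed programs (assignments, branching, while-loops) for a random access machine which stores arrays of natural numbers and arrays of sets of agents (agents are numbered), whose input consists of $|F|$, $|W|$ and the sets $W(f)$, $F(w)$, and where every assignment and every test takes one time unit; the operations are successor, predecessor and comparison of numbers, union, intersection, difference, equality and membership for sets, forming a singleton, and extracting the least element of a set. There are three programs and a constant such that, for every market of the CM-QF-Model and for one listing $\rho_0,\dots,\rho_{k-1}$ of $\Pi$, within time $O(|F|^3|W|^3\cdot\text{oracle-call})$ each: the first outputs $k$, all $\rho_i^+$ and $\rho_i^-$, the order relation $\succeq^\star$ as a table, the matrix $A$ and the vector $\chi^{\mu_F}$; the second, given also $\mu\in\mathcal S$, outputs $\{i:\rho_i\in\psi(\mu)\}$; the third, given also $\{i:\rho_i\in U\}$ for an upper set $U$ of $\Pi$, outputs the stable matching $\psi^{-1}(U)$. -/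

import Mathlib

open scoped Matrix

/-! ## Affine representation of lattices of sets -/

namespace AffineRep

/-- The characteristic vector of a subset of `E`. -/
noncomputable def charVec {E : Type*} (S : Set E) : E → ℝ := S.indicator 1

/-- `U` is an upper set for the order `ge` (`ge y' y` reads "`y'` is above `y`"). -/
def IsUpper {Y : Type*} (ge : Y → Y → Prop) (U : Set Y) : Prop :=
  ∀ y ∈ U, ∀ y', ge y' y → y' ∈ U

/-- `ψ` is a representation function of the lattice `(X, geX)` by the poset `(Y, geY)`:
a bijection from `X` onto the upper sets of `Y` with `S ⪰ S' ↔ ψ S ⊆ ψ S'`. -/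
structure IsRepresentationFunction {X Y : Type*} (geX : X → X → Prop) (geY : Y → Y → Prop)
    (ψ : X → Set Y) : Prop where
  bijOn : Set.BijOn ψ Set.univ {U | IsUpper geY U}
  ge_iff : ∀ S S', geX S S' ↔ ψ S ⊆ ψ S'

/-- The poset `(Y, geY)` affinely represents the lattice `(X, geX)`, whose elements `S` are the
subsets `sets S` of the base set `E`, with representation function `ψ`, via the affine map `g`.
As `ψ` is a bijection onto the upper sets, `g (χ^U) = χ^(ψ⁻¹ U)` for all upper sets `U` says that
`g (χ^(ψ S)) = χ^S` for all `S`. -/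
structure AffinelyRepresents {X Y E : Type*} (sets : X → Set E) (geX : X → X → Prop)
    (geY : Y → Y → Prop) (ψ : X → Set Y) (g : (Y → ℝ) →ᵃ[ℝ] (E → ℝ)) : Prop where
  sets_injective : Function.Injective sets
  isRepresentationFunction : IsRepresentationFunction geX geY ψ
  map_charVec : ∀ S, g (charVec (ψ S)) = charVec (sets S)

/-! ### Irreducible elements and minimal differences of a family of sets -/

/-- `H(a)`: the intersection of all members of the family that contain `a`. -/
def minContaining {B : Type*} (H : Set (Set B)) (a : B) : Set B := ⋂₀ {h ∈ H | a ∈ h}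

/-- The irreducible members: those of the form `H(a)` for some `a` in the maximal member. -/
def irreducibles {B : Type*} (H : Set (Set B)) : Set (Set B) :=
  {h ∈ H | ∃ a ∈ ⋃₀ H, h = minContaining H a}

/-- The centers `K(h)` of a member `h`. -/
def centers {B : Type*} (H : Set (Set B)) (h : Set B) : Set B :=
  {a ∈ ⋃₀ H | minContaining H a = h}

/-- The order `⊒` on minimal differences (sets of centers of irreducible members other than the
minimal member `⋂₀ H`): `K₁ ⊒ K₂` iff `I(K₁) ⊆ I(K₂)`, where `I(K)` is the irreducible member whose
set of centers is `K`. -/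
def MinDiffGE {B : Type*} (H : Set (Set B)) (K₁ K₂ : Set B) : Prop :=
  ∃ h₁ ∈ irreducibles H, ∃ h₂ ∈ irreducibles H, h₁ ≠ ⋂₀ H ∧ h₂ ≠ ⋂₀ H ∧
    centers H h₁ = K₁ ∧ centers H h₂ = K₂ ∧ h₁ ⊆ h₂

end AffineRep

/-! ## Matching markets with choice functions -/

namespace Choice

/-! Properties of a choice function `C` whose domain is the power set of `A`. -/

def Substitutable {α : Type*} [DecidableEq α] (A : Finset α) (C : Finset α → Finset α) : Prop :=
  ∀ S ⊆ A, ∀ b ∈ C S, ∀ T ⊆ S, b ∈ C (insert b T)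

def Consistent {α : Type*} (A : Finset α) (C : Finset α → Finset α) : Prop :=
  ∀ S ⊆ A, ∀ T, C S ⊆ T → T ⊆ S → C S = C T

def CardinalMonotone {α : Type*} (A : Finset α) (C : Finset α → Finset α) : Prop :=
  ∀ T ⊆ A, ∀ S ⊆ T, (C S).card ≤ (C T).card

def QuotaFilling {α : Type*} (A : Finset α) (C : Finset α → Finset α) : Prop :=
  ∃ q : ℕ, ∀ S ⊆ A, (C S).card = min q S.card

end Choice

/-- A matching market with firms `F` and workers `W`. `acc` is the set of mutually acceptable
firm-worker pairs. The choice function of an agent matters only on sets of acceptable partners: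
its values elsewhere are irrelevant, and nothing below looks at them. -/
structure Market (F W : Type*) [DecidableEq F] [DecidableEq W] [Fintype F] [Fintype W] where
  acc : Finset (F × W)
  choiceF : F → Finset W → Finset W
  choiceW : W → Finset F → Finset F
  choiceF_subset : ∀ f, ∀ S ⊆ Finset.univ.filter (fun w => (f, w) ∈ acc), choiceF f S ⊆ S
  choiceW_subset : ∀ w, ∀ S ⊆ Finset.univ.filter (fun f => (f, w) ∈ acc), choiceW w S ⊆ S

namespace Market

/-- The partners `μ(f)` of the firm `f` in the set of pairs `μ`. -/
def atFirm {F W : Type*} [DecidableEq F] [DecidableEq W] [Fintype W]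
    (μ : Finset (F × W)) (f : F) : Finset W :=
  Finset.univ.filter fun w => (f, w) ∈ μ

/-- The partners `μ(w)` of the worker `w` in the set of pairs `μ`. -/
def atWorker {F W : Type*} [DecidableEq F] [DecidableEq W] [Fintype F]
    (μ : Finset (F × W)) (w : W) : Finset F :=
  Finset.univ.filter fun f => (f, w) ∈ μ

section

variable {F W : Type*} [DecidableEq F] [DecidableEq W] [Fintype F] [Fintype W] (M : Market F W)

/-- The CM-Model; `atFirm M.acc f` is the set `W(f)` of acceptable workers of `f`. -/
structure IsCM : Prop where
  substF : ∀ f, Choice.Substitutable (atFirm M.acc f) (M.choiceF f)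
  substW : ∀ w, Choice.Substitutable (atWorker M.acc w) (M.choiceW w)
  consF : ∀ f, Choice.Consistent (atFirm M.acc f) (M.choiceF f)
  consW : ∀ w, Choice.Consistent (atWorker M.acc w) (M.choiceW w)
  cardF : ∀ f, Choice.CardinalMonotone (atFirm M.acc f) (M.choiceF f)
  cardW : ∀ w, Choice.CardinalMonotone (atWorker M.acc w) (M.choiceW w)

/-- The CM-QF-Model: moreover the choice functions of the workers are quota-filling. -/
structure IsCMQF : Prop extends M.IsCM where
  quotaW : ∀ w, Choice.QuotaFilling (atWorker M.acc w) (M.choiceW w)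

/-- Stable matchings, as sets of acceptable pairs. -/
structure IsStable (μ : Finset (F × W)) : Prop where
  subset_acc : μ ⊆ M.acc
  rationalF : ∀ f, M.choiceF f (atFirm μ f) = atFirm μ f
  rationalW : ∀ w, M.choiceW w (atWorker μ w) = atWorker μ w
  not_blocked : ∀ f w, (f, w) ∈ M.acc → (f, w) ∉ μ →
    ¬ (w ∈ M.choiceF f (insert w (atFirm μ f)) ∧ f ∈ M.choiceW w (insert f (atWorker μ w)))

/-- The set `𝒮` of stable matchings. -/
abbrev StableMatching := {μ : Finset (F × W) // M.IsStable μ}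

/-- `μ₁ ⪰ μ₂`: every firm `f` chooses `μ₁(f)` from `μ₁(f) ∪ μ₂(f)`. -/
def Dominates (μ₁ μ₂ : M.StableMatching) : Prop :=
  ∀ f, M.choiceF f (atFirm μ₁.1 f ∪ atFirm μ₂.1 f) = atFirm μ₁.1 f

/-- `μ` is the firm-optimal stable matching `μ_F`. -/
def IsFirmOptimal (μ : M.StableMatching) : Prop := ∀ ν, M.Dominates μ ν

/-- `μ'` is an immediate predecessor of `μ` in `(𝒮, ⪰)`. -/
def IsImmediatePredecessor (μ' μ : M.StableMatching) : Prop :=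
  M.Dominates μ' μ ∧ μ' ≠ μ ∧ ∀ ν, M.Dominates μ' ν → M.Dominates ν μ → ν = μ' ∨ ν = μ

/-- The set `Π` of rotations `ρ = (ρ⁺, ρ⁻) = (μ \ μ', μ' \ μ)`, where `μ'` is an immediate
predecessor of `μ`. -/
abbrev Rotation := {ρ : Finset (F × W) × Finset (F × W) //
  ∃ μ' μ : M.StableMatching, M.IsImmediatePredecessor μ' μ ∧ ρ = (μ.1 \ μ'.1, μ'.1 \ μ.1)}

noncomputable instance : Fintype M.Rotation := Fintype.ofFinite _

/-- The P-set of `μ`: stable pairs `(f, w)` such that `f` chooses `w` from `μ(f) ∪ {w}`. -/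
def pSet (μ : M.StableMatching) : Set (F × W) :=
  {p | (∃ ν : M.StableMatching, p ∈ ν.1) ∧ p.2 ∈ M.choiceF p.1 (insert p.2 (atFirm μ.1 p.1))}

/-- The order `⪰⋆` of the rotation poset: `ρ₁ ⪰⋆ ρ₂` iff `ρ₁⁺ ⊒ ρ₂⁺` as minimal differences of the
family of P-sets. -/
def RotationGE (ρ₁ ρ₂ : M.Rotation) : Prop :=
  AffineRep.MinDiffGE (Set.range M.pSet) ↑ρ₁.1.1 ↑ρ₂.1.1

/-- The representation function `ψ`: the rotations whose minimal difference `ρ⁺` is contained in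
the P-set of the matching. -/
def rotationSet (μ : M.StableMatching) : Set M.Rotation := {ρ | ↑ρ.1.1 ⊆ M.pSet μ}

/-- The base set `E` of acceptable pairs. -/
abbrev Edge := {p : F × W // p ∈ M.acc}

/-- A set of pairs, as a subset of the base set `E`. -/
def edgeSet (μ : Finset (F × W)) : Set M.Edge := {e | e.1 ∈ μ}

/-- The matrix `A` with columns `χ^(ρ⁺) - χ^(ρ⁻)`. -/
noncomputable def rotationMatrix : Matrix M.Edge M.Rotation ℝ := Matrix.of fun e ρ =>
  AffineRep.charVec (M.edgeSet ρ.1.1) e - AffineRep.charVec (M.edgeSet ρ.1.2) e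

end

end Market

/-! ## Oracle machines

A random access machine whose memory consists of arrays of natural numbers and arrays of sets of
agents. Agents of each side are numbered from `0`. An assignment and the evaluation of the condition
of a branch or loop take one time unit (an expression has a size fixed by the program); in
particular comparing two sets and extracting an element of the difference of two sets take constant
time. The only arithmetic operations are successor and predecessor, so that numbers stay of
logarithmic bit length in polynomial time, and the sets in memory contain only numbers of agents.
A query of a choice function takes `T` time units. -/

namespace OracleMachine

/-- Memory: `num a i j k` and `set a i j k` are the entries with indices `i, j, k` of the `a`-th
array of numbers and of the `a`-th array of sets. -/
structure Memory where
  num : ℕ → ℕ → ℕ → ℕ → ℕ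
  set : ℕ → ℕ → ℕ → ℕ → Finset ℕ

/-- Expressions for numbers; `nF` and `nW` are the numbers of firms and workers. -/
inductive NumExp where
  | const (c : ℕ)
  | nF
  | nW
  | cell (a : ℕ) (i j k : NumExp)
  | succ (x : NumExp)
  | pred (x : NumExp)

/-- Expressions for sets. -/
inductive SetExp where
  | empty
  | cell (a : ℕ) (i j k : NumExp)
  | singleton (x : NumExp)
  | union (X Y : SetExp)
  | inter (X Y : SetExp)
  | sdiff (X Y : SetExp)

/-- Conditions. -/
inductive Cond where
  | lt (x y : NumExp)
  | eq (x y : NumExp)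
  | mem (x : NumExp) (X : SetExp)
  | setEq (X Y : SetExp)
  | not (b : Cond)
  | and (b c : Cond)

/-- Programs. The arguments `a i j k` name the memory cell which receives the result. -/
inductive Program where
  /-- assign a number -/
  | assignNum (a : ℕ) (i j k : NumExp) (x : NumExp)
  /-- assign a set -/
  | assignSet (a : ℕ) (i j k : NumExp) (X : SetExp)
  /-- extract an element (the least one) of a set; the result is `0` if the set is empty -/
  | pick (a : ℕ) (i j k : NumExp) (X : SetExp)
  /-- query the choice function of firm `x` on the set `X` of workers -/
  | queryF (a : ℕ) (i j k : NumExp) (x : NumExp) (X : SetExp)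
  /-- query the choice function of worker `x` on the set `X` of firms -/
  | queryW (a : ℕ) (i j k : NumExp) (x : NumExp) (X : SetExp)
  | seq (P Q : Program)
  | ite (b : Cond) (P Q : Program)
  | loop (b : Cond) (P : Program)

def NumExp.eval (n m : ℕ) (s : Memory) : NumExp → ℕ
  | const c => c
  | nF => n
  | nW => m
  | cell a i j k => s.num a (i.eval n m s) (j.eval n m s) (k.eval n m s)
  | succ x => x.eval n m s + 1
  | pred x => x.eval n m s - 1

/-- Sets in memory are sets of numbers of agents: `singleton x` is empty unless `x < max n m`. -/
def SetExp.eval (n m : ℕ) (s : Memory) : SetExp → Finset ℕ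
  | empty => ∅
  | cell a i j k => s.set a (i.eval n m s) (j.eval n m s) (k.eval n m s)
  | singleton x => if x.eval n m s < max n m then {x.eval n m s} else ∅
  | union X Y => X.eval n m s ∪ Y.eval n m s
  | inter X Y => X.eval n m s ∩ Y.eval n m s
  | sdiff X Y => X.eval n m s \ Y.eval n m s

def Cond.eval (n m : ℕ) (s : Memory) : Cond → Prop
  | lt x y => x.eval n m s < y.eval n m s
  | eq x y => x.eval n m s = y.eval n m s
  | mem x X => x.eval n m s ∈ X.eval n m s
  | setEq X Y => X.eval n m s = Y.eval n m s
  | not b => ¬ b.eval n m s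
  | and b c => b.eval n m s ∧ c.eval n m s

/-- Store the number `v` in the cell `(a, i, j, k)`. -/
def Memory.setNum (s : Memory) (a i j k v : ℕ) : Memory where
  num a' i' j' k' := if a' = a ∧ i' = i ∧ j' = j ∧ k' = k then v else s.num a' i' j' k'
  set := s.set

/-- Store the set `V` in the cell `(a, i, j, k)`. -/
def Memory.setSet (s : Memory) (a i j k : ℕ) (V : Finset ℕ) : Memory where
  num := s.num
  set a' i' j' k' := if a' = a ∧ i' = i ∧ j' = j ∧ k' = k then V else s.set a' i' j' k'

/-- A set of numbered agents as a set of natural numbers. -/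
def toNatSet {n : ℕ} (S : Finset (Fin n)) : Finset ℕ := S.map Fin.valEmbedding

/-- `Exec M T P s s' t`: on the market `M`, where a query takes time `T`, the program `P` started
with memory `s` halts with memory `s'` after `t` time units. A query is possible only for sets of
acceptable partners, the domain of a choice function. -/
inductive Exec {n m : ℕ} (M : Market (Fin n) (Fin m)) (T : ℕ) :
    Program → Memory → Memory → ℕ → Prop
  | assignNum (a : ℕ) (i j k x : NumExp) (s : Memory) :
      Exec M T (.assignNum a i j k x) s
        (s.setNum a (i.eval n m s) (j.eval n m s) (k.eval n m s) (x.eval n m s)) 1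
  | assignSet (a : ℕ) (i j k : NumExp) (X : SetExp) (s : Memory) :
      Exec M T (.assignSet a i j k X) s
        (s.setSet a (i.eval n m s) (j.eval n m s) (k.eval n m s) (X.eval n m s)) 1
  | pick (a : ℕ) (i j k : NumExp) (X : SetExp) (s : Memory) :
      Exec M T (.pick a i j k X) s
        (s.setNum a (i.eval n m s) (j.eval n m s) (k.eval n m s)
          (sInf (X.eval n m s : Set ℕ))) 1
  | queryF (a : ℕ) (i j k x : NumExp) (X : SetExp) (s : Memory) (f : Fin n)
      (S : Finset (Fin m)) (hx : x.eval n m s = f) (hX : X.eval n m s = toNatSet S)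
      (hS : S ⊆ Market.atFirm M.acc f) :
      Exec M T (.queryF a i j k x X) s
        (s.setSet a (i.eval n m s) (j.eval n m s) (k.eval n m s) (toNatSet (M.choiceF f S))) T
  | queryW (a : ℕ) (i j k x : NumExp) (X : SetExp) (s : Memory) (w : Fin m)
      (S : Finset (Fin n)) (hx : x.eval n m s = w) (hX : X.eval n m s = toNatSet S)
      (hS : S ⊆ Market.atWorker M.acc w) :
      Exec M T (.queryW a i j k x X) s
        (s.setSet a (i.eval n m s) (j.eval n m s) (k.eval n m s) (toNatSet (M.choiceW w S))) T
  | seq (P Q : Program) (s s' s'' : Memory) (t t' : ℕ) :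
      Exec M T P s s' t → Exec M T Q s' s'' t' → Exec M T (.seq P Q) s s'' (t + t')
  | iteTrue (b : Cond) (P Q : Program) (s s' : Memory) (t : ℕ) :
      b.eval n m s → Exec M T P s s' t → Exec M T (.ite b P Q) s s' (1 + t)
  | iteFalse (b : Cond) (P Q : Program) (s s' : Memory) (t : ℕ) :
      ¬ b.eval n m s → Exec M T Q s s' t → Exec M T (.ite b P Q) s s' (1 + t)
  | loopTrue (b : Cond) (P : Program) (s s' s'' : Memory) (t t' : ℕ) :
      b.eval n m s → Exec M T P s s' t → Exec M T (.loop b P) s' s'' t' →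
      Exec M T (.loop b P) s s'' (1 + t + t')
  | loopFalse (b : Cond) (P : Program) (s : Memory) :
      ¬ b.eval n m s → Exec M T (.loop b P) s s 1

section

variable {n m : ℕ} (M : Market (Fin n) (Fin m))

/-- The partners of the firm with number `i` in the set of pairs `μ` (none if `i ≥ n`). -/
def firmRow (μ : Finset (Fin n × Fin m)) (i : ℕ) : Finset ℕ :=
  if h : i < n then toNatSet (Market.atFirm μ ⟨i, h⟩) else ∅

/-- The partners of the worker with number `i` in the set of pairs `μ` (none if `i ≥ m`). -/
def workerRow (μ : Finset (Fin n × Fin m)) (i : ℕ) : Finset ℕ :=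
  if h : i < m then toNatSet (Market.atWorker μ ⟨i, h⟩) else ∅

open Classical in
/-- The input: the sets of acceptable partners of the firms (set array `0`) and of the workers (set
array `1`), a set of pairs `μ` as an array of sets indexed by the firms (set array `2`), and a set
`U` of natural numbers as a `0/1` array (number array `0`). Everything else is empty or zero. -/
noncomputable def input (μ : Finset (Fin n × Fin m)) (U : Set ℕ) : Memory where
  num a i j k := if a = 0 ∧ j = 0 ∧ k = 0 ∧ i ∈ U then 1 else 0
  set a i j k :=
    if j = 0 ∧ k = 0 then
      if a = 0 then firmRow M.acc i
      else if a = 1 then workerRow M.acc i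
      else if a = 2 then firmRow μ i
      else ∅
    else ∅

/-- Entries of `A` are stored as the codes `0`, `1`, and `2` for `-1`. -/
def decodeSign : ℕ → ℝ
  | 0 => 0
  | 1 => 1
  | _ => -1

open Classical in
/-- The memory contains the rotation poset, with the rotations listed as `ρ 0, …, ρ (k - 1)`, and
the affine function `u ↦ A u + x⁰` with `x⁰ = χ^μF`. -/
structure HoldsRepresentation (μF : M.StableMatching) {k : ℕ} (ρ : Fin k ≃ M.Rotation)
    (s : Memory) : Prop where
  count : s.num 1 0 0 0 = k
  plus : ∀ (i : Fin k) (f : Fin n), s.set 3 i f 0 = toNatSet (Market.atFirm (ρ i).1.1 f)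
  minus : ∀ (i : Fin k) (f : Fin n), s.set 4 i f 0 = toNatSet (Market.atFirm (ρ i).1.2 f)
  order : ∀ i j : Fin k, s.num 2 i j 0 = if M.RotationGE (ρ i) (ρ j) then 1 else 0
  matrix : ∀ (e : M.Edge) (i : Fin k),
    decodeSign (s.num 3 e.1.1 e.1.2 i) = M.rotationMatrix e (ρ i)
  offset : ∀ e : M.Edge,
    (s.num 4 e.1.1 e.1.2 0 : ℝ) = AffineRep.charVec (M.edgeSet μF.1) e

/-- The positions, in the list `ρ`, of the members of a set of rotations. -/
def indexSet {k : ℕ} (ρ : Fin k ≃ M.Rotation) (R : Set M.Rotation) : Set ℕ :=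
  {i | ∃ h : i < k, ρ ⟨i, h⟩ ∈ R}

open Classical in
/-- The memory contains the set of rotations `R`, as a `0/1` array. -/
def HoldsRotationSet {k : ℕ} (ρ : Fin k ≃ M.Rotation) (R : Set M.Rotation) (s : Memory) : Prop :=
  ∀ i : Fin k, s.num 5 i 0 0 = if ρ i ∈ R then 1 else 0

/-- The memory contains the matching `μ`, as an array of sets indexed by the firms. -/
def HoldsMatching (μ : Finset (Fin n × Fin m)) (s : Memory) : Prop :=
  ∀ f : Fin n, s.set 5 f 0 0 = toNatSet (Market.atFirm μ f)

/-- Started with memory `s`, the program halts within time `b`, and the final memory satisfies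
`post`. -/
def HaltsWithin (T : ℕ) (P : Program) (s : Memory) (b : ℕ) (post : Memory → Prop) : Prop :=
  ∃ s' t, Exec M T P s s' t ∧ t ≤ b ∧ post s'

end

end OracleMachine

/-! Gluing the choices of all firms, and of all workers, gives two path-independent, cardinal
monotone choice functions `C` and `D` on sets of pairs, and stability becomes a statement about
these two (`isStable_iff`). For stable `μ` and `ν`, substitutability gives `C (μ ∪ ν) ∩ D (μ ∪ ν) ⊆
μ ∩ ν`, and counting with cardinal monotonicity turns all inequalities into equalities
(`stab_counts`). So stable matchings have one size, and the join `C (μ ∪ ν)` and the meet `D (μ ∪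
ν)` have the same union and intersection as `μ` and `ν`. Together with convexity (a pair in both
ends of a chain lies in the middle) this is all that the order theory uses; it is recorded in
`IsSetLattice`.

In such a lattice let `above m μ` be the set of pairs of the members above `μ`; for stable matchings
this is the P-set (`pSet_eq`). The map turns joins into intersections and meets into unions and is
injective, so the lattice is distributive. A cover can be moved up to the greatest `η` whose `above`
contains a given entering pair, without changing its two differences (`covBy_greatest`). Hence a
rotation `ρ` is determined by a base `η`: the pairs of `ρ⁺` lie in `above m ν`, and those of `ρ⁻`
have been passed at `ν`, exactly if `ν ≤ η`. Therefore `ρ ∈ ψ(μ)` iff `μ ≤ η`, and `⪰⋆` is the order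
of the bases: Birkhoff's theorem with meet-irreducible elements. Descending along a cover adds
exactly one rotation, which gives the affine formula by induction from the top. The sets `ρ⁺` are
nonempty and disjoint, which bounds the number of rotations, and the matrix is triangular along the
bases, hence of full column rank.

For the algorithm, let `b = (f, w)` leave in the rotation `ρ`. The base of `ρ` is the greatest
stable matching that has passed `b`. Deferred acceptance finds it when `b` is withdrawn from `f` and
yet presented to `w` as a proposal (`DAInv.init_forced`). One run takes `O(nm)` steps, and the pairs
no longer available at its end tell which stable pairs have been passed at the base. Doing this for
every pair yields all bases; `mem_minus_iff` and `mem_plus_iff` recover the rotations by comparing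
pairs with pairs, at `O(n)` steps per comparison. One query per rotation decides `ψ`, and its
inverse adds the entering and deletes the leaving pairs. -/

/-! ## Path-independent, cardinal monotone choice -/

namespace PathIndependent

variable {E : Type*} [DecidableEq E]

/-- Substitutable, consistent and cardinal monotone choice functions on a ground set. -/
structure IsChoice (C : Finset E → Finset E) : Prop where
  subset : ∀ S, C S ⊆ S
  subst : ∀ S, ∀ b ∈ C S, ∀ T ⊆ S, b ∈ C (insert b T)
  cons : ∀ S T, C S ⊆ T → T ⊆ S → C S = C T
  mono : ∀ S T, S ⊆ T → (C S).card ≤ (C T).card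

namespace IsChoice

variable {C : Finset E → Finset E} (h : IsChoice C)
include h

theorem mem_of_subset {S T : Finset E} {b : E} (hb : b ∈ C S) (hT : T ⊆ S) (hbT : b ∈ T) :
    b ∈ C T := by
  have := h.subst S b hb T hT
  rwa [Finset.insert_eq_of_mem hbT] at this

theorem idem (S : Finset E) : C (C S) = C S :=
  (h.cons S (C S) subset_rfl (h.subset S)).symm

/-- Path independence: by substitutability `C (S ∪ T)` lies in `C S ∪ T`, and consistency then
allows the rest of `S` to be discarded. -/
theorem union_left (S T : Finset E) : C (C S ∪ T) = C (S ∪ T) := by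
  refine (h.cons (S ∪ T) (C S ∪ T) ?_ ?_).symm
  · intro x hx
    rcases Finset.mem_union.1 (h.subset _ hx) with hS | hT
    · exact Finset.mem_union_left _ (h.mem_of_subset hx Finset.subset_union_left hS)
    · exact Finset.mem_union_right _ hT
  · exact Finset.union_subset_union_left (h.subset S)

theorem union_right (S T : Finset E) : C (S ∪ C T) = C (S ∪ T) := by
  rw [Finset.union_comm, h.union_left, Finset.union_comm]

theorem insert_choice (b : E) (S : Finset E) : C (insert b (C S)) = C (insert b S) := by
  rw [Finset.insert_eq, Finset.insert_eq, h.union_right]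

/-- If every element of `T` outside `S` is rejected together with `S = C S`, then
`C (S ∪ T) = S`. -/
theorem union_eq_of_rejected {S T : Finset E} (hS : C S = S)
    (hT : ∀ t ∈ T, t ∉ S → t ∉ C (insert t S)) : C (S ∪ T) = S := by
  refine (h.cons (S ∪ T) S (fun x hx => ?_) Finset.subset_union_left).trans hS
  by_contra hxS
  have hxT : x ∈ T := (Finset.mem_union.1 (h.subset _ hx)).resolve_left hxS
  exact hT x hxT hxS (h.subst _ x hx S Finset.subset_union_left)

end IsChoice

/-- Stability of a set of contracts for the choice functions of the two sides. -/
structure Stab (C D : Finset E → Finset E) (μ : Finset E) : Prop where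
  left : C μ = μ
  right : D μ = μ
  not_blocked : ∀ e, e ∉ μ → ¬ (e ∈ C (insert e μ) ∧ e ∈ D (insert e μ))

theorem Stab.symm {C D : Finset E → Finset E} {μ : Finset E} (h : Stab C D μ) : Stab D C μ :=
  ⟨h.right, h.left, fun e he hb => h.not_blocked e he hb.symm⟩

variable {C D : Finset E → Finset E} (hC : IsChoice C) (hD : IsChoice D)

section
include hC hD

/-- By path independence a contract of `A` that is not in `C A` stays rejected when added to `C A`,
and likewise for `T` and `D`. So no contract of `A ∪ T` blocks. All stable sets below are obtained
in this way. -/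
theorem stab_of_cover {A T : Finset E} (hAT : C A = D T)
    (hcov : ∀ e, e ∈ C (insert e (C A)) → e ∈ D (insert e (C A)) → e ∈ A ∨ e ∈ T) :
    Stab C D (C A) := by
  refine ⟨hC.idem A, by rw [hAT, hD.idem T], fun e he hb => ?_⟩
  rcases hcov e hb.1 hb.2 with hA | hT
  · rw [hC.insert_choice, Finset.insert_eq_of_mem hA] at hb
    exact he hb.1
  · rw [hAT, hD.insert_choice, Finset.insert_eq_of_mem hT] at hb
    exact he (hAT ▸ hb.2)

/-- A contract chosen by both sides from `μ ∪ ν` but missing from one of the two sets would block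
it, by substitutability. -/
theorem Stab.inter_subset {μ ν : Finset E} (hμ : Stab C D μ)
    (hν : Stab C D ν) : C (μ ∪ ν) ∩ D (μ ∪ ν) ⊆ μ ∩ ν := by
  have key : ∀ {μ ν : Finset E}, Stab C D ν → ∀ x ∈ C (μ ∪ ν) ∩ D (μ ∪ ν), x ∈ ν := by
    intro μ ν hν x hx
    rw [Finset.mem_inter] at hx
    by_contra hxν
    exact hν.not_blocked x hxν ⟨hC.subst _ x hx.1 ν Finset.subset_union_right,
      hD.subst _ x hx.2 ν Finset.subset_union_right⟩
  intro x hx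
  exact Finset.mem_inter.2 ⟨key hμ x (by rwa [Finset.union_comm ν μ]), key hν x hx⟩

/-- Both choices have at least `max |μ| |ν|` elements by cardinal monotonicity, while the sum of
their sizes is at most `|μ ∪ ν| + |μ ∩ ν| = |μ| + |ν|`. Hence equality holds everywhere. -/
theorem stab_counts {μ ν : Finset E} (hμ : Stab C D μ) (hν : Stab C D ν) :
    C (μ ∪ ν) ∪ D (μ ∪ ν) = μ ∪ ν ∧ C (μ ∪ ν) ∩ D (μ ∪ ν) = μ ∩ ν ∧
      (C (μ ∪ ν)).card = μ.card ∧ μ.card = ν.card := by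
  have h1 := hμ.inter_subset hC hD hν
  have h2 : C (μ ∪ ν) ∪ D (μ ∪ ν) ⊆ μ ∪ ν := Finset.union_subset (hC.subset _) (hD.subset _)
  have c1 := Finset.card_le_card h1
  have c2 := Finset.card_le_card h2
  have e1 := Finset.card_union_add_card_inter (C (μ ∪ ν)) (D (μ ∪ ν))
  have e2 := Finset.card_union_add_card_inter μ ν
  have m1 := hC.mono μ (μ ∪ ν) Finset.subset_union_left
  have m2 := hC.mono ν (μ ∪ ν) Finset.subset_union_right
  have m3 := hD.mono μ (μ ∪ ν) Finset.subset_union_left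
  have m4 := hD.mono ν (μ ∪ ν) Finset.subset_union_right
  rw [hμ.left] at m1
  rw [hν.left] at m2
  rw [hμ.right] at m3
  rw [hν.right] at m4
  exact ⟨Finset.eq_of_subset_of_card_le h2 (by omega),
    Finset.eq_of_subset_of_card_le h1 (by omega), by omega, by omega⟩

theorem Stab.card_eq {μ ν : Finset E} (hμ : Stab C D μ) (hν : Stab C D ν) : μ.card = ν.card :=
  (stab_counts hC hD hμ hν).2.2.2

theorem Stab.union_eq {μ ν : Finset E} (hμ : Stab C D μ) (hν : Stab C D ν) :
    C (μ ∪ ν) ∪ D (μ ∪ ν) = μ ∪ ν :=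
  (stab_counts hC hD hμ hν).1

theorem Stab.inter_eq {μ ν : Finset E} (hμ : Stab C D μ) (hν : Stab C D ν) :
    C (μ ∪ ν) ∩ D (μ ∪ ν) = μ ∩ ν :=
  (stab_counts hC hD hμ hν).2.1

/-- Opposition of interests: the union and the intersection of the two choices are known, so one
choice determines the other. -/
theorem Stab.choice_union_comm {μ ν : Finset E} (hμ : Stab C D μ) (hν : Stab C D ν)
    (h : C (μ ∪ ν) = μ) : D (μ ∪ ν) = ν := by
  have h1 := hμ.union_eq hC hD hν
  have h2 := hμ.inter_eq hC hD hν
  rw [h] at h1 h2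
  ext x
  have e1 := congrArg (x ∈ ·) h1
  have e2 := congrArg (x ∈ ·) h2
  simp only [Finset.mem_union, Finset.mem_inter, eq_iff_iff] at e1 e2
  tauto

/-- The join of two stable sets is stable. -/
theorem Stab.join [Fintype E] {μ ν : Finset E} (hμ : Stab C D μ) (hν : Stab C D ν) :
    Stab C D (C (μ ∪ ν)) := by
  -- the contracts that are not rejected from `X := μ ∪ ν ∪ {rejected}`
  let X : Finset E → Finset E := fun μ => Finset.univ.filter fun e => e ∈ C (insert e μ) → e ∈ μ
  have hμX : ∀ μ, μ ⊆ X μ := fun μ e he => by simp [X, he]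
  have hCX : ∀ {μ}, C μ = μ → C (X μ) = μ := by
    intro μ h
    have := hC.union_eq_of_rejected (T := X μ) h (fun t ht htμ htC => htμ (by
      simp only [X, Finset.mem_filter, Finset.mem_univ, true_and] at ht; exact ht htC))
    rwa [Finset.union_eq_right.2 (hμX μ)] at this
  -- A contract outside `X μ` is wanted by the side of `C` at `μ`, so by stability the side of `D`
  -- rejects it.
  have hDY : ∀ {μ}, Stab C D μ → ∀ T, (∀ e ∈ T, e ∈ X μ → e ∈ μ) → D (μ ∪ T) = μ := by
    intro μ h T hT
    refine hD.union_eq_of_rejected h.right fun t ht htμ htD => ?_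
    have : t ∉ X μ := fun hX => htμ (hT t ht hX)
    simp only [X, Finset.mem_filter, Finset.mem_univ, true_and, not_forall] at this
    exact h.not_blocked t htμ ⟨this.1, htD⟩
  have hJ : C (X μ ∪ X ν) = C (μ ∪ ν) := by
    rw [← hC.union_left, ← hC.union_right, hCX hμ.left, hCX hν.left]
  -- `Y` consists of the join and of everything outside `X μ ∪ X ν`. These two sets cover the ground
  -- set, `C` chooses the join from `X μ ∪ X ν`, and it remains to see that `D` chooses it from `Y`.
  let Y : Finset E := Finset.univ.filter fun e => e ∈ X μ ∪ X ν → e ∈ C (μ ∪ ν)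
  have hJY : C (μ ∪ ν) ⊆ Y := fun e he => by simp [Y, he]
  have hY : ∀ {κ}, Stab C D κ → X κ ⊆ X μ ∪ X ν → (∀ e ∈ Y, e ∈ X κ → e ∈ κ) := by
    intro κ hκ hsub e heY heX
    simp only [Y, Finset.mem_filter, Finset.mem_univ, true_and] at heY
    have h1 : e ∈ C (X μ ∪ X ν) := hJ ▸ heY (hsub heX)
    rw [← hCX hκ.left]
    exact hC.mem_of_subset h1 hsub heX
  have hYμ := hDY hμ Y (hY hμ Finset.subset_union_left)
  have hYν := hDY hν Y (hY hν Finset.subset_union_right)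
  have hsub : C (μ ∪ ν) ⊆ D Y := by
    intro e he
    rcases Finset.mem_union.1 (hC.subset _ he) with h | h
    · exact hD.mem_of_subset (hYμ.symm ▸ h : e ∈ D (μ ∪ Y)) Finset.subset_union_right (hJY he)
    · exact hD.mem_of_subset (hYν.symm ▸ h : e ∈ D (ν ∪ Y)) Finset.subset_union_right (hJY he)
  -- `D Y` is at most as large as `D (μ ∪ Y) = μ`, which has the size of the join; so the inclusion
  -- `hsub` is an equality.
  have hcard : (D Y).card ≤ (C (μ ∪ ν)).card := by
    rw [(stab_counts hC hD hμ hν).2.2.1]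
    have := hD.mono Y (μ ∪ Y) Finset.subset_union_right
    rwa [hYμ] at this
  have heq := Finset.eq_of_subset_of_card_le hsub hcard
  rw [← hJ]
  refine stab_of_cover hC hD (T := Y) (by rw [hJ, heq]) fun e _ _ => ?_
  by_cases h : e ∈ X μ ∪ X ν
  · exact Or.inl h
  · exact Or.inr (by simp only [Y, Finset.mem_filter, Finset.mem_univ, true_and]; exact fun h' => absurd h' h)

theorem Stab.meet [Fintype E] {μ ν : Finset E} (hμ : Stab C D μ) (hν : Stab C D ν) :
    Stab C D (D (μ ∪ ν)) :=
  (hμ.symm.join hD hC hν.symm).symm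

/-- Stable sets exist. -/
theorem exists_stab [Fintype E] : ∃ μ, Stab C D μ := by
  -- Substitutability makes the rejected part of a set monotone in the set, so `Φ`, the complement
  -- of what `D` rejects from `T A`, is monotone and a minimal set with `Φ A ≤ A` is a fixed point.
  -- There `A` and `T A` cover the ground set and `C A = D (T A)`.
  let T : Finset E → Finset E := fun A => (A \ C A)ᶜ
  let Φ : Finset E → Finset E := fun A => (T A \ D (T A))ᶜ
  have rej : ∀ {C : Finset E → Finset E}, IsChoice C → ∀ {S T : Finset E}, S ⊆ T →
      S \ C S ⊆ T \ C T := by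
    intro C hC S T hST x hx
    rw [Finset.mem_sdiff] at hx ⊢
    exact ⟨hST hx.1, fun h => hx.2 (hC.mem_of_subset h hST hx.1)⟩
  have hΦ : Monotone Φ := fun A B hAB => by
    have h1 : T B ⊆ T A := Finset.compl_subset_compl.2 (rej hC hAB)
    exact Finset.compl_subset_compl.2 (rej hD h1)
  obtain ⟨A, hA⟩ := Set.Finite.exists_minimal (Set.toFinite {A | Φ A ≤ A}) ⟨Finset.univ, by simp⟩
  have hfix : Φ A = A := le_antisymm hA.1 (hA.2 (hΦ hA.1) hA.1)
  have mT : ∀ x, x ∈ T A ↔ (x ∈ A → x ∈ C A) := fun x => by simp [T]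
  have mA : ∀ x, x ∈ A ↔ (x ∈ T A → x ∈ D (T A)) := fun x => by
    conv_lhs => rw [← hfix]
    simp [Φ]
  have h1 : C A = D (T A) := by
    ext x
    constructor
    · intro hx
      exact (mA x).1 (hC.subset _ hx) ((mT x).2 fun _ => hx)
    · intro hx
      exact (mT x).1 (hD.subset _ hx) ((mA x).2 fun _ => hx)
  refine ⟨_, stab_of_cover hC hD h1 fun e _ _ => ?_⟩
  by_cases he : e ∈ A
  · exact Or.inl he
  · exact Or.inr ((mT e).2 fun h => absurd h he)

end

/-! ### Domination -/

section
include hC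

/-- Path independence evaluates `C (a ∪ b ∪ c)` in two ways. -/
theorem dominates_trans {a b c : Finset E} (hab : C (a ∪ b) = a) (hbc : C (b ∪ c) = b) :
    C (a ∪ c) = a := by
  have h1 : C (a ∪ b ∪ c) = C (a ∪ c) := by rw [← hC.union_left, hab]
  have h2 : C (a ∪ b ∪ c) = a := by rw [Finset.union_assoc, ← hC.union_right, hbc, hab]
  rw [← h1, h2]

theorem choice_union_dominates (a b : Finset E) : C (C (a ∪ b) ∪ a) = C (a ∪ b) := by
  rw [hC.union_left, Finset.union_right_comm, Finset.union_self]

theorem dominates_choice_union {a b c : Finset E} (ha : C (c ∪ a) = c) (hb : C (c ∪ b) = c) :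
    C (c ∪ C (a ∪ b)) = c := by
  rw [hC.union_right, ← Finset.union_assoc, ← hC.union_left, ha, hb]

end

end PathIndependent

/-! ## Lattices of sets with complementary joins and meets -/

/-- A lattice of finite sets of equal size, in which the join and the meet of two members have the
same union and the same intersection as these, and whose members are convex. -/
structure IsSetLattice {S E : Type*} [Lattice S] [DecidableEq E] (m : S → Finset E) : Prop where
  union_eq : ∀ a b, m (a ⊔ b) ∪ m (a ⊓ b) = m a ∪ m b
  inter_eq : ∀ a b, m (a ⊔ b) ∩ m (a ⊓ b) = m a ∩ m b
  convex : ∀ a b c, a ≤ b → b ≤ c → ∀ e, e ∈ m a → e ∈ m c → e ∈ m b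
  card_eq : ∀ a b, (m a).card = (m b).card
  injective : Function.Injective m

namespace IsSetLattice

section Lattice

variable {S E : Type*} [Lattice S]

/-- The elements of the members above `μ`. -/
def above (m : S → Finset E) (μ : S) : Set E := {e | ∃ η, μ ≤ η ∧ e ∈ m η}

variable {m : S → Finset E}

theorem subset_above (μ : S) {e : E} (he : e ∈ m μ) : e ∈ above m μ := ⟨μ, le_rfl, he⟩

theorem above_anti {μ ν : S} (h : ν ≤ μ) : above m μ ⊆ above m ν :=
  fun _ ⟨η, hη, he⟩ => ⟨η, h.trans hη, he⟩

theorem above_top [OrderTop S] : above m (⊤ : S) = {e | e ∈ m (⊤ : S)} := by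
  ext e
  exact ⟨fun ⟨η, hη, he⟩ => top_le_iff.1 hη ▸ he, fun he => subset_above _ he⟩

variable [DecidableEq E] (h : IsSetLattice m)
include h

theorem mem_sup_or_mem_inf {a b : S} {e : E} : e ∈ m (a ⊔ b) ∨ e ∈ m (a ⊓ b) ↔ e ∈ m a ∨ e ∈ m b := by
  rw [← Finset.mem_union, h.union_eq, Finset.mem_union]

theorem mem_sup_and_mem_inf {a b : S} {e : E} :
    e ∈ m (a ⊔ b) ∧ e ∈ m (a ⊓ b) ↔ e ∈ m a ∧ e ∈ m b := by
  rw [← Finset.mem_inter, h.inter_eq, Finset.mem_inter]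

/-- If `e` were not in the join, it would be in the meet, and convexity along `η ⊓ μ ≤ μ ≤ ξ` would
put it into `μ`. Then it is common to `η` and `μ`, hence in the join after all. -/
theorem mem_above_iff {η μ : S} {e : E} (he : e ∈ m η) : e ∈ above m μ ↔ e ∈ m (η ⊔ μ) := by
  refine ⟨fun ⟨ξ, hξ, heξ⟩ => ?_, fun h => ⟨_, le_sup_right, h⟩⟩
  by_contra hn
  have h1 : e ∈ m (η ⊓ μ) := (h.mem_sup_or_mem_inf.2 (Or.inl he)).resolve_left hn
  have h2 : e ∈ m μ := h.convex _ _ _ inf_le_right hξ e h1 heξ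
  exact hn (h.mem_sup_and_mem_inf.2 ⟨he, h2⟩).1

theorem above_sup (μ ν : S) : above m (μ ⊔ ν) = above m μ ∩ above m ν := by
  refine Set.Subset.antisymm
    (Set.subset_inter (above_anti le_sup_left) (above_anti le_sup_right)) ?_
  rintro e ⟨⟨η, hη, he⟩, hν⟩
  exact ⟨η ⊔ ν, sup_le_sup_right hη ν, (h.mem_above_iff he).1 hν⟩

/-- A pair of `η ≥ μ ⊓ ν` that is in neither set on the right descends from `η` to `η ⊓ μ` and from
there to `η ⊓ μ ⊓ ν = μ ⊓ ν`, and so lies in `μ` or `ν`. -/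
theorem above_inf (μ ν : S) : above m (μ ⊓ ν) = above m μ ∪ above m ν := by
  refine Set.Subset.antisymm ?_
    (Set.union_subset (above_anti inf_le_left) (above_anti inf_le_right))
  rintro e ⟨η, hη, he⟩
  by_contra hn
  rw [Set.mem_union, not_or] at hn
  have h1 : e ∈ m (η ⊓ μ) :=
    (h.mem_sup_or_mem_inf.2 (Or.inl he)).resolve_left fun h' => hn.1 ((h.mem_above_iff he).2 h')
  have h2 : e ∈ m (η ⊓ μ ⊓ ν) :=
    (h.mem_sup_or_mem_inf.2 (Or.inl h1)).resolve_left fun h' => hn.2 ((h.mem_above_iff h1).2 h')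
  rw [inf_assoc, inf_eq_right.2 hη] at h2
  rcases h.mem_sup_or_mem_inf.1 (Or.inr h2) with h3 | h3
  · exact hn.1 (subset_above μ h3)
  · exact hn.2 (subset_above ν h3)

/-- The inclusion gives `above m (μ ⊔ ν) = above m μ`, hence `m μ ⊆ m (μ ⊔ ν)`; as the sizes agree,
`μ = μ ⊔ ν`. -/
theorem above_subset_iff {μ ν : S} : above m μ ⊆ above m ν ↔ ν ≤ μ := by
  refine ⟨fun hs => ?_, above_anti⟩
  have h1 : above m (μ ⊔ ν) = above m μ := by
    rw [h.above_sup, Set.inter_eq_left.2 hs]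
  have h2 : m μ ⊆ m (μ ⊔ ν) := fun e he => by
    have := (h.mem_above_iff he).1 (h1 ▸ subset_above μ he : e ∈ above m (μ ⊔ ν))
    rwa [sup_eq_right.2 le_sup_left] at this
  have h3 := h.injective (Finset.eq_of_subset_of_card_le h2 (h.card_eq _ _).le)
  exact sup_eq_left.1 h3.symm

theorem above_injective : Function.Injective (above m) := fun _ _ he =>
  le_antisymm (h.above_subset_iff.1 he.ge) (h.above_subset_iff.1 he.le)

/-- Distributivity is inherited from unions and intersections through the order-reversing embedding
`above`. -/
theorem inf_sup_le (a b c : S) : a ⊓ (b ⊔ c) ≤ a ⊓ b ⊔ a ⊓ c := by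
  rw [← h.above_subset_iff]
  simp only [h.above_sup, h.above_inf]
  rw [Set.union_inter_distrib_left]

/-- The elements of the members above `μ` that are not in `μ`. -/
theorem mem_of_le {η μ : S} (hle : η ≤ μ) {e : E} (he : e ∈ m η) (hμ : e ∈ above m μ) : e ∈ m μ := by
  have := (h.mem_above_iff he).1 hμ
  rwa [sup_eq_right.2 hle] at this

/-- A pair gained at the cover descends from its member `η` to `η ⊓ μ'`. This lies between `μ` and
`μ'` and cannot be `μ'`, so it is `μ`. -/
theorem above_diff_of_covBy {μ μ' : S} (hc : μ ⋖ μ') :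
    above m μ \ above m μ' = {e | e ∈ m μ ∧ e ∉ m μ'} := by
  ext e
  constructor
  · rintro ⟨⟨η, hη, he⟩, hn⟩
    refine ⟨?_, fun h' => hn (subset_above _ h')⟩
    have h1 : e ∈ m (η ⊓ μ') :=
      (h.mem_sup_or_mem_inf.2 (Or.inl he)).resolve_left fun h' => hn ((h.mem_above_iff he).2 h')
    rcases hc.eq_or_eq (le_inf hη hc.le) inf_le_right with h2 | h2
    · rwa [h2] at h1
    · exact absurd (subset_above _ (h2 ▸ h1)) hn
  · rintro ⟨h1, h2⟩
    exact ⟨subset_above _ h1, fun h' => h2 (h.mem_of_le hc.le h1 h')⟩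

/-- The elements of members above `μ` that are in `μ` no more. -/
def passed (m : S → Finset E) (μ : S) : Set E := {e | e ∈ above m μ ∧ e ∉ m μ}

theorem passed_anti {μ ν : S} (hle : ν ≤ μ) : passed m μ ⊆ passed m ν := fun _ ⟨h1, h2⟩ =>
  ⟨above_anti hle h1, fun h3 => h2 (h.mem_of_le hle h3 h1)⟩

theorem passed_sup {μ ν : S} {e : E} (hμ : e ∈ passed m μ) (hν : e ∈ passed m ν) :
    e ∈ passed m (μ ⊔ ν) := by
  refine ⟨h.above_sup μ ν ▸ ⟨hμ.1, hν.1⟩, fun h' => ?_⟩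
  rcases h.mem_sup_or_mem_inf.1 (Or.inl h') with h1 | h1
  · exact hμ.2 h1
  · exact hν.2 h1

theorem passed_diff_of_covBy {μ μ' : S} (hc : μ ⋖ μ') :
    passed m μ \ passed m μ' = {e | e ∈ m μ' ∧ e ∉ m μ} := by
  ext e
  constructor
  · rintro ⟨⟨h1, h2⟩, h3⟩
    refine ⟨?_, h2⟩
    by_contra h4
    have h5 : e ∉ above m μ' := fun h5 => h3 ⟨h5, h4⟩
    have : e ∈ above m μ \ above m μ' := ⟨h1, h5⟩
    rw [h.above_diff_of_covBy hc] at this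
    exact h2 this.1
  · rintro ⟨h1, h2⟩
    exact ⟨⟨above_anti hc.le (subset_above _ h1), h2⟩, fun h' => h'.2 h1⟩

/-- Members have equal sizes. Applied to a cover in both directions, this makes both parts of a
rotation nonempty. -/
theorem exists_mem_notMem {μ μ' : S} (hne : μ ≠ μ') : ∃ e, e ∈ m μ ∧ e ∉ m μ' := by
  by_contra! hn
  exact hne (h.injective (Finset.eq_of_subset_of_card_le hn (h.card_eq _ _).le))

end Lattice

/-! ### Covers and greatest members in the distributive lattice -/

section DistribLattice

variable {S : Type*} [DistribLattice S]

theorem exists_greatest [Finite S] {p : S → Prop} (hp : ∀ a b, p a → p b → p (a ⊔ b)) {μ : S} (hμ : p μ) :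
    ∃ η, p η ∧ ∀ ν, p ν → ν ≤ η := by
  obtain ⟨η, hη⟩ := Set.Finite.exists_maximal (Set.toFinite {ν | p ν}) ⟨μ, hμ⟩
  exact ⟨η, hη.1, fun ν hν => sup_eq_left.1 (le_antisymm (hη.2 (hp _ _ hη.1 hν) le_sup_left)
    le_sup_left)⟩

theorem exists_covBy [Finite S] [OrderTop S] {μ : S} (hμ : μ ≠ ⊤) : ∃ μ', μ ⋖ μ' := by
  obtain ⟨μ', hμ', -⟩ := exists_covBy_le_of_lt (lt_top_iff_ne_top.2 hμ)
  exact ⟨μ', hμ'⟩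

variable {E : Type*} [DecidableEq E] {m : S → Finset E} (h : IsSetLattice m)
include h

/-- A cover `μ ⋖ μ'` can be moved up to the greatest `η` that has a given new element; the cover
`η ⋖ η'` then has the same differences. -/
theorem covBy_greatest {μ μ' η : S} (hc : μ ⋖ μ') {a : E} (ha : a ∈ m μ) (ha' : a ∉ m μ')
    (hη : a ∈ above m η) (hgr : ∀ ν, a ∈ above m ν → ν ≤ η) :
    ∃ η', η ⋖ η' ∧ m η \ m η' = m μ \ m μ' ∧ m η' \ m η = m μ' \ m μ ∧
      above m η' = above m η \ ↑(m μ \ m μ') ∧ ∀ ξ, η < ξ → η' ≤ ξ := by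
  have hμη : μ ≤ η := hgr μ (subset_above _ ha)
  have haP : a ∉ above m μ' := fun h' => ha' (h.mem_of_le hc.le ha h')
  -- As `a` is in `above m η` but not in `above m μ'`, the member `μ'` is not below `η`. So `μ ⋖ μ'`
  -- transposes up to `η ⋖ η ⊔ μ'`.
  have hinf : η ⊓ μ' = μ := by
    rcases hc.eq_or_eq (le_inf hμη hc.le) inf_le_right with h1 | h1
    · exact h1
    · exact absurd (above_anti (inf_eq_right.1 h1) hη) haP
  have hcov : η ⋖ η ⊔ μ' := by
    apply covBy_sup_of_inf_covBy_right
    rwa [hinf]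
  -- The two diagonals of the transposed square have equal unions and equal intersections, which
  -- forces the two covers to have the same differences.
  have key : ∀ e, (e ∈ m (η ⊔ μ') ∨ e ∈ m μ ↔ e ∈ m η ∨ e ∈ m μ') ∧
      (e ∈ m (η ⊔ μ') ∧ e ∈ m μ ↔ e ∈ m η ∧ e ∈ m μ') := fun e => by
    have h1 := h.mem_sup_or_mem_inf (a := η) (b := μ') (e := e)
    have h2 := h.mem_sup_and_mem_inf (a := η) (b := μ') (e := e)
    rw [hinf] at h1 h2
    exact ⟨h1, h2⟩
  have e1 : m η \ m (η ⊔ μ') = m μ \ m μ' := by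
    ext e
    have := key e
    simp only [Finset.mem_sdiff]
    tauto
  have e2 : m (η ⊔ μ') \ m η = m μ' \ m μ := by
    ext e
    have := key e
    simp only [Finset.mem_sdiff]
    tauto
  have e3 : above m (η ⊔ μ') = above m η \ ↑(m μ \ m μ') := by
    rw [← e1]
    have := h.above_diff_of_covBy hcov
    have hsub : above m (η ⊔ μ') ⊆ above m η := above_anti le_sup_left
    ext e
    have h3 := Set.ext_iff.1 this e
    simp only [Set.mem_sdiff, Set.mem_ofPred_eq] at h3
    simp only [Set.mem_sdiff, Finset.mem_coe, Finset.mem_sdiff]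
    have := @hsub e
    tauto
  -- The last claim says that `η ⊔ μ'` is the only upper cover of `η`. The pair `a` is in `above m
  -- η` but neither in `above m ξ` nor in `above m (η ⊔ μ')`, so `ξ ⊓ (η ⊔ μ')` cannot be `η`.
  refine ⟨η ⊔ μ', hcov, e1, e2, e3, fun ξ hξ => ?_⟩
  rw [← h.above_subset_iff, e3]
  intro k hk
  refine ⟨above_anti hξ.le hk, fun hkK => ?_⟩
  have haξ : a ∉ above m ξ := fun h' => hξ.not_ge (hgr ξ h')
  -- `ξ ⊓ (η ⊔ μ')` is `η` or `η ⊔ μ'`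
  rcases hcov.eq_or_eq (le_inf hξ.le hcov.le) inf_le_right with h1 | h1
  · have : a ∈ above m (ξ ⊓ (η ⊔ μ')) := h1.symm ▸ hη
    rw [h.above_inf] at this
    refine this.elim haξ fun h2 => ?_
    rw [e3] at h2
    exact h2.2 (by simp [ha, ha'])
  · have h2 := above_anti (m := m) (inf_eq_right.1 h1) hk
    rw [e3] at h2
    exact h2.2 hkK

end DistribLattice

end IsSetLattice

namespace IsSetLattice

/-! ### Rotations -/

/-- The pairs of differences along the covers of the lattice. -/
def IsRotation {S E : Type*} [Lattice S] [DecidableEq E] (m : S → Finset E)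
    (ρ : Finset E × Finset E) : Prop :=
  ∃ μ μ' : S, μ ⋖ μ' ∧ ρ = (m μ \ m μ', m μ' \ m μ)

/-- `η` is the greatest member at which `ρ` has been performed. -/
structure IsBase {S E : Type*} [Lattice S] [DecidableEq E] (m : S → Finset E)
    (ρ : Finset E × Finset E) (η : S) : Prop where
  plus_iff : ∀ a, a ∈ ρ.1 ↔ ∀ ν, a ∈ above m ν ↔ ν ≤ η
  minus_iff : ∀ b, b ∈ ρ.2 ↔ ∀ ν, b ∈ passed m ν ↔ ν ≤ η
  plus_nonempty : ρ.1.Nonempty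
  minus_nonempty : ρ.2.Nonempty
  plus_subset : ρ.1 ⊆ m η
  exists_gt : ∃ η', η < η' ∧ above m η' = above m η \ ↑ρ.1

section Rotation

variable {S E : Type*} [DistribLattice S] [Finite S] [DecidableEq E] {m : S → Finset E}
  (h : IsSetLattice m)
include h

/-- The base is the greatest `η` whose `above` contains one chosen entering pair. Since everything
strictly above `η` is above its upper cover `η'`, all other pairs of the rotation, entering or
leaving, have the same threshold `η`. -/
theorem IsRotation.exists_base {ρ : Finset E × Finset E} (hρ : IsRotation m ρ) :
    ∃ η, IsBase m ρ η := by
  obtain ⟨μ, μ', hc, rfl⟩ := hρ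
  obtain ⟨a, ha, ha'⟩ := h.exists_mem_notMem hc.lt.ne
  obtain ⟨b, hb, hb'⟩ := h.exists_mem_notMem hc.lt.ne'
  obtain ⟨η, hη, hgr⟩ := exists_greatest (p := fun ν => a ∈ above m ν)
    (fun x y hx hy => h.above_sup x y ▸ ⟨hx, hy⟩) (subset_above μ ha)
  obtain ⟨η', hcov, e1, e2, e3, hpred⟩ := h.covBy_greatest hc ha ha' hη hgr
  have hplus : ∀ a, a ∈ m η \ m η' ↔ ∀ ν, a ∈ above m ν ↔ ν ≤ η := by
    intro x
    constructor
    · intro hx ν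
      have hxη : x ∈ above m η := subset_above _ (Finset.mem_sdiff.1 hx).1
      refine ⟨fun hxν => ?_, fun hν => above_anti hν hxη⟩
      by_contra hn
      have h1 := above_anti (hpred (ν ⊔ η) (lt_of_le_of_ne le_sup_right
        fun heq => hn (sup_eq_right.1 heq.symm)))
        (h.above_sup ν η ▸ ⟨hxν, hxη⟩ : x ∈ above m (ν ⊔ η))
      rw [e3, ← e1] at h1
      exact h1.2 hx
    · intro hx
      have := h.above_diff_of_covBy hcov
      have h1 : x ∈ above m η \ above m η' :=
        ⟨(hx η).2 le_rfl, fun h' => hcov.lt.not_ge ((hx η').1 h')⟩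
      rw [this] at h1
      exact Finset.mem_sdiff.2 h1
  have hminus : ∀ b, b ∈ m η' \ m η ↔ ∀ ν, b ∈ passed m ν ↔ ν ≤ η := by
    intro x
    have hdiff := Set.ext_iff.1 (h.passed_diff_of_covBy hcov) x
    simp only [Set.mem_sdiff, Set.mem_ofPred_eq] at hdiff
    rw [Finset.mem_sdiff, ← hdiff]
    constructor
    · intro hx ν
      refine ⟨fun hxν => ?_, fun hν => h.passed_anti hν hx.1⟩
      by_contra hn
      exact hx.2 (h.passed_anti (hpred (ν ⊔ η) (lt_of_le_of_ne le_sup_right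
        fun heq => hn (sup_eq_right.1 heq.symm))) (h.passed_sup hxν hx.1))
    · intro hx
      exact ⟨(hx η).2 le_rfl, fun h' => hcov.lt.not_ge ((hx η').1 h')⟩
  rw [← e1, ← e2]
  exact ⟨η, hplus, hminus, ⟨a, by rw [e1]; simp [ha, ha']⟩, ⟨b, by rw [e2]; simp [hb, hb']⟩,
    Finset.sdiff_subset, η', hcov.lt, by rw [e3, e1]⟩

omit h [Finite S] in
theorem IsBase.ext {ρ₁ ρ₂ : Finset E × Finset E} {η : S} (h₁ : IsBase m ρ₁ η)
    (h₂ : IsBase m ρ₂ η) : ρ₁ = ρ₂ :=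
  Prod.ext (Finset.ext fun a => by rw [h₁.plus_iff, h₂.plus_iff])
    (Finset.ext fun a => by rw [h₁.minus_iff, h₂.minus_iff])

omit h [Finite S] in
theorem IsBase.eq_of_mem_plus {ρ₁ ρ₂ : Finset E × Finset E} {η₁ η₂ : S} (h₁ : IsBase m ρ₁ η₁)
    (h₂ : IsBase m ρ₂ η₂) {a : E} (ha₁ : a ∈ ρ₁.1) (ha₂ : a ∈ ρ₂.1) : ρ₁ = ρ₂ := by
  have e1 := (h₁.plus_iff a).1 ha₁
  have e2 := (h₂.plus_iff a).1 ha₂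
  obtain rfl := le_antisymm ((e2 _).1 ((e1 _).2 le_rfl)) ((e1 _).1 ((e2 _).2 le_rfl))
  exact h₁.ext h₂

omit h [Finite S] in
theorem IsBase.subset_above_iff {ρ : Finset E × Finset E} {η : S} (hη : IsBase m ρ η) {ν : S} :
    ↑ρ.1 ⊆ above m ν ↔ ν ≤ η := by
  obtain ⟨a, ha⟩ := hη.plus_nonempty
  exact ⟨fun hs => ((hη.plus_iff a).1 ha ν).1 (hs ha),
    fun hν x hx => ((hη.plus_iff x).1 hx ν).2 hν⟩

omit h [Finite S] in
theorem IsBase.disjoint {ρ : Finset E × Finset E} {η : S} (hη : IsBase m ρ η) {a : E}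
    (ha : a ∈ ρ.1) : a ∉ ρ.2 := fun h' =>
  (((hη.minus_iff a).1 h' η).2 le_rfl).2 (hη.plus_subset ha)

omit h [Finite S] in
theorem IsBase.notMem_top [OrderTop S] {ρ : Finset E × Finset E} {η : S} (hη : IsBase m ρ η)
    {a : E} (ha : a ∈ ρ.1) : a ∉ m (⊤ : S) := fun h' => by
  obtain ⟨η', hlt, -⟩ := hη.exists_gt
  exact hlt.not_ge (le_top.trans (((hη.plus_iff a).1 ha ⊤).1 (subset_above _ h')))

/-- The rotation is read off at an upper cover of the greatest member whose `above` contains `a`. -/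
theorem exists_isRotation_plus [OrderTop S] {a : E} {μ : S} (ha : a ∈ above m μ)
    (hat : a ∉ m (⊤ : S)) : ∃ ρ, IsRotation m ρ ∧ a ∈ ρ.1 := by
  obtain ⟨η, hη, hgr⟩ := exists_greatest (p := fun ν => a ∈ above m ν)
    (fun x y hx hy => h.above_sup x y ▸ ⟨hx, hy⟩) ha
  have hne : η ≠ ⊤ := by
    rintro rfl
    rw [above_top] at hη
    exact hat hη
  obtain ⟨η', hc⟩ := exists_covBy hne
  have h1 : a ∈ above m η \ above m η' := ⟨hη, fun h' => hc.lt.not_ge (hgr _ h')⟩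
  rw [h.above_diff_of_covBy hc] at h1
  exact ⟨_, ⟨η, η', hc, rfl⟩, Finset.mem_sdiff.2 h1⟩

theorem exists_isRotation_minus [OrderTop S] {b : E} {μ : S} (hb : b ∈ passed m μ) :
    ∃ ρ, IsRotation m ρ ∧ b ∈ ρ.2 := by
  obtain ⟨η, hη, hgr⟩ := exists_greatest (p := fun ν => b ∈ passed m ν)
    (fun x y hx hy => h.passed_sup hx hy) hb
  have hne : η ≠ ⊤ := by
    rintro rfl
    have := hη.1
    rw [above_top] at this
    exact hη.2 this
  obtain ⟨η', hc⟩ := exists_covBy hne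
  have h1 : b ∈ passed m η \ passed m η' := ⟨hη, fun h' => hc.lt.not_ge (hgr _ h')⟩
  rw [h.passed_diff_of_covBy hc] at h1
  exact ⟨_, ⟨η, η', hc, rfl⟩, Finset.mem_sdiff.2 h1⟩

/-! ### Minimal differences -/

open AffineRep

-- `above` reverses the order, so the least set of the family that contains `a` belongs to the
-- greatest member.
omit h [Finite S] [DecidableEq E] in
theorem minContaining_eq {a : E} {η : S} (ha : ∀ ν, a ∈ above m ν ↔ ν ≤ η) :
    minContaining (Set.range (above m)) a = above m η := by
  apply Set.Subset.antisymm
  · exact Set.sInter_subset_of_mem ⟨⟨η, rfl⟩, (ha η).2 le_rfl⟩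
  · rintro x hx _ ⟨⟨ν, rfl⟩, hν⟩
    exact above_anti ((ha ν).1 hν) hx

theorem exists_minContaining {a : E} (ha : a ∈ ⋃₀ Set.range (above m)) :
    ∃ η, (∀ ν, a ∈ above m ν ↔ ν ≤ η) ∧ minContaining (Set.range (above m)) a = above m η := by
  obtain ⟨_, ⟨μ, rfl⟩, hμ⟩ := ha
  obtain ⟨η, hη, hgr⟩ := exists_greatest (p := fun ν => a ∈ above m ν)
    (fun x y hx hy => h.above_sup x y ▸ ⟨hx, hy⟩) hμ
  have : ∀ ν, a ∈ above m ν ↔ ν ≤ η := fun ν => ⟨hgr ν, fun hν => above_anti hν hη⟩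
  exact ⟨η, this, minContaining_eq this⟩

theorem centers_eq {ρ : Finset E × Finset E} {η : S} (hη : IsBase m ρ η) :
    centers (Set.range (above m)) (above m η) = ↑ρ.1 := by
  ext a
  constructor
  · rintro ⟨ha, hmin⟩
    obtain ⟨η', hη', he⟩ := h.exists_minContaining ha
    obtain rfl := h.above_injective (he.symm.trans hmin)
    exact (hη.plus_iff a).2 hη'
  · intro ha
    have := (hη.plus_iff a).1 ha
    exact ⟨⟨_, ⟨η, rfl⟩, (this η).2 le_rfl⟩, minContaining_eq this⟩

/-- Any center of an irreducible set recovers it as `H(a)`, so the irreducible set with centers `ρ⁺`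
is `above m η`. It is not the minimal member of the family because some `η'` lies strictly above
`η`. -/
theorem minDiffGE_iff {ρ₁ ρ₂ : Finset E × Finset E} {η₁ η₂ : S} (h₁ : IsBase m ρ₁ η₁)
    (h₂ : IsBase m ρ₂ η₂) :
    MinDiffGE (Set.range (above m)) ↑ρ₁.1 ↑ρ₂.1 ↔ η₂ ≤ η₁ := by
  have key : ∀ {ρ : Finset E × Finset E} {η : S}, IsBase m ρ η →
      ∀ h ∈ irreducibles (Set.range (above m)), centers (Set.range (above m)) h = ↑ρ.1 →
        h = above m η := by
    rintro ρ η hη I - hI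
    obtain ⟨a, ha⟩ := hη.plus_nonempty
    have h1 : a ∈ centers (Set.range (above m)) I := hI ▸ ha
    rw [← h1.2, minContaining_eq ((hη.plus_iff a).1 ha)]
  have irr : ∀ {ρ : Finset E × Finset E} {η : S}, IsBase m ρ η →
      above m η ∈ irreducibles (Set.range (above m)) ∧ above m η ≠ ⋂₀ Set.range (above m) := by
    intro ρ η hη
    obtain ⟨a, ha⟩ := hη.plus_nonempty
    have h1 := (hη.plus_iff a).1 ha
    refine ⟨⟨⟨η, rfl⟩, a, ⟨_, ⟨η, rfl⟩, (h1 η).2 le_rfl⟩, (minContaining_eq h1).symm⟩, fun he => ?_⟩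
    obtain ⟨η', hlt, -⟩ := hη.exists_gt
    have h2 : a ∈ ⋂₀ Set.range (above m) := he ▸ (h1 η).2 le_rfl
    exact hlt.not_ge ((h1 η').1 (Set.mem_sInter.1 h2 _ ⟨η', rfl⟩))
  constructor
  · rintro ⟨I₁, hI₁, I₂, hI₂, -, -, hc₁, hc₂, hsub⟩
    rw [key h₁ _ hI₁ hc₁, key h₂ _ hI₂ hc₂] at hsub
    exact h.above_subset_iff.1 hsub
  · intro hle
    exact ⟨_, (irr h₁).1, _, (irr h₂).1, (irr h₁).2, (irr h₂).2, h.centers_eq h₁, h.centers_eq h₂,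
      h.above_subset_iff.2 hle⟩

/-! ### The representation -/

variable {p : Finset E × Finset E → Prop} (hp : ∀ ρ, p ρ ↔ IsRotation m ρ)
include hp

/-- The greatest member at which a rotation has been performed. -/
noncomputable def base (ρ : {ρ // p ρ}) : S :=
  (IsRotation.exists_base h ((hp ρ.1).1 ρ.2)).choose

theorem base_spec (ρ : {ρ // p ρ}) : IsBase m ρ.1 (h.base hp ρ) :=
  (IsRotation.exists_base h ((hp ρ.1).1 ρ.2)).choose_spec

theorem base_injective : Function.Injective (h.base hp) := fun ρ₁ ρ₂ he =>
  Subtype.ext (IsBase.ext (h.base_spec hp ρ₁) (he ▸ h.base_spec hp ρ₂))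

variable [OrderTop S]

omit hp [Finite S] in
theorem above_finset_inf {ι : Type*} (s : Finset ι) (f : ι → S) {a : E}
    (ha : a ∈ above m (s.inf f)) : a ∈ m (⊤ : S) ∨ ∃ i ∈ s, a ∈ above m (f i) := by
  classical
  induction s using Finset.induction_on with
  | empty => rw [Finset.inf_empty, above_top] at ha; exact Or.inl ha
  | insert i s _ ih =>
    rw [Finset.inf_insert, h.above_inf] at ha
    rcases ha with ha | ha
    · exact Or.inr ⟨i, Finset.mem_insert_self _ _, ha⟩
    · rcases ih ha with h1 | ⟨j, hj, h1⟩
      · exact Or.inl h1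
      · exact Or.inr ⟨j, Finset.mem_insert_of_mem hj, h1⟩

/-- A pair of `above m μ` outside the top enters in some rotation, and the base of this rotation
decides in which sets `above m ν` the pair lies. -/
theorem le_iff_forall_base {μ ν : S} :
    ν ≤ μ ↔ ∀ ρ, μ ≤ h.base hp ρ → ν ≤ h.base hp ρ := by
  refine ⟨fun hle ρ => hle.trans, fun hρ => ?_⟩
  rw [← h.above_subset_iff]
  intro a ha
  by_cases hat : a ∈ m (⊤ : S)
  · exact above_anti le_top (subset_above _ hat)
  · obtain ⟨ρ, hr, haρ⟩ := h.exists_isRotation_plus ha hat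
    have hb := ((h.base_spec hp ⟨ρ, (hp ρ).2 hr⟩).plus_iff a).1 haρ
    exact (hb ν).2 (hρ _ ((hb μ).1 ha))

/-- The witness is the meet of the bases of `U`. As `above` turns this meet into a union, a base
above the meet is above one of the bases of `U`. -/
theorem exists_forall_base_iff (U : Set {ρ // p ρ})
    (hU : ∀ ρ ∈ U, ∀ ρ', h.base hp ρ ≤ h.base hp ρ' → ρ' ∈ U) :
    ∃ μ : S, ∀ ρ, μ ≤ h.base hp ρ ↔ ρ ∈ U := by
  classical
  have hfin : U.Finite := Set.Finite.of_injOn (f := h.base hp) (t := Set.univ)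
    (fun _ _ => trivial) (h.base_injective hp).injOn Set.finite_univ
  refine ⟨hfin.toFinset.inf (h.base hp), fun ρ => ⟨fun hle => ?_, fun hρ => ?_⟩⟩
  · have hs := h.base_spec hp ρ
    obtain ⟨a, ha⟩ := hs.plus_nonempty
    have h1 := (hs.plus_iff a).1 ha
    rcases h.above_finset_inf _ _ ((h1 _).2 hle) with h2 | ⟨ρ', hρ', h2⟩
    · exact absurd h2 (hs.notMem_top ha)
    · exact hU ρ' (by simpa using hρ') ρ ((h1 _).1 h2)
  · exact Finset.inf_le (by simpa using hρ)

-- Descending along a cover performs exactly one more rotation, the one that the cover defines.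
omit hp [Finite S] [OrderTop S] in
theorem base_covBy {μ μ' : S} (hc : μ ⋖ μ') {η : S}
    (hη : IsBase m (m μ \ m μ', m μ' \ m μ) η) (ν : S) :
    μ ≤ ν → (∃ ρ, IsBase m ρ ν) → (¬ μ' ≤ ν ↔ ν = η) := by
  rintro hμ ⟨ρ, hρ⟩
  obtain ⟨a, ha⟩ := hη.plus_nonempty
  have h1 := (hη.plus_iff a).1 ha
  simp only [Finset.mem_sdiff] at ha
  constructor
  · intro hn
    obtain ⟨c, hcρ⟩ := hρ.plus_nonempty
    have h2 := (hρ.plus_iff c).1 hcρ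
    have h3 : c ∈ above m μ \ above m μ' := ⟨(h2 μ).2 hμ, fun h' => hn ((h2 μ').1 h')⟩
    rw [h.above_diff_of_covBy hc] at h3
    have h4 := (hη.plus_iff c).1 (Finset.mem_sdiff.2 h3)
    exact le_antisymm ((h4 _).1 ((h2 _).2 le_rfl)) ((h2 _).1 ((h4 _).2 le_rfl))
  · rintro rfl hle
    have : a ∈ above m μ' := (h1 _).2 hle
    exact ha.2 (h.mem_of_le hc.le ha.1 this)

/-- Induction from the top downwards: at `μ ⋖ μ'` the characteristic vector changes by the column of
the one rotation that is added. -/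
theorem charVec_eq [Fintype {ρ // p ρ}] (μ : S) (e : E) :
    charVec (m μ : Set E) e = charVec (m (⊤ : S) : Set E) e +
      ∑ ρ : {ρ // p ρ}, (charVec (ρ.1.1 : Set E) e - charVec (ρ.1.2 : Set E) e) *
        charVec {ρ | μ ≤ h.base hp ρ} ρ := by
  classical
  induction μ using (wellFounded_gt (α := S)).induction with
  | _ μ ih =>
    by_cases hμ : μ = ⊤
    · subst hμ
      rw [Finset.sum_eq_zero, add_zero]
      intro ρ _
      rw [charVec, charVec, charVec, Set.indicator_of_notMem (a := ρ), mul_zero]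
      intro hle
      obtain ⟨η', hlt, -⟩ := (h.base_spec hp ρ).exists_gt
      exact hlt.not_ge (le_top.trans hle)
    · obtain ⟨μ', hc⟩ := exists_covBy hμ
      have hr : IsRotation m (m μ \ m μ', m μ' \ m μ) := ⟨μ, μ', hc, rfl⟩
      let r : {ρ // p ρ} := ⟨_, (hp _).2 hr⟩
      have hrb : IsBase m (m μ \ m μ', m μ' \ m μ) (h.base hp r) := h.base_spec hp r
      have hle : μ ≤ h.base hp r := by
        rw [← hrb.subset_above_iff]
        exact fun x hx => subset_above _ (Finset.mem_sdiff.1 hx).1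
      have hind : ∀ ρ, charVec {ρ | μ ≤ h.base hp ρ} ρ =
          charVec {ρ | μ' ≤ h.base hp ρ} ρ + if ρ = r then 1 else 0 := by
        intro ρ
        simp only [charVec, Set.indicator_apply, Set.mem_ofPred_eq, Pi.one_apply]
        have key := h.base_covBy hc hrb (h.base hp ρ)
        by_cases h1 : μ ≤ h.base hp ρ
        · have h2 := key h1 ⟨_, h.base_spec hp ρ⟩
          by_cases h3 : ρ = r
          · subst h3
            simp [h1, h2.2 rfl]
          · have : μ' ≤ h.base hp ρ := by
              by_contra h4
              exact h3 (h.base_injective hp (h2.1 h4))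
            simp [h1, h3, this]
        · have h3 : ρ ≠ r := fun he => h1 (he ▸ hle)
          have : ¬ μ' ≤ h.base hp ρ := fun h4 => h1 (hc.le.trans h4)
          simp [h1, h3, this]
      simp only [hind, mul_add, Finset.sum_add_distrib, ← add_assoc]
      rw [← ih μ' hc.lt]
      simp only [mul_ite, mul_one, mul_zero, Finset.sum_ite_eq', Finset.mem_univ, if_true, r]
      by_cases h1 : e ∈ m μ <;> by_cases h2 : e ∈ m μ' <;>
        simp [charVec, h1, h2]

-- The system is triangular. In the row of a pair of `ρ₀⁺` another rotation has a nonzero entry only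
-- if the pair leaves in it, and then its base is strictly below that of `ρ₀`. So `ρ₀` is taken with
-- minimal base among the nonzero coefficients.
omit [OrderTop S] in
theorem eq_zero_of_sum_eq_zero [Fintype {ρ // p ρ}] (u : {ρ // p ρ} → ℝ)
    (hu : ∀ ρ₀ : {ρ // p ρ}, ∀ e ∈ ρ₀.1.1, ∑ ρ : {ρ // p ρ},
      (charVec (ρ.1.1 : Set E) e - charVec (ρ.1.2 : Set E) e) * u ρ = 0) : u = 0 := by
  classical
  by_contra hne
  obtain ⟨ρ₁, hρ₁⟩ : ∃ ρ, u ρ ≠ 0 := Function.ne_iff.1 hne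
  obtain ⟨η, ⟨⟨ρ₀, hρ₀, rfl⟩, hmin⟩⟩ := Set.Finite.exists_minimal
    (Set.toFinite (h.base hp '' {ρ | u ρ ≠ 0})) ⟨_, ρ₁, hρ₁, rfl⟩
  have hs := h.base_spec hp ρ₀
  obtain ⟨a, ha⟩ := hs.plus_nonempty
  have h0 := hu ρ₀ a ha
  rw [Finset.sum_eq_single ρ₀] at h0
  · have hd := hs.disjoint ha
    simp [charVec, ha, hd] at h0
    exact hρ₀ h0
  · intro ρ _ hρne
    by_cases huρ : u ρ = 0
    · simp [huρ]
    have hsρ := h.base_spec hp ρ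
    have h1 : a ∉ ρ.1.1 := fun h' => hρne (Subtype.ext (hsρ.eq_of_mem_plus hs h' ha))
    have h2 : a ∉ ρ.1.2 := fun h' => by
      have h3 := (((hsρ.minus_iff a).1 h' _).2 le_rfl).1
      have h4 := (((hs.plus_iff a).1 ha _).1 h3)
      exact hρne (h.base_injective hp (le_antisymm h4 (hmin ⟨ρ, huρ, rfl⟩ h4)))
    simp [charVec, h1, h2]
  · simp

end Rotation

end IsSetLattice

/-! ## Choice functions of all agents of a side -/

namespace PathIndependent

section Transport

variable {E E' : Type*} [DecidableEq E] [DecidableEq E']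

theorem IsChoice.map_equiv {C : Finset E → Finset E} (h : IsChoice C) (e : E' ≃ E) :
    IsChoice fun X : Finset E' => (C (X.map e.toEmbedding)).map e.symm.toEmbedding where
  subset S x hx := by
    rw [Finset.mem_map_equiv] at hx
    simpa using h.subset _ hx
  subst S b hb T hT := by
    rw [Finset.mem_map_equiv] at hb ⊢
    have := h.subst _ _ hb (T.map e.toEmbedding) (Finset.map_subset_map.2 hT)
    rw [Finset.map_insert]
    simpa using this
  cons S T h1 h2 := by
    congr 1
    refine h.cons _ _ (fun x hx => ?_) (Finset.map_subset_map.2 h2)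
    rw [Finset.mem_map_equiv]
    exact h1 (by simpa using hx)
  mono S T hST := by
    rw [Finset.card_map, Finset.card_map]
    exact h.mono _ _ (Finset.map_subset_map.2 hST)

end Transport

section Glue

variable {α β : Type*} [DecidableEq α] [DecidableEq β] [Fintype α] [Fintype β]

/-- The union of the choices of all agents `a : α` from a set of pairs. -/
def glue (acc : Finset (α × β)) (c : α → Finset β → Finset β) (X : Finset (α × β)) :
    Finset (α × β) :=
  Finset.univ.filter fun p => p.2 ∈ c p.1 (Market.atFirm (X ∩ acc) p.1)

variable {acc : Finset (α × β)} {c : α → Finset β → Finset β}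

omit [Fintype α] in
theorem mem_atFirm {X : Finset (α × β)} {a : α} {b : β} : b ∈ Market.atFirm X a ↔ (a, b) ∈ X := by
  simp [Market.atFirm]

omit [Fintype β] in
theorem mem_atWorker {X : Finset (α × β)} {a : α} {b : β} :
    a ∈ Market.atWorker X b ↔ (a, b) ∈ X := by
  simp [Market.atWorker]

omit [Fintype α] in
theorem atFirm_mono {X Y : Finset (α × β)} (h : X ⊆ Y) (a : α) :
    Market.atFirm X a ⊆ Market.atFirm Y a := fun _ hb => mem_atFirm.2 (h (mem_atFirm.1 hb))

omit [Fintype α] in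
theorem atFirm_insert (X : Finset (α × β)) (a : α) (b : β) :
    Market.atFirm (insert (a, b) X) a = insert b (Market.atFirm X a) := by
  ext x; simp [mem_atFirm]

theorem mem_glue {X : Finset (α × β)} {a : α} {b : β} :
    (a, b) ∈ glue acc c X ↔ b ∈ c a (Market.atFirm (X ∩ acc) a) := by
  simp [glue]

theorem mem_glue_of_subset {X : Finset (α × β)} (h : X ⊆ acc) {a : α} {b : β} :
    (a, b) ∈ glue acc c X ↔ b ∈ c a (Market.atFirm X a) := by
  rw [mem_glue, Finset.inter_eq_left.2 h]

theorem mem_glue_insert {X : Finset (α × β)} (h : X ⊆ acc) {a : α} {b : β} (hab : (a, b) ∈ acc) :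
    (a, b) ∈ glue acc c (insert (a, b) X) ↔ b ∈ c a (insert b (Market.atFirm X a)) := by
  rw [mem_glue_of_subset (Finset.insert_subset hab h), atFirm_insert]

variable (hc : ∀ a, ∀ S ⊆ Market.atFirm acc a, c a S ⊆ S)
include hc

theorem glue_subset_inter (X : Finset (α × β)) : glue acc c X ⊆ X ∩ acc := by
  rintro ⟨a, b⟩ h
  exact mem_atFirm.1 (hc a _ (atFirm_mono Finset.inter_subset_right a) (mem_glue.1 h))

omit hc in
theorem card_glue (X : Finset (α × β)) :
    (glue acc c X).card = ∑ a, (c a (Market.atFirm (X ∩ acc) a)).card := by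
  rw [Finset.card_eq_sum_card_fiberwise (f := Prod.fst) (t := Finset.univ) (by simp)]
  refine Finset.sum_congr rfl fun a _ => ?_
  refine Finset.card_bij (fun p _ => p.2) ?_ ?_ ?_
  · rintro ⟨a', b⟩ h
    simp only [Finset.mem_filter] at h
    obtain ⟨h, rfl⟩ := h
    exact mem_glue.1 h
  · rintro ⟨a₁, b₁⟩ h₁ ⟨a₂, b₂⟩ h₂ heq
    simp only [Finset.mem_filter] at h₁ h₂
    exact Prod.ext (h₁.2.trans h₂.2.symm) heq
  · intro b hb
    exact ⟨(a, b), by simpa [mem_glue] using hb, rfl⟩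

/-- The properties hold agent by agent, and sizes add up over the agents. The intersection with
`acc` in `glue` keeps every argument inside the domain on which the properties are assumed, while
the glued function is total. -/
theorem glue_isChoice (hs : ∀ a, Choice.Substitutable (Market.atFirm acc a) (c a))
    (hk : ∀ a, Choice.Consistent (Market.atFirm acc a) (c a))
    (hm : ∀ a, Choice.CardinalMonotone (Market.atFirm acc a) (c a)) :
    IsChoice (glue acc c) where
  subset X := (glue_subset_inter hc X).trans Finset.inter_subset_left
  subst := by
    rintro S ⟨a, b⟩ hb T hT
    have hacc := (Finset.mem_inter.1 (glue_subset_inter hc S hb)).2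
    rw [mem_glue] at hb ⊢
    rw [Finset.insert_inter_of_mem hacc, atFirm_insert]
    exact hs a _ (atFirm_mono Finset.inter_subset_right a) b hb _
      (atFirm_mono (Finset.inter_subset_inter_right hT) a)
  cons S T h1 h2 := by
    ext ⟨a, b⟩
    rw [mem_glue, mem_glue, hk a _ (atFirm_mono Finset.inter_subset_right a)
      (Market.atFirm (T ∩ acc) a) ?_ (atFirm_mono (Finset.inter_subset_inter_right h2) a)]
    intro x hx
    have hx' : (a, x) ∈ glue acc c S := mem_glue.2 hx
    exact mem_atFirm.2 (Finset.mem_inter.2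
      ⟨h1 hx', (Finset.mem_inter.1 (glue_subset_inter hc S hx')).2⟩)
  mono S T hST := by
    rw [card_glue, card_glue]
    exact Finset.sum_le_sum fun a _ => hm a _ (atFirm_mono Finset.inter_subset_right a) _
      (atFirm_mono (Finset.inter_subset_inter_right hST) a)

end Glue

end PathIndependent

/-! ### Stable matchings as stable sets for the two glued choice functions -/

namespace Market

open PathIndependent IsSetLattice AffineRep

variable {F W : Type*} [DecidableEq F] [DecidableEq W] [Fintype F] [Fintype W] (M : Market F W)

/-- The union of the choices of all firms from a set of pairs. -/
def firmChoice : Finset (F × W) → Finset (F × W) := glue M.acc M.choiceF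

/-- The union of the choices of all workers from a set of pairs. -/
def workerChoice (X : Finset (F × W)) : Finset (F × W) :=
  (glue (M.acc.map (Equiv.prodComm F W).toEmbedding) M.choiceW
    (X.map (Equiv.prodComm F W).toEmbedding)).map (Equiv.prodComm F W).symm.toEmbedding

omit [Fintype W] in
theorem atFirm_map_swap (X : Finset (F × W)) (w : W) :
    atFirm (X.map (Equiv.prodComm F W).toEmbedding) w = atWorker X w := by
  ext f
  simp [mem_atFirm, mem_atWorker]

variable {M}

theorem mem_workerChoice {X : Finset (F × W)} (h : X ⊆ M.acc) {f : F} {w : W} :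
    (f, w) ∈ M.workerChoice X ↔ f ∈ M.choiceW w (atWorker X w) := by
  rw [workerChoice, Finset.mem_map_equiv]
  simp only [Equiv.symm_symm, Equiv.prodComm_apply, Prod.swap_prod_mk]
  rw [mem_glue_of_subset (Finset.map_subset_map.2 h), atFirm_map_swap]

theorem mem_firmChoice {X : Finset (F × W)} (h : X ⊆ M.acc) {f : F} {w : W} :
    (f, w) ∈ M.firmChoice X ↔ w ∈ M.choiceF f (atFirm X f) := mem_glue_of_subset h

theorem mem_firmChoice_insert {X : Finset (F × W)} (h : X ⊆ M.acc) {f : F} {w : W}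
    (hfw : (f, w) ∈ M.acc) :
    (f, w) ∈ M.firmChoice (insert (f, w) X) ↔ w ∈ M.choiceF f (insert w (atFirm X f)) :=
  mem_glue_insert h hfw

omit [Fintype W] in
theorem atWorker_insert (X : Finset (F × W)) (f : F) (w : W) :
    atWorker (insert (f, w) X) w = insert f (atWorker X w) := by
  ext x; simp [mem_atWorker]

theorem mem_workerChoice_insert {X : Finset (F × W)} (h : X ⊆ M.acc) {f : F} {w : W}
    (hfw : (f, w) ∈ M.acc) :
    (f, w) ∈ M.workerChoice (insert (f, w) X) ↔ f ∈ M.choiceW w (insert f (atWorker X w)) := by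
  rw [mem_workerChoice (Finset.insert_subset hfw h), atWorker_insert]

theorem firmChoice_subset_acc (X : Finset (F × W)) : M.firmChoice X ⊆ M.acc :=
  (glue_subset_inter M.choiceF_subset X).trans Finset.inter_subset_right

theorem IsCM.firmChoice (hM : M.IsCM) : IsChoice M.firmChoice :=
  glue_isChoice M.choiceF_subset hM.substF hM.consF hM.cardF

theorem IsCM.workerChoice (hM : M.IsCM) : IsChoice M.workerChoice := by
  refine (glue_isChoice ?_ ?_ ?_ ?_).map_equiv _ <;> simp only [atFirm_map_swap]
  exacts [M.choiceW_subset, hM.substW, hM.consW, hM.cardW]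

theorem isStable_iff (μ : Finset (F × W)) :
    M.IsStable μ ↔ Stab M.firmChoice M.workerChoice μ := by
  constructor
  · rintro ⟨h0, h1, h2, h3⟩
    refine ⟨?_, ?_, ?_⟩
    · ext ⟨f, w⟩
      rw [mem_firmChoice h0, h1, mem_atFirm]
    · ext ⟨f, w⟩
      rw [mem_workerChoice h0, h2, mem_atWorker]
    · rintro ⟨f, w⟩ he ⟨hf, hw⟩
      have hacc := M.firmChoice_subset_acc _ hf
      exact h3 f w hacc he ⟨(mem_firmChoice_insert h0 hacc).1 hf,
        (mem_workerChoice_insert h0 hacc).1 hw⟩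
  · rintro ⟨h1, h2, h3⟩
    have h0 : μ ⊆ M.acc := h1 ▸ M.firmChoice_subset_acc μ
    refine ⟨h0, fun f => ?_, fun w => ?_, fun f w hacc he hb => ?_⟩
    · ext w
      rw [← mem_firmChoice h0, h1, mem_atFirm]
    · ext f
      rw [← mem_workerChoice h0, h2, mem_atWorker]
    · exact h3 _ he ⟨(mem_firmChoice_insert h0 hacc).2 hb.1,
        (mem_workerChoice_insert h0 hacc).2 hb.2⟩

theorem dominates_iff (μ ν : M.StableMatching) :
    M.Dominates μ ν ↔ M.firmChoice (μ.1 ∪ ν.1) = μ.1 := by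
  have h0 : μ.1 ∪ ν.1 ⊆ M.acc := Finset.union_subset μ.2.subset_acc ν.2.subset_acc
  have hu : ∀ f, atFirm (μ.1 ∪ ν.1) f = atFirm μ.1 f ∪ atFirm ν.1 f := fun f => by
    ext w; simp [mem_atFirm]
  constructor
  · intro h
    ext ⟨f, w⟩
    rw [mem_firmChoice h0, hu, h f, mem_atFirm]
  · intro h f
    ext w
    rw [← hu, ← mem_firmChoice h0, h, mem_atFirm]

/-! ### The lattice of stable matchings -/

variable (M) in
/-- The stable matchings, to be ordered by domination. -/
def StableLattice (_ : M.IsCM) : Type _ := M.StableMatching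

variable (hM : M.IsCM)

/-- The pairs of a stable matching. -/
def pairsOf (μ : M.StableLattice hM) : Finset (F × W) := Subtype.val (p := M.IsStable) μ

/-- A stable matching as an element of the lattice. -/
def toLattice (μ : M.StableMatching) : M.StableLattice hM := μ

theorem stab (μ : M.StableLattice hM) : Stab M.firmChoice M.workerChoice (pairsOf hM μ) :=
  (isStable_iff _).1 (Subtype.prop (p := M.IsStable) μ)

/-- A stable set of pairs as an element of the lattice. -/
def ofStab {μ : Finset (F × W)} (h : Stab M.firmChoice M.workerChoice μ) : M.StableLattice hM :=
  Subtype.mk (p := M.IsStable) μ ((isStable_iff μ).2 h)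

theorem pairsOf_injective : Function.Injective (pairsOf hM) := fun _ _ h => Subtype.ext h

instance : Finite (M.StableLattice hM) := inferInstanceAs (Finite M.StableMatching)

/-- Because interests are opposed, the order can be tested on either side; the laws of the meet thus
become those of the join with the two sides exchanged. -/
theorem firmChoice_eq_iff (μ ν : M.StableLattice hM) :
    M.firmChoice (pairsOf hM μ ∪ pairsOf hM ν) = pairsOf hM μ ↔
      M.workerChoice (pairsOf hM ν ∪ pairsOf hM μ) = pairsOf hM ν := by
  rw [Finset.union_comm (pairsOf hM ν)]
  refine ⟨(stab hM μ).choice_union_comm hM.firmChoice hM.workerChoice (stab hM ν), fun h => ?_⟩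
  rw [Finset.union_comm] at h ⊢
  exact (stab hM ν).symm.choice_union_comm hM.workerChoice hM.firmChoice (stab hM μ).symm h

noncomputable instance : Lattice (M.StableLattice hM) where
  le ν μ := M.firmChoice (pairsOf hM μ ∪ pairsOf hM ν) = pairsOf hM μ
  le_refl μ := by rw [Finset.union_self]; exact (stab hM μ).left
  le_trans a b c h1 h2 := dominates_trans hM.firmChoice h2 h1
  le_antisymm a b h1 h2 := pairsOf_injective hM (by
    rw [Finset.union_comm] at h1
    exact h2.symm.trans h1)
  sup μ ν := ofStab hM ((stab hM μ).join hM.firmChoice hM.workerChoice (stab hM ν))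
  inf μ ν := ofStab hM ((stab hM μ).meet hM.firmChoice hM.workerChoice (stab hM ν))
  le_sup_left a b := choice_union_dominates hM.firmChoice _ _
  le_sup_right a b := by
    have := choice_union_dominates hM.firmChoice (pairsOf hM b) (pairsOf hM a)
    rwa [Finset.union_comm (pairsOf hM b) (pairsOf hM a)] at this
  sup_le a b c h1 h2 := dominates_choice_union hM.firmChoice h1 h2
  inf_le_left a b := (firmChoice_eq_iff hM _ _).2 (choice_union_dominates hM.workerChoice _ _)
  inf_le_right a b := (firmChoice_eq_iff hM _ _).2 (by
    have := choice_union_dominates hM.workerChoice (pairsOf hM b) (pairsOf hM a)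
    rwa [Finset.union_comm (pairsOf hM b) (pairsOf hM a)] at this)
  le_inf a b c h1 h2 := (firmChoice_eq_iff hM _ _).2 (dominates_choice_union hM.workerChoice
    ((firmChoice_eq_iff hM _ _).1 h1) ((firmChoice_eq_iff hM _ _).1 h2))

theorem le_iff {μ ν : M.StableLattice hM} :
    ν ≤ μ ↔ M.firmChoice (pairsOf hM μ ∪ pairsOf hM ν) = pairsOf hM μ := Iff.rfl

theorem le_iff_workerChoice {μ ν : M.StableLattice hM} :
    ν ≤ μ ↔ M.workerChoice (pairsOf hM ν ∪ pairsOf hM μ) = pairsOf hM ν :=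
  firmChoice_eq_iff hM _ _

theorem dominates_iff_le {μ ν : M.StableMatching} :
    M.Dominates μ ν ↔ toLattice hM ν ≤ toLattice hM μ := dominates_iff μ ν

theorem pairsOf_inf (μ ν : M.StableLattice hM) :
    pairsOf hM (μ ⊓ ν) = M.workerChoice (pairsOf hM μ ∪ pairsOf hM ν) := rfl

theorem isSetLattice : IsSetLattice (pairsOf hM) where
  union_eq a b := (stab hM a).union_eq hM.firmChoice hM.workerChoice (stab hM b)
  inter_eq a b := (stab hM a).inter_eq hM.firmChoice hM.workerChoice (stab hM b)
  -- If `e` were missing from `b`, it would block `b`: the firms choose it from `c ∪ b` and the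
  -- workers from `a ∪ b`.
  convex a b c hab hbc e ha hc := by
    by_contra hb
    refine (stab hM b).not_blocked e hb ⟨?_, ?_⟩
    · exact hM.firmChoice.subst _ e (((le_iff hM).1 hbc).symm ▸ hc) _ Finset.subset_union_right
    · exact hM.workerChoice.subst _ e (((le_iff_workerChoice hM).1 hab).symm ▸ ha) _
        Finset.subset_union_right
  card_eq a b := (stab hM a).card_eq hM.firmChoice hM.workerChoice (stab hM b)
  injective := pairsOf_injective hM

noncomputable instance : DistribLattice (M.StableLattice hM) :=
  DistribLattice.ofInfSupLe (isSetLattice hM).inf_sup_le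

instance : Nonempty (M.StableLattice hM) := by
  obtain ⟨μ, hμ⟩ := exists_stab hM.firmChoice hM.workerChoice
  exact ⟨ofStab hM hμ⟩

noncomputable instance : OrderTop (M.StableLattice hM) where
  top := (exists_greatest (S := M.StableLattice hM) (p := fun _ => True) (fun _ _ _ _ => trivial)
    (μ := Classical.arbitrary _) trivial).choose
  le_top a := (exists_greatest (S := M.StableLattice hM) (p := fun _ => True)
    (fun _ _ _ _ => trivial) (μ := Classical.arbitrary _) trivial).choose_spec.2 a trivial

/-! ### Rotations of a market -/

/-- A pair of a stable `ν` which is outside `μ` and which its firm wants at `μ` lies in `ν ⊔ μ`.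
Otherwise it would lie in `ν ⊓ μ`, the workers' choice from `ν ∪ μ`, and so would block `μ`. -/
theorem pSet_eq (μ : M.StableMatching) : M.pSet μ = above (pairsOf hM) (toLattice hM μ) := by
  ext ⟨f, w⟩
  have hμ := μ.2.subset_acc
  constructor
  · rintro ⟨⟨ν, hν⟩, hc⟩
    have hacc := ν.2.subset_acc hν
    rw [← mem_firmChoice_insert hμ hacc] at hc
    by_cases hfw : (f, w) ∈ μ.1
    · exact subset_above (m := pairsOf hM) _ hfw
    rw [(isSetLattice hM).mem_above_iff (η := toLattice hM ν) hν]
    by_contra hn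
    have h1 := ((isSetLattice hM).mem_sup_or_mem_inf (a := toLattice hM ν)
      (b := toLattice hM μ) (e := (f, w))).2 (Or.inl hν)
    have h2 := h1.resolve_left hn
    rw [pairsOf_inf] at h2
    exact ((isStable_iff _).1 μ.2).not_blocked _ hfw ⟨hc, hM.workerChoice.subst _ _ h2 _
      Finset.subset_union_right⟩
  · rintro ⟨η, hη, he⟩
    refine ⟨⟨η, he⟩, ?_⟩
    rw [← mem_firmChoice_insert hμ ((Subtype.prop (p := M.IsStable) η).subset_acc he)]
    refine hM.firmChoice.subst _ _ ?_ _ (Finset.subset_union_right (s₁ := pairsOf hM η))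
    exact (((le_iff hM).1 hη).symm ▸ he)

theorem isImmediatePredecessor_iff (μ' μ : M.StableMatching) :
    M.IsImmediatePredecessor μ' μ ↔ toLattice hM μ ⋖ toLattice hM μ' := by
  rw [IsImmediatePredecessor, covBy_iff_lt_and_eq_or_eq]
  simp only [dominates_iff_le hM]
  constructor
  · rintro ⟨h1, h2, h3⟩
    exact ⟨lt_of_le_of_ne h1 (Ne.symm h2), fun c h4 h5 => (h3 c h5 h4).symm⟩
  · rintro ⟨h1, h2⟩
    exact ⟨h1.le, h1.ne', fun c h4 h5 => (h2 c h5 h4).symm⟩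

theorem isRotation_iff (ρ : Finset (F × W) × Finset (F × W)) :
    (∃ μ' μ : M.StableMatching, M.IsImmediatePredecessor μ' μ ∧
      ρ = (μ.1 \ μ'.1, μ'.1 \ μ.1)) ↔ IsRotation (pairsOf hM) ρ := by
  simp only [isImmediatePredecessor_iff hM]
  exact exists_comm

/-- The firm-best stable matching at which the rotation has been eliminated. -/
noncomputable def rotationBase (ρ : M.Rotation) : M.StableLattice hM :=
  (isSetLattice hM).base (isRotation_iff hM) ρ

theorem rotationBase_spec (ρ : M.Rotation) :
    IsBase (pairsOf hM) ρ.1 (rotationBase hM ρ) :=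
  (isSetLattice hM).base_spec (isRotation_iff hM) ρ

theorem rotationBase_injective : Function.Injective (rotationBase hM) :=
  (isSetLattice hM).base_injective (isRotation_iff hM)

theorem rotationGE_iff (ρ₁ ρ₂ : M.Rotation) :
    M.RotationGE ρ₁ ρ₂ ↔ rotationBase hM ρ₂ ≤ rotationBase hM ρ₁ := by
  have : Set.range M.pSet = Set.range (above (pairsOf hM)) :=
    congrArg Set.range (funext (pSet_eq hM))
  rw [RotationGE, this]
  exact (isSetLattice hM).minDiffGE_iff (rotationBase_spec hM ρ₁) (rotationBase_spec hM ρ₂)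

theorem mem_rotationSet_iff (μ : M.StableMatching) (ρ : M.Rotation) :
    ρ ∈ M.rotationSet μ ↔ toLattice hM μ ≤ rotationBase hM ρ := by
  rw [rotationSet, Set.mem_ofPred_eq, pSet_eq hM]
  exact (rotationBase_spec hM ρ).subset_above_iff

include hM

theorem isPartialOrder_rotationGE : IsPartialOrder M.Rotation M.RotationGE where
  refl ρ := (rotationGE_iff hM ρ ρ).2 le_rfl
  trans a b c h1 h2 := (rotationGE_iff hM a c).2
    (((rotationGE_iff hM b c).1 h2).trans ((rotationGE_iff hM a b).1 h1))
  antisymm a b h1 h2 := rotationBase_injective hM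
    (le_antisymm ((rotationGE_iff hM b a).1 h2) ((rotationGE_iff hM a b).1 h1))

theorem isRepresentationFunction_rotationSet :
    IsRepresentationFunction M.Dominates M.RotationGE M.rotationSet := by
  have key : ∀ μ ν, M.Dominates μ ν ↔ M.rotationSet μ ⊆ M.rotationSet ν := fun μ ν => by
    rw [dominates_iff_le hM, (isSetLattice hM).le_iff_forall_base (isRotation_iff hM)]
    exact forall_congr' fun ρ => by
      rw [mem_rotationSet_iff hM, mem_rotationSet_iff hM]; rfl
  refine ⟨⟨?_, ?_, ?_⟩, key⟩
  · intro μ _ ρ hρ ρ' hge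
    rw [mem_rotationSet_iff hM] at hρ ⊢
    exact hρ.trans ((rotationGE_iff hM _ _).1 hge)
  · intro μ _ ν _ he
    exact le_antisymm (α := M.StableLattice hM) ((dominates_iff_le hM).1 ((key ν μ).2 he.ge))
      ((dominates_iff_le hM).1 ((key μ ν).2 he.le))
  · intro U hU
    obtain ⟨μ, hμ⟩ := (isSetLattice hM).exists_forall_base_iff (isRotation_iff hM) U
      fun ρ hρ ρ' hle => hU ρ hρ ρ' ((rotationGE_iff hM _ _).2 hle)
    exact ⟨μ, trivial, Set.ext fun ρ => (mem_rotationSet_iff hM μ ρ).trans (hμ ρ)⟩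

theorem charVec_eq (μ : M.StableMatching) :
    charVec (M.edgeSet μ.1) = M.rotationMatrix *ᵥ charVec (M.rotationSet μ) +
      charVec (M.edgeSet (pairsOf hM ⊤)) := by
  have hr : M.rotationSet μ = {ρ | toLattice hM μ ≤ rotationBase hM ρ} :=
    Set.ext fun ρ => mem_rotationSet_iff hM μ ρ
  ext e
  rw [hr, Pi.add_apply, add_comm]
  exact (isSetLattice hM).charVec_eq (isRotation_iff hM) (toLattice hM μ) e.1

theorem rotationMatrix_mulVec_injective : Function.Injective M.rotationMatrix.mulVec := by
  rw [← Matrix.coe_mulVecLin, ← LinearMap.ker_eq_bot, LinearMap.ker_eq_bot']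
  intro u hu
  refine (isSetLattice hM).eq_zero_of_sum_eq_zero (isRotation_iff hM) u fun ρ₀ e he => ?_
  have hacc : e ∈ M.acc := by
    obtain ⟨μ', μ, -, h⟩ := ρ₀.2
    rw [h] at he
    exact μ.2.subset_acc (Finset.mem_sdiff.1 he).1
  exact congrFun hu ⟨e, hacc⟩

theorem rank_rotationMatrix : M.rotationMatrix.rank = Fintype.card M.Rotation := by
  rw [← Matrix.rank_transpose]
  apply LinearIndependent.rank_matrix
  exact Matrix.mulVec_injective_iff.1 (rotationMatrix_mulVec_injective hM)

/-- The sets `ρ⁺` are nonempty and pairwise disjoint, so one pair from each names the rotation. -/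
theorem card_rotation_le : Fintype.card M.Rotation ≤ Fintype.card F * Fintype.card W := by
  rw [← Fintype.card_prod]
  choose a ha using fun ρ : M.Rotation => (rotationBase_spec hM ρ).plus_nonempty
  exact Fintype.card_le_of_injective a fun ρ₁ ρ₂ he =>
    Subtype.ext ((rotationBase_spec hM ρ₁).eq_of_mem_plus (rotationBase_spec hM ρ₂) (ha ρ₁)
      (he ▸ ha ρ₂))

theorem affinelyRepresents :
    ∃ μF : M.StableMatching, M.IsFirmOptimal μF ∧
      ∃ g : (M.Rotation → ℝ) →ᵃ[ℝ] (M.Edge → ℝ),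
        (∀ u, g u = M.rotationMatrix *ᵥ u + charVec (M.edgeSet μF.1)) ∧
        AffinelyRepresents (fun μ : M.StableMatching => M.edgeSet μ.1)
          M.Dominates M.RotationGE M.rotationSet g := by
  refine ⟨(⊤ : M.StableLattice hM), fun ν => (dominates_iff_le hM).2 (le_top (a := toLattice hM ν)),
    (M.rotationMatrix.mulVecLin).toAffineMap + AffineMap.const ℝ _ _, fun u => rfl, ?_, 
    isRepresentationFunction_rotationSet hM, fun μ => (charVec_eq hM μ).symm⟩
  intro μ ν he
  ext p
  have key : ∀ μ : M.StableMatching, p ∈ μ.1 ↔ ∃ h : p ∈ M.acc, (⟨p, h⟩ : M.Edge) ∈ M.edgeSet μ.1 :=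
    fun μ => ⟨fun h => ⟨μ.2.subset_acc h, h⟩, fun ⟨_, h⟩ => h⟩
  rw [key, key]
  exact exists_congr fun h => by rw [show M.edgeSet μ.1 = M.edgeSet ν.1 from he]

theorem exists_distribLattice :
    ∃ L : DistribLattice M.StableMatching, ∀ μ ν : M.StableMatching, L.le ν μ ↔ M.Dominates μ ν :=
  ⟨inferInstanceAs (DistribLattice (M.StableLattice hM)), fun _ _ => (dominates_iff_le hM).symm⟩

end Market

/-! ## Deferred acceptance -/

namespace Market

open PathIndependent IsSetLattice AffineRep

variable {F W : Type*} [DecidableEq F] [DecidableEq W] [Fintype F] [Fintype W] {M : Market F W}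
  (hM : M.IsCM)

/-- The invariant of the deferred acceptance procedure. The firms choose from the available pairs
`A`; the pairs in `T` have been proposed, and the workers hold `M.workerChoice T`. The pairs in `Z`
have been proposed although they are not available. Only the firms in `D` may have new proposals.
The stable matchings that satisfy `p` are still attainable. -/
structure DAInv (p : M.StableLattice hM → Prop) (Z A T : Finset (F × W)) (D : Finset F) : Prop where
  avail_subset : A ⊆ M.acc
  proposed_subset : T ⊆ M.acc
  inter_subset : A ∩ T ⊆ M.workerChoice T
  cover : M.acc ⊆ A ∪ T
  held_subset : M.workerChoice T ⊆ A ∪ Z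
  held_chosen : A ∩ M.workerChoice T ⊆ M.firmChoice A
  forced_subset : Z ⊆ T
  forced_disjoint : ∀ e ∈ Z, e ∉ A
  target_subset : ∀ ν, p ν → pairsOf hM ν ⊆ A
  target_proposed : ∀ ν, p ν → ∀ t ∈ T, t ∈ M.firmChoice (insert t (pairsOf hM ν))
  clean : ∀ e ∈ M.firmChoice A, e.1 ∉ D → e ∈ M.workerChoice T

/-- The pairs that belong to some stable matching. -/
noncomputable def stablePairs (M : Market F W) : Finset (F × W) := by
  classical exact Finset.univ.filter fun e => ∃ ν : M.StableMatching, e ∈ ν.1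

theorem mem_stablePairs {e : F × W} :
    e ∈ M.stablePairs ↔ ∃ ν : M.StableLattice hM, e ∈ pairsOf hM ν := by
  simp only [stablePairs, Finset.mem_filter, Finset.mem_univ, true_and]
  rfl

theorem pairsOf_subset_acc (ν : M.StableLattice hM) : pairsOf hM ν ⊆ M.acc :=
  (Subtype.prop (p := M.IsStable) ν).subset_acc

theorem workerChoice_subset_acc (X : Finset (F × W)) : M.workerChoice X ⊆ M.acc := by
  intro e he
  rw [workerChoice, Finset.mem_map_equiv] at he
  have := (glue_subset_inter (by simp only [atFirm_map_swap]; exact M.choiceW_subset) _ he)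
  simpa using (Finset.mem_inter.1 this).2

/-- A stable pair that the worker rejects has been passed. -/
theorem mem_passed_of_notMem_workerChoice {μ : M.StableLattice hM} {e : F × W}
    (he : e ∈ M.stablePairs) (hn : e ∉ M.workerChoice (insert e (pairsOf hM μ))) :
    e ∈ passed (pairsOf hM) μ := by
  obtain ⟨η, hη⟩ := (mem_stablePairs hM).1 he
  refine ⟨((isSetLattice hM).mem_above_iff hη).2 ?_, fun h => hn ?_⟩
  · refine ((isSetLattice hM).mem_sup_or_mem_inf.2 (Or.inl hη)).resolve_right fun h => hn ?_
    rw [pairsOf_inf] at h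
    exact hM.workerChoice.subst _ _ h _ Finset.subset_union_right
  · rw [Finset.insert_eq_of_mem h, (stab hM μ).right]
    exact h

theorem mem_firmChoice_of_mem_above {μ : M.StableLattice hM} {e : F × W}
    (he : e ∈ above (pairsOf hM) μ) : e ∈ M.firmChoice (insert e (pairsOf hM μ)) := by
  obtain ⟨η, hη, heη⟩ := he
  refine hM.firmChoice.subst _ _ ?_ _ (Finset.subset_union_right (s₁ := pairsOf hM η))
  rwa [(le_iff hM).1 hη]

namespace DAInv

variable {hM} {p : M.StableLattice hM → Prop} {Z A T : Finset (F × W)} {D : Finset F}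

theorem init : DAInv hM (fun _ => True) ∅ M.acc ∅ Finset.univ where
  avail_subset := subset_rfl
  proposed_subset := Finset.empty_subset _
  inter_subset := by simp
  cover := by simp
  held_subset := (hM.workerChoice.subset _).trans (Finset.empty_subset _)
  held_chosen := by
    rw [Finset.subset_empty.1 (hM.workerChoice.subset ∅)]
    simp
  forced_subset := subset_rfl
  forced_disjoint := by simp
  target_subset ν _ := pairsOf_subset_acc hM ν
  target_proposed := by simp
  clean := by simp

/-- The worker receives the proposal `b`, but the firm cannot count on it. The targets are the
stable matchings that have passed `b`: they do not contain `b` although its firm wants it, so they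
are available and treat `b` like an ordinary rejected proposal. -/
theorem init_forced {b : F × W} (hb : b ∈ M.acc) :
    DAInv hM (fun ν => b ∈ passed (pairsOf hM) ν) {b} (M.acc.erase b) {b} Finset.univ where
  avail_subset := Finset.erase_subset _ _
  proposed_subset := by simpa using hb
  inter_subset := by simp
  cover := by
    intro e he
    by_cases h : e = b <;> simp [h, he]
  held_subset := (hM.workerChoice.subset _).trans Finset.subset_union_right
  held_chosen := by
    intro e he
    rw [Finset.mem_inter] at he
    exact absurd (Finset.mem_singleton.1 (hM.workerChoice.subset _ he.2))
      (Finset.ne_of_mem_erase he.1)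
  forced_subset := subset_rfl
  forced_disjoint := by simp
  target_subset ν hν e he := Finset.mem_erase.2
    ⟨fun h => hν.2 (h ▸ he), pairsOf_subset_acc hM ν he⟩
  target_proposed ν hν t ht := by
    rw [Finset.mem_singleton.1 ht]
    exact mem_firmChoice_of_mem_above hM hν.1
  clean := by simp

/-- At a target every proposal is wanted by its firm, so stability makes the workers reject all
proposals outside the target. -/
theorem workerChoice_target (h : DAInv hM p Z A T D) {ν : M.StableLattice hM} (hν : p ν) :
    M.workerChoice (pairsOf hM ν ∪ T) = pairsOf hM ν :=
  hM.workerChoice.union_eq_of_rejected (stab hM ν).right fun t ht htν hw =>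
    (stab hM ν).not_blocked t htν ⟨h.target_proposed ν hν t ht, hw⟩

/-- A firm without new proposals can be removed from the list of firms to be examined. -/
theorem erase (h : DAInv hM p Z A T D) {f : F}
    (hf : ∀ e ∈ M.firmChoice A, e.1 = f → e ∈ M.workerChoice T) :
    DAInv hM p Z A T (D.erase f) :=
  { h with
    clean := fun e he hD => by
      by_cases hef : e.1 = f
      · exact hf e he hef
      · exact h.clean e he fun h' => hD (Finset.mem_erase.2 ⟨hef, h'⟩) }

theorem notMem_proposed (h : DAInv hM p Z A T D) {e : F × W} (he : e ∈ M.firmChoice A)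
    (hne : e ∉ M.workerChoice T) : e ∉ T := fun hT =>
  hne (h.inter_subset (Finset.mem_inter.2 ⟨hM.firmChoice.subset _ he, hT⟩))

-- By cardinal monotonicity a further proposal does not lower the number of held pairs, so it
-- displaces at most one.
include hM in
theorem card_rejected_le (e : F × W) (T : Finset (F × W)) :
    (insert e (M.workerChoice T) \ M.workerChoice (insert e T)).card ≤ 1 := by
  rw [← hM.workerChoice.insert_choice]
  have h1 := hM.workerChoice.mono _ _ (Finset.subset_insert e (M.workerChoice T))
  rw [hM.workerChoice.idem] at h1
  have h2 := Finset.card_insert_le e (M.workerChoice T)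
  rw [Finset.card_sdiff_of_subset (hM.workerChoice.subset _)]
  omega

/-- A proposal, after which the pairs no longer held are not available any more. -/
theorem propose (h : DAInv hM p Z A T D) {e : F × W} (he : e ∈ M.firmChoice A)
    {D' : Finset F} (hD : D ⊆ D')
    (hD' : ∀ r ∈ insert e (M.workerChoice T) \ M.workerChoice (insert e T), r.1 ∈ D') :
    DAInv hM p Z (A \ (insert e (M.workerChoice T) \ M.workerChoice (insert e T))) (insert e T) D' where
  avail_subset := Finset.sdiff_subset.trans h.avail_subset
  proposed_subset := Finset.insert_subset (M.firmChoice_subset_acc _ he) h.proposed_subset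
  inter_subset := by
    intro x hx
    simp only [Finset.mem_inter, Finset.mem_sdiff, not_and, not_not] at hx
    refine hx.1.2 ?_
    rcases Finset.mem_insert.1 hx.2 with rfl | hxT
    · exact Finset.mem_insert_self _ _
    · exact Finset.mem_insert_of_mem (h.inter_subset (Finset.mem_inter.2 ⟨hx.1.1, hxT⟩))
  cover := by
    intro x hx
    rcases Finset.mem_union.1 (h.cover hx) with hA | hT
    · by_cases hr : x ∈ insert e (M.workerChoice T) \ M.workerChoice (insert e T)
      · refine Finset.mem_union_right _ ?_
        exact Finset.insert_subset_insert e (hM.workerChoice.subset T) (Finset.mem_sdiff.1 hr).1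
      · exact Finset.mem_union_left _ (Finset.mem_sdiff.2 ⟨hA, hr⟩)
    · exact Finset.mem_union_right _ (Finset.mem_insert_of_mem hT)
  held_subset := by
    intro x hx
    have h1 : x ∈ insert e (M.workerChoice T) := by
      rw [← hM.workerChoice.insert_choice] at hx
      exact hM.workerChoice.subset _ hx
    have h2 : x ∈ A ∪ Z := by
      rcases Finset.mem_insert.1 h1 with rfl | h3
      · exact Finset.mem_union_left _ (hM.firmChoice.subset _ he)
      · exact h.held_subset h3
    rcases Finset.mem_union.1 h2 with hA | hZ
    · exact Finset.mem_union_left _ (Finset.mem_sdiff.2 ⟨hA, fun hr => (Finset.mem_sdiff.1 hr).2 hx⟩)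
    · exact Finset.mem_union_right _ hZ
  held_chosen := by
    intro x hx
    obtain ⟨hxA, hx⟩ := Finset.mem_inter.1 hx
    have h1 : x ∈ insert e (M.workerChoice T) := by
      rw [← hM.workerChoice.insert_choice] at hx
      exact hM.workerChoice.subset _ hx
    -- By substitutability a firm still chooses its remaining pairs when others become unavailable.
    refine hM.firmChoice.mem_of_subset ?_ Finset.sdiff_subset hxA
    rcases Finset.mem_insert.1 h1 with rfl | h3
    · exact he
    · exact h.held_chosen (Finset.mem_inter.2 ⟨(Finset.mem_sdiff.1 hxA).1, h3⟩)
  forced_subset := h.forced_subset.trans (Finset.subset_insert _ _)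
  forced_disjoint x hx hA := h.forced_disjoint x hx (Finset.mem_sdiff.1 hA).1
  target_proposed := by
    intro ν hν t ht
    rcases Finset.mem_insert.1 ht with rfl | ht
    · exact hM.firmChoice.subst _ _ he _ (h.target_subset ν hν)
    · exact h.target_proposed ν hν t ht
  target_subset := by
    intro ν hν x hx
    refine Finset.mem_sdiff.2 ⟨h.target_subset ν hν hx, fun hr => ?_⟩
    obtain ⟨hr1, hr2⟩ := Finset.mem_sdiff.1 hr
    have hxT : x ∈ insert e T := Finset.insert_subset_insert e (hM.workerChoice.subset T) hr1
    -- The enlarged set of proposals still loses against `ν`. So a proposed pair of `ν` is chosen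
    -- from `ν ∪ insert e T`, hence from `insert e T`, and is not among those rejected.
    have hw : M.workerChoice (pairsOf hM ν ∪ insert e T) = pairsOf hM ν := by
      refine hM.workerChoice.union_eq_of_rejected (stab hM ν).right fun t ht htν hw =>
        (stab hM ν).not_blocked t htν ⟨?_, hw⟩
      rcases Finset.mem_insert.1 ht with rfl | ht
      · exact hM.firmChoice.subst _ _ he _ (h.target_subset ν hν)
      · exact h.target_proposed ν hν t ht
    exact hr2 (hM.workerChoice.mem_of_subset (hw.symm ▸ hx) Finset.subset_union_right hxT)
  clean := by
    rintro ⟨f, w⟩ hx hf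
    have hfD : f ∉ D := fun h' => hf (hD h')
    -- the row of `f` has not changed
    have hrow : atFirm (A \ (insert e (M.workerChoice T) \ M.workerChoice (insert e T))) f =
        atFirm A f := by
      ext v
      rw [mem_atFirm, mem_atFirm, Finset.mem_sdiff]
      exact ⟨And.left, fun hA => ⟨hA, fun hr => hf (hD' (f, v) hr)⟩⟩
    rw [mem_firmChoice (Finset.sdiff_subset.trans h.avail_subset), hrow,
      ← mem_firmChoice h.avail_subset] at hx
    have h1 := h.clean _ hx hfD
    by_contra hn
    exact hf (hD' _ (Finset.mem_sdiff.2 ⟨Finset.mem_insert_of_mem h1, hn⟩))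

section Final

variable (h : DAInv hM p Z A T ∅)
include h

theorem firmChoice_eq : M.firmChoice A = A ∩ M.workerChoice T :=
  Finset.Subset.antisymm (fun x hx => Finset.mem_inter.2
    ⟨hM.firmChoice.subset _ hx, h.clean x hx (by simp)⟩) h.held_chosen

/-- If some target exists, then no forced proposal is held. -/
theorem disjoint_of_target {ν : M.StableLattice hM} (hν : p ν) : M.workerChoice T ⊆ A := by
  -- The held pairs are at most as many as the pairs of the target, which are at most as many as
  -- those the firms choose from `A`; the latter are the available held pairs.
  have h1 : (M.workerChoice T).card ≤ (A ∩ M.workerChoice T).card := by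
    rw [← h.firmChoice_eq]
    calc (M.workerChoice T).card ≤ (pairsOf hM ν).card := by
          have := hM.workerChoice.mono T (pairsOf hM ν ∪ T) Finset.subset_union_right
          rwa [h.workerChoice_target hν] at this
      _ ≤ (M.firmChoice A).card := by
          have := hM.firmChoice.mono _ _ (h.target_subset ν hν)
          rwa [(stab hM ν).left] at this
  exact Finset.inter_eq_right.1 (Finset.eq_of_subset_of_card_le Finset.inter_subset_right h1)

variable (hB : M.workerChoice T ⊆ A)
include hB

theorem firmChoice_eq_workerChoice : M.firmChoice A = M.workerChoice T := by
  rw [h.firmChoice_eq, Finset.inter_eq_right.2 hB]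

theorem stab_workerChoice : Stab M.firmChoice M.workerChoice (M.workerChoice T) := by
  have h1 := h.firmChoice_eq_workerChoice hB
  rw [← h1]
  exact stab_of_cover hM.firmChoice hM.workerChoice h1 fun e he _ =>
    Finset.mem_union.1 (h.cover (M.firmChoice_subset_acc _ he))

theorem target_le {ν : M.StableLattice hM} (hν : p ν) :
    ν ≤ ofStab hM (h.stab_workerChoice hB) := by
  rw [le_iff]
  change M.firmChoice (M.workerChoice T ∪ pairsOf hM ν) = M.workerChoice T
  have h1 := h.firmChoice_eq_workerChoice hB
  rw [← h1]
  refine (hM.firmChoice.cons A _ Finset.subset_union_left ?_).symm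
  exact Finset.union_subset (hM.firmChoice.subset _) (h.target_subset ν hν)

/-- An unavailable pair was proposed and is rejected by its worker at the outcome; an available pair
that its firm wants at the outcome belongs to it. Thus the final availability answers, at constant
cost per pair, which stable pairs have been passed. -/
theorem notMem_avail_iff {e : F × W} (he : e ∈ M.stablePairs) :
    e ∉ A ↔ e ∈ passed (pairsOf hM) (ofStab hM (h.stab_workerChoice hB)) := by
  have hacc : e ∈ M.acc := by
    obtain ⟨ν, hν⟩ := (mem_stablePairs hM).1 he
    exact pairsOf_subset_acc hM ν hν
  constructor
  · intro hA
    have hT : e ∈ T := (Finset.mem_union.1 (h.cover hacc)).resolve_left hA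
    refine mem_passed_of_notMem_workerChoice hM he fun hw => hA (hB ?_)
    change e ∈ M.workerChoice (insert e (M.workerChoice T)) at hw
    rwa [hM.workerChoice.insert_choice, Finset.insert_eq_of_mem hT] at hw
  · rintro ⟨h1, h2⟩ hA
    have h3 := mem_firmChoice_of_mem_above hM h1
    change e ∈ M.firmChoice (insert e (M.workerChoice T)) at h3
    rw [← h.firmChoice_eq_workerChoice hB, hM.firmChoice.insert_choice,
      Finset.insert_eq_of_mem hA, h.firmChoice_eq_workerChoice hB] at h3
    exact h2 h3

end Final

end DAInv

end Market

/-! ## Reasoning about oracle machines -/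

namespace OracleMachine

/-! ### Written arrays -/

namespace Program

/-- The arrays of numbers written by a program. -/
def nums : Program → List ℕ
  | assignNum a _ _ _ _ => [a]
  | assignSet _ _ _ _ _ => []
  | pick a _ _ _ _ => [a]
  | queryF _ _ _ _ _ _ => []
  | queryW _ _ _ _ _ _ => []
  | seq P Q => P.nums ++ Q.nums
  | ite _ P Q => P.nums ++ Q.nums
  | loop _ P => P.nums

/-- The arrays of sets written by a program. -/
def sets : Program → List ℕ
  | assignNum _ _ _ _ _ => []
  | assignSet a _ _ _ _ => [a]
  | pick _ _ _ _ _ => []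
  | queryF a _ _ _ _ _ => [a]
  | queryW a _ _ _ _ _ => [a]
  | seq P Q => P.sets ++ Q.sets
  | ite _ P Q => P.sets ++ Q.sets
  | loop _ P => P.sets

/-- A bound of the number of steps of a program without loops. -/
def steps : Program → ℕ
  | seq P Q => P.steps + Q.steps
  | ite _ P Q => 1 + P.steps + Q.steps
  | _ => 1

end Program

variable {n m : ℕ}

/-- The memories agree on the arrays that are not written by `P`. -/
structure Agree (P : Program) (s s' : Memory) : Prop where
  num : ∀ a, a ∉ P.nums → s'.num a = s.num a
  set : ∀ a, a ∉ P.sets → s'.set a = s.set a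

theorem Agree.refl (P : Program) (s : Memory) : Agree P s s := ⟨fun _ _ => rfl, fun _ _ => rfl⟩

theorem Agree.trans {P : Program} {s s' s'' : Memory} (h : Agree P s s') (h' : Agree P s' s'') :
    Agree P s s'' :=
  ⟨fun a ha => (h'.num a ha).trans (h.num a ha), fun a ha => (h'.set a ha).trans (h.set a ha)⟩

theorem Agree.mono {P Q : Program} {s s' : Memory} (h : Agree P s s') (hn : P.nums ⊆ Q.nums)
    (hs : P.sets ⊆ Q.sets) : Agree Q s s' :=
  ⟨fun a ha => h.num a fun h' => ha (hn h'), fun a ha => h.set a fun h' => ha (hs h')⟩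

theorem Memory.setNum_num_of_ne (s : Memory) {a b : ℕ} (h : b ≠ a) (i j k v : ℕ) :
    (s.setNum a i j k v).num b = s.num b := by
  funext i' j' k'
  simp [Memory.setNum, h]

theorem Memory.setSet_set_of_ne (s : Memory) {a b : ℕ} (h : b ≠ a) (i j k : ℕ) (V : Finset ℕ) :
    (s.setSet a i j k V).set b = s.set b := by
  funext i' j' k'
  simp [Memory.setSet, h]

theorem Exec.agree {M : Market (Fin n) (Fin m)} {T : ℕ} {P : Program} {s s' : Memory} {t : ℕ}
    (h : Exec M T P s s' t) : Agree P s s' := by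
  induction h with
  | assignNum a i j k x s =>
    exact ⟨fun b hb => s.setNum_num_of_ne (by simpa [Program.nums] using hb) _ _ _ _,
      fun _ _ => rfl⟩
  | pick a i j k x s =>
    exact ⟨fun b hb => s.setNum_num_of_ne (by simpa [Program.nums] using hb) _ _ _ _,
      fun _ _ => rfl⟩
  | assignSet a i j k X s =>
    exact ⟨fun _ _ => rfl,
      fun b hb => s.setSet_set_of_ne (by simpa [Program.sets] using hb) _ _ _ _⟩
  | queryF a i j k x X s =>
    exact ⟨fun _ _ => rfl,
      fun b hb => s.setSet_set_of_ne (by simpa [Program.sets] using hb) _ _ _ _⟩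
  | queryW a i j k x X s =>
    exact ⟨fun _ _ => rfl,
      fun b hb => s.setSet_set_of_ne (by simpa [Program.sets] using hb) _ _ _ _⟩
  | seq P Q s s' s'' t t' _ _ ih ih' =>
    exact (ih.mono (List.subset_append_left _ _) (List.subset_append_left _ _)).trans
      (ih'.mono (List.subset_append_right _ _) (List.subset_append_right _ _))
  | iteTrue b P Q s s' t _ _ ih =>
    exact ih.mono (List.subset_append_left _ _) (List.subset_append_left _ _)
  | iteFalse b P Q s s' t _ _ ih =>
    exact ih.mono (List.subset_append_right _ _) (List.subset_append_right _ _)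
  | loopTrue b P s s' s'' t t' _ _ _ ih ih' =>
    exact (ih.mono (Q := .loop b P) (List.Subset.refl _) (List.Subset.refl _)).trans ih'
  | loopFalse b P s _ => exact Agree.refl _ s

/-! ### Total correctness -/

/-- Started with memory `s`, the program halts within `b` steps, each of which takes time at most
`T`, and the final memory satisfies `Q`. -/
def Run (M : Market (Fin n) (Fin m)) (T : ℕ) (P : Program) (s : Memory) (b : ℕ)
    (Q : Memory → Prop) : Prop :=
  HaltsWithin M T P s (b * T) Q

/-- The weakest precondition of a program without loops. -/
def Program.wp (M : Market (Fin n) (Fin m)) : Program → (Memory → Prop) → Memory → Prop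
  | assignNum a i j k x, Q, s =>
    Q (s.setNum a (i.eval n m s) (j.eval n m s) (k.eval n m s) (x.eval n m s))
  | assignSet a i j k X, Q, s =>
    Q (s.setSet a (i.eval n m s) (j.eval n m s) (k.eval n m s) (X.eval n m s))
  | pick a i j k X, Q, s =>
    Q (s.setNum a (i.eval n m s) (j.eval n m s) (k.eval n m s) (sInf (X.eval n m s : Set ℕ)))
  | queryF a i j k x X, Q, s => ∃ (f : Fin n) (S : Finset (Fin m)), x.eval n m s = f ∧
    X.eval n m s = toNatSet S ∧ S ⊆ Market.atFirm M.acc f ∧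
    Q (s.setSet a (i.eval n m s) (j.eval n m s) (k.eval n m s) (toNatSet (M.choiceF f S)))
  | queryW a i j k x X, Q, s => ∃ (w : Fin m) (S : Finset (Fin n)), x.eval n m s = w ∧
    X.eval n m s = toNatSet S ∧ S ⊆ Market.atWorker M.acc w ∧
    Q (s.setSet a (i.eval n m s) (j.eval n m s) (k.eval n m s) (toNatSet (M.choiceW w S)))
  | seq P R, Q, s => P.wp M (R.wp M Q) s
  | ite b P R, Q, s => (b.eval n m s → P.wp M Q s) ∧ (¬ b.eval n m s → R.wp M Q s)
  | loop _ _, _, _ => False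

variable {M : Market (Fin n) (Fin m)} {T : ℕ}

theorem Run.mono {P : Program} {s : Memory} {b b' : ℕ} {Q Q' : Memory → Prop}
    (h : Run M T P s b Q) (hb : b ≤ b') (hQ : ∀ s', Q s' → Q' s') : Run M T P s b' Q' := by
  obtain ⟨s', t, h1, h2, h3⟩ := h
  exact ⟨s', t, h1, h2.trans (Nat.mul_le_mul_right T hb), hQ s' h3⟩

theorem Run.agree {P : Program} {s : Memory} {b : ℕ} {Q : Memory → Prop} (h : Run M T P s b Q) :
    Run M T P s b fun s' => Q s' ∧ Agree P s s' := by
  obtain ⟨s', t, h1, h2, h3⟩ := h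
  exact ⟨s', t, h1, h2, h3, h1.agree⟩

theorem Run.seq {P R : Program} {s : Memory} {b c : ℕ} {Q Q' : Memory → Prop}
    (h : Run M T P s b Q) (h' : ∀ s', Q s' → Agree P s s' → Run M T R s' c Q') :
    Run M T (.seq P R) s (b + c) Q' := by
  obtain ⟨s', t, h1, h2, h3⟩ := h
  obtain ⟨s'', t', h4, h5, h6⟩ := h' s' h3 h1.agree
  exact ⟨s'', t + t', .seq _ _ _ _ _ _ _ h1 h4, by rw [add_mul]; omega, h6⟩

theorem Run.of_wp (hT : 1 ≤ T) {P : Program} {s : Memory} {Q : Memory → Prop} (h : P.wp M Q s) :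
    Run M T P s P.steps Q := by
  induction P generalizing s Q with
  | assignNum a i j k x => exact ⟨_, 1, .assignNum _ _ _ _ _ _, by simpa [Program.steps], h⟩
  | assignSet a i j k X => exact ⟨_, 1, .assignSet _ _ _ _ _ _, by simpa [Program.steps], h⟩
  | pick a i j k X => exact ⟨_, 1, .pick _ _ _ _ _ _, by simpa [Program.steps], h⟩
  | queryF a i j k x X =>
    obtain ⟨f, S, h1, h2, h3, h4⟩ := h
    exact ⟨_, T, .queryF _ _ _ _ _ _ _ f S h1 h2 h3, by simp [Program.steps], h4⟩
  | queryW a i j k x X =>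
    obtain ⟨f, S, h1, h2, h3, h4⟩ := h
    exact ⟨_, T, .queryW _ _ _ _ _ _ _ f S h1 h2 h3, by simp [Program.steps], h4⟩
  | seq P R ihP ihR => exact (ihP h).seq fun s' hs' _ => ihR hs'
  | ite b P R ihP ihR =>
    by_cases hb : b.eval n m s
    · obtain ⟨s', t, h1, h2, h3⟩ := ihP (h.1 hb)
      refine ⟨s', 1 + t, .iteTrue _ _ _ _ _ _ hb h1, ?_, h3⟩
      simp only [Program.steps, add_mul]
      omega
    · obtain ⟨s', t, h1, h2, h3⟩ := ihR (h.2 hb)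
      refine ⟨s', 1 + t, .iteFalse _ _ _ _ _ _ hb h1, ?_, h3⟩
      simp only [Program.steps, add_mul]
      omega
  | loop b P _ => exact h.elim

theorem Run.ite (hT : 1 ≤ T) {b : Cond} {P R : Program} {s : Memory} {c : ℕ} {Q : Memory → Prop}
    (hP : b.eval n m s → Run M T P s c Q) (hR : ¬ b.eval n m s → Run M T R s c Q) :
    Run M T (.ite b P R) s (c + 1) Q := by
  by_cases hb : b.eval n m s
  · obtain ⟨s', t, h1, h2, h3⟩ := hP hb
    exact ⟨s', 1 + t, .iteTrue _ _ _ _ _ _ hb h1, by rw [add_mul]; omega, h3⟩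
  · obtain ⟨s', t, h1, h2, h3⟩ := hR hb
    exact ⟨s', 1 + t, .iteFalse _ _ _ _ _ _ hb h1, by rw [add_mul]; omega, h3⟩

/-- While-loops: the variant `v` decreases in every iteration. -/
theorem Run.loop (hT : 1 ≤ T) {b : Cond} {P : Program} {c : ℕ} (I : ℕ → Memory → Prop)
    (hbody : ∀ v s, I v s → b.eval n m s → Run M T P s c fun s' => ∃ v' < v, I v' s')
    {v : ℕ} {s : Memory} (h : I v s) :
    Run M T (.loop b P) s (v * (c + 1) + 1) fun s' => (∃ v', I v' s') ∧ ¬ b.eval n m s' := by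
  induction v using Nat.strong_induction_on generalizing s with
  | _ v ih =>
    by_cases hb : b.eval n m s
    · obtain ⟨s', t, h1, h2, v', hv', h3⟩ := hbody v s h hb
      obtain ⟨s'', t', h4, h5, h6⟩ := ih v' hv' h3
      refine ⟨s'', 1 + t + t', .loopTrue _ _ _ _ _ _ _ hb h1 h4, ?_, h6⟩
      -- The variant drops by `d + 1`: one unit pays for this iteration and its test, and `d` is
      -- slack.
      obtain ⟨d, rfl⟩ := Nat.exists_eq_add_of_lt hv'
      nlinarith [Nat.zero_le (d * (c + 1) * T)]
    · exact ⟨s, 1, .loopFalse _ _ _ hb, by nlinarith [Nat.zero_le (v * (c + 1) * T)], ⟨v, h⟩, hb⟩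

/-! ### Counting loops -/

/-- The scalar stored in the array `a`. -/
abbrev NumExp.var (a : ℕ) : NumExp := .cell a (.const 0) (.const 0) (.const 0)

/-- Execute `P` with the values `0, 1, …` less than the bound for the variable `a`. -/
def Program.forUpTo (a : ℕ) (bound : NumExp) (P : Program) : Program :=
  .seq (.assignNum a (.const 0) (.const 0) (.const 0) (.const 0))
    (.loop (.lt (.var a) bound)
      (.seq P (.assignNum a (.const 0) (.const 0) (.const 0) (.succ (.var a)))))

/-- Each iteration pays `2` beyond the body, for the test and the increment; the final `2` is for
the initialization and the failing test. By `hI` the invariant ignores the counter, and by `hbound`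
the bound stays fixed during the loop. -/
theorem Run.forUpTo (hT : 1 ≤ T) {a : ℕ} {bound : NumExp} {P : Program} {N c : ℕ} {s : Memory}
    (I : ℕ → Memory → Prop) (ha : a ∉ P.nums)
    (hbound : ∀ s', Agree (.forUpTo a bound P) s s' → bound.eval n m s' = N)
    (hI : ∀ i s v, I i s → I i (s.setNum a 0 0 0 v)) (h0 : I 0 s)
    (hbody : ∀ i s', i < N → Agree (.forUpTo a bound P) s s' → s'.num a 0 0 0 = i → I i s' →
      Run M T P s' c (I (i + 1))) :
    Run M T (.forUpTo a bound P) s (N * (c + 2) + 2) (I N) := by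
  have hag : ∀ s' v, Agree (.forUpTo a bound P) s s' →
      Agree (.forUpTo a bound P) s (s'.setNum a 0 0 0 v) := fun s' v h =>
    ⟨fun b hb => (s'.setNum_num_of_ne (fun he => hb (by simp [Program.forUpTo, Program.nums, he]))
      _ _ _ _).trans (h.num b hb), h.set⟩
  have hself : ∀ (s' : Memory) v, (s'.setNum a 0 0 0 v).num a 0 0 0 = v := fun s' v => by
    simp [Memory.setNum]
  have hloop := Run.loop (M := M) (c := c + 1) (b := .lt (.var a) bound)
    (P := .seq P (.assignNum a (.const 0) (.const 0) (.const 0) (.succ (.var a)))) hT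
    (fun v s' => Agree (.forUpTo a bound P) s s' ∧ s'.num a 0 0 0 + v = N ∧ I (s'.num a 0 0 0) s')
    (fun v s' ⟨h1, h2, h3⟩ hb => ?_) (v := N) (s := s.setNum a 0 0 0 0)
    ⟨hag s 0 (Agree.refl _ _), by rw [hself, zero_add], by rw [hself]; exact hI 0 s 0 h0⟩
  · obtain ⟨s', t, h1, h2, ⟨v', h3, h4, h5⟩, h6⟩ := hloop
    refine ⟨s', 1 + t, .seq _ _ _ _ _ _ _ (.assignNum _ _ _ _ _ _) h1, ?_, ?_⟩
    · nlinarith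
    · simp only [Cond.eval, NumExp.eval] at h6
      rw [hbound s' h3] at h6
      obtain rfl : v' = 0 := by omega
      rw [add_zero] at h4
      rwa [h4] at h5
  · simp only [Cond.eval, NumExp.eval] at hb
    rw [hbound s' h1] at hb
    refine (hbody _ s' hb h1 rfl h3).seq (c := 1) fun s'' h4 h5 => ?_
    have hc : s''.num a 0 0 0 = s'.num a 0 0 0 := by rw [h5.num a ha]
    refine ⟨_, 1, .assignNum _ _ _ _ _ _, by omega, v - 1, by omega, ?_, ?_, ?_⟩
    · refine hag _ _ (h1.trans (h5.mono ?_ ?_))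
      · simp [Program.forUpTo, Program.nums]
      · simp [Program.forUpTo, Program.sets]
    · simp only [NumExp.eval, hself]
      omega
    · simp only [NumExp.eval, hself, hc]
      exact hI _ _ _ h4

/-- Execute `P` for all pairs of a firm and a worker. -/
def Program.forPairs (a b : ℕ) (P : Program) : Program :=
  .forUpTo a .nF (.forUpTo b .nW P)

/-- All pairs, in the order of `Program.forPairs`. -/
def allPairs (n m : ℕ) : List (Fin n × Fin m) :=
  (List.finRange n).flatMap fun x => (List.finRange m).map fun y => (x, y)

theorem mem_allPairs (e : Fin n × Fin m) : e ∈ allPairs n m := by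
  simp [allPairs]

/-- The invariant speaks of the list, not the set, of the pairs treated so far, because the
numbering of the rotations depends on the order of treatment. -/
theorem Run.forPairs (hT : 1 ≤ T) {a b : ℕ} {P : Program} {c : ℕ} {s : Memory}
    (I : List (Fin n × Fin m) → Memory → Prop) (hab : a ≠ b) (ha : a ∉ P.nums) (hb : b ∉ P.nums)
    (hI : ∀ L s i v, I L s → i = a ∨ i = b → I L (s.setNum i 0 0 0 v)) (h0 : I [] s)
    (hbody : ∀ L e s', Agree (.forPairs a b P) s s' → s'.num a 0 0 0 = e.1 → s'.num b 0 0 0 = e.2 →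
      I L s' → Run M T P s' c (I (L ++ [e]))) :
    Run M T (.forPairs a b P) s (n * (m * (c + 2) + 4) + 2)
      fun s' => I (allPairs n m) s' := by
  have htake : ∀ {N i : ℕ} (h : i < N),
      (List.finRange N).take (i + 1) = (List.finRange N).take i ++ [⟨i, h⟩] := by
    intro N i h
    rw [List.take_add_one, List.getElem?_eq_getElem (by simpa using h)]
    simp
  have hrun := Run.forUpTo (M := M) (bound := .nF) (P := .forUpTo b .nW P) (N := n)
    (c := m * (c + 2) + 2) hT
    (fun x s' => I (((List.finRange n).take x).flatMap
      fun x => (List.finRange m).map fun y => (x, y)) s') (a := a) (s := s)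
    (by simp [Program.forUpTo, Program.nums, hab, ha]) (fun _ _ => rfl)
    (fun i s v h => hI _ s a v h (Or.inl rfl)) (by simpa using h0) ?_
  · refine hrun.mono (le_of_eq (by ring)) fun s' h => ?_
    rwa [List.take_of_length_le (by simp)] at h
  · intro x s₁ hx hag hsx h
    refine (Run.forUpTo (M := M) (bound := .nW) (N := m) (c := c) hT
      (fun y s' => I ((((List.finRange n).take x).flatMap
        fun x => (List.finRange m).map fun y => (x, y)) ++
          ((List.finRange m).take y).map fun y => (⟨x, hx⟩, y)) s') hb (fun _ _ => rfl)
      (fun i s v h => hI _ s b v h (Or.inr rfl)) (by simpa using h) ?_).mono le_rfl fun s' h => ?_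
    · intro y s₂ hy hag' hsy h
      have hag2 : Agree (.forPairs a b P) s₁ s₂ := hag'.mono
        (fun i hi => by
          simp only [Program.forPairs, Program.forUpTo, Program.nums, List.mem_append] at hi ⊢
          tauto)
        (by simp [Program.forPairs, Program.forUpTo, Program.sets])
      have := hbody _ (⟨x, hx⟩, ⟨y, hy⟩) s₂ (Agree.trans hag hag2)
        (by rw [hag'.num a (by simp [Program.forUpTo, Program.nums, hab, ha]), hsx]) hsy h
      refine this.mono le_rfl fun s' h' => ?_
      rw [htake hy, List.map_append, ← List.append_assoc]
      exact h'
    · rw [htake hx, List.flatMap_append]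
      rw [List.take_of_length_le (l := List.finRange m) (by simp)] at h
      simpa using h

theorem pairs_bound_le {n m c : ℕ} (hn : 1 ≤ n) (hm : 1 ≤ m) :
    n * (m * (c + 2) + 4) + 2 ≤ n * m * (c + 8) := by
  nlinarith [Nat.mul_le_mul hn hm, Nat.mul_le_mul_left n hm]

end OracleMachine

namespace OracleMachine

variable {n m : ℕ}

/-! ### Sets of pairs in memory -/

theorem mem_toNatSet {k : ℕ} {S : Finset (Fin k)} {x : Fin k} : (x : ℕ) ∈ toNatSet S ↔ x ∈ S := by
  simp only [toNatSet, Finset.mem_map, Fin.valEmbedding_apply]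
  exact ⟨fun ⟨y, hy, he⟩ => Fin.ext he ▸ hy, fun h => ⟨x, h, rfl⟩⟩

theorem toNatSet_inj {k : ℕ} {S S' : Finset (Fin k)} : toNatSet S = toNatSet S' ↔ S = S' :=
  Finset.map_inj

theorem toNatSet_empty {k : ℕ} : toNatSet (∅ : Finset (Fin k)) = ∅ := Finset.map_empty _

theorem toNatSet_eq_empty {k : ℕ} {S : Finset (Fin k)} : toNatSet S = ∅ ↔ S = ∅ :=
  Finset.map_eq_empty

theorem toNatSet_singleton {k : ℕ} (x : Fin k) : toNatSet {x} = {(x : ℕ)} := by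
  simp [toNatSet]

theorem toNatSet_union {k : ℕ} (S S' : Finset (Fin k)) :
    toNatSet S ∪ toNatSet S' = toNatSet (S ∪ S') := (Finset.map_union ..).symm

theorem toNatSet_inter {k : ℕ} (S S' : Finset (Fin k)) :
    toNatSet S ∩ toNatSet S' = toNatSet (S ∩ S') := (Finset.map_inter ..).symm

theorem toNatSet_sdiff {k : ℕ} (S S' : Finset (Fin k)) :
    toNatSet S \ toNatSet S' = toNatSet (S \ S') := by
  ext x
  simp only [toNatSet, Finset.mem_sdiff, Finset.mem_map, Fin.valEmbedding_apply]
  constructor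
  · rintro ⟨⟨y, hy, rfl⟩, h⟩
    exact ⟨y, ⟨hy, fun hy' => h ⟨y, hy', rfl⟩⟩, rfl⟩
  · rintro ⟨y, ⟨hy, hy'⟩, rfl⟩
    exact ⟨⟨y, hy, rfl⟩, fun ⟨z, hz, he⟩ => hy' (Fin.ext he ▸ hz)⟩

theorem sInf_toNatSet {k : ℕ} {S : Finset (Fin k)} (h : S.Nonempty) :
    ∃ x ∈ S, sInf (toNatSet S : Set ℕ) = x := by
  have hne : (toNatSet S : Set ℕ).Nonempty := by
    rw [Finset.coe_nonempty, Finset.nonempty_iff_ne_empty, Ne, toNatSet_eq_empty]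
    exact h.ne_empty
  have := Nat.sInf_mem hne
  rw [Finset.mem_coe, toNatSet, Finset.mem_map] at this
  obtain ⟨x, hx, he⟩ := this
  exact ⟨x, hx, he.symm⟩

/-- The set array `a` contains the pairs `X`, indexed by the firms. -/
def FirmRows (s : Memory) (a : ℕ) (X : Finset (Fin n × Fin m)) : Prop :=
  ∀ f : Fin n, s.set a f 0 0 = toNatSet (Market.atFirm X f)

/-- The set array `a` contains the pairs `X`, indexed by the workers. -/
def WorkerRows (s : Memory) (a : ℕ) (X : Finset (Fin n × Fin m)) : Prop :=
  ∀ w : Fin m, s.set a w 0 0 = toNatSet (Market.atWorker X w)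

theorem FirmRows.congr {s s' : Memory} {a : ℕ} {X : Finset (Fin n × Fin m)} (h : FirmRows s a X)
    (he : s'.set a = s.set a) : FirmRows s' a X := fun f => by rw [he, h f]

theorem lt_max_firm (f : Fin n) : (f : ℕ) < max n m := lt_max_of_lt_left f.2

theorem lt_max_worker (w : Fin m) : (w : ℕ) < max n m := lt_max_of_lt_right w.2

theorem Memory.setNum_num (s : Memory) (a i j k v a' i' j' k' : ℕ) :
    (s.setNum a i j k v).num a' i' j' k' =
      if a' = a ∧ i' = i ∧ j' = j ∧ k' = k then v else s.num a' i' j' k' := rfl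

theorem Memory.setNum_set (s : Memory) (a i j k v : ℕ) : (s.setNum a i j k v).set = s.set := rfl

theorem Memory.setSet_set (s : Memory) (a i j k : ℕ) (V : Finset ℕ) (a' i' j' k' : ℕ) :
    (s.setSet a i j k V).set a' i' j' k' =
      if a' = a ∧ i' = i ∧ j' = j ∧ k' = k then V else s.set a' i' j' k' := rfl

theorem Memory.setSet_num (s : Memory) (a i j k : ℕ) (V : Finset ℕ) :
    (s.setSet a i j k V).num = s.num := rfl

/-! ### Deferred acceptance -/

/-- The set stored in the scalar set variable `a`. -/
abbrev SetExp.var (a : ℕ) : SetExp := .cell a (.const 0) (.const 0) (.const 0)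

/-- Row `x` of the set array `a`. -/
abbrev SetExp.row (a : ℕ) (x : NumExp) : SetExp := .cell a x (.const 0) (.const 0)

/-- Assign a scalar set variable. -/
abbrev Program.assignVar (a : ℕ) (X : SetExp) : Program :=
  .assignSet a (.const 0) (.const 0) (.const 0) X

/-- Assign a row of a set array. -/
abbrev Program.assignRow (a : ℕ) (x : NumExp) (X : SetExp) : Program :=
  .assignSet a x (.const 0) (.const 0) X

/-- Assign a scalar number variable. -/
abbrev Program.assignNumVar (a : ℕ) (x : NumExp) : Program :=
  .assignNum a (.const 0) (.const 0) (.const 0) x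

/-- Pick an element as the value of a scalar number variable. -/
abbrev Program.pickVar (a : ℕ) (X : SetExp) : Program :=
  .pick a (.const 0) (.const 0) (.const 0) X

open Program in
/-- The firm `var 16` proposes to the worker `var 17`. -/
def proposeProgram : Program :=
  .seq (assignVar 11 (.union (.row 8 (.var 17)) (.singleton (.var 16)))) <|
  .seq (.queryW 10 (.const 0) (.const 0) (.const 0) (.var 17) (.var 11)) <|
  .seq (assignVar 11 (.sdiff (.var 11) (.var 10))) <|
  .seq (assignRow 7 (.var 16) (.union (.row 7 (.var 16)) (.singleton (.var 17)))) <|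
  .seq (assignRow 8 (.var 17) (.var 10)) <|
  -- The scratch set `11` now contains the displaced firms. Clearing it serves as the idle
  -- instruction, here and in later programs.
  .ite (.setEq (.var 11) .empty) (assignVar 11 .empty) <|
  .seq (pickVar 18 (.var 11)) <|
  -- The displaced firm may be the proposer itself. It loses the pair and has to be examined again.
  .seq (assignRow 6 (.var 18) (.sdiff (.row 6 (.var 18)) (.singleton (.var 17)))) <|
  .seq (assignRow 7 (.var 18) (.sdiff (.row 7 (.var 18)) (.singleton (.var 17)))) <|
  assignVar 9 (.union (.var 9) (.singleton (.var 18)))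

open Program in
/-- Examine a firm in the set `var 9`. -/
def examineProgram : Program :=
  .seq (pickVar 16 (.var 9)) <|
  .seq (.queryF 10 (.const 0) (.const 0) (.const 0) (.var 16) (.row 6 (.var 16))) <|
  .seq (assignVar 10 (.sdiff (.var 10) (.row 7 (.var 16)))) <|
  .ite (.setEq (.var 10) .empty)
    (assignVar 9 (.sdiff (.var 9) (.singleton (.var 16))))
    (.seq (pickVar 17 (.var 10)) proposeProgram)

/-- Deferred acceptance from the available pairs in the set array `6`; the workers hold the pairs in
the set arrays `7` and `8`, and the set `var 9` contains the firms which have to be examined. -/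
def deferredAcceptance : Program :=
  .loop (.not (.setEq (.var 9) .empty)) examineProgram

open Market PathIndependent IsSetLattice

variable {M : Market (Fin n) (Fin m)} {T : ℕ} {hM : M.IsCM}

/-- The memory contains a state of the deferred acceptance procedure with measure at most `v`. -/
def HoldsDA (hM : M.IsCM) (p : M.StableLattice hM → Prop) (Z : Finset (Fin n × Fin m)) (v : ℕ)
    (s : Memory) : Prop :=
  ∃ A P D, DAInv hM p Z A P D ∧ FirmRows s 6 A ∧ FirmRows s 7 (M.workerChoice P) ∧
    WorkerRows s 8 (M.workerChoice P) ∧ s.set 9 0 0 0 = toNatSet D ∧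
    -- A proposal lowers the first summand by `2` and adds at most one firm to `D`; an examination
    -- without a proposal removes one firm. So the measure always drops.
    2 * (M.acc \ P).card + D.card ≤ v

/-- Only the addressed worker changes what is held, and at most one pair is displaced; hence
updating single rows carries out `DAInv.propose`. -/
theorem wp_proposeProgram {p : M.StableLattice hM → Prop} {Z A P : Finset (Fin n × Fin m)}
    {D : Finset (Fin n)} {v : ℕ} {s : Memory} (h : DAInv hM p Z A P D)
    (h6 : FirmRows s 6 A) (h7 : FirmRows s 7 (M.workerChoice P))
    (h8 : WorkerRows s 8 (M.workerChoice P)) (h9 : s.set 9 0 0 0 = toNatSet D)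
    (hv : 2 * (M.acc \ P).card + D.card ≤ v) {f : Fin n} {w : Fin m} (hf : s.num 16 0 0 0 = f)
    (hw : s.num 17 0 0 0 = w) (he : (f, w) ∈ M.firmChoice A)
    (hne : (f, w) ∉ M.workerChoice P) :
    proposeProgram.wp M (fun s' => ∃ v' < v, HoldsDA hM p Z v' s') s := by
  set B := M.workerChoice P with hB
  set B' := M.workerChoice (insert (f, w) P) with hB'
  have hacc : (f, w) ∈ M.acc := M.firmChoice_subset_acc _ he
  have hBacc : B ⊆ M.acc := workerChoice_subset_acc P
  have heB' : B' = M.workerChoice (insert (f, w) B) := (hM.workerChoice.insert_choice _ _).symm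
  have hB'sub : B' ⊆ insert (f, w) B := heB' ▸ hM.workerChoice.subset _
  have hins : insert (f, w) B ⊆ M.acc := Finset.insert_subset hacc hBacc
  have hrow : M.choiceW w (insert f (atWorker B w)) = atWorker B' w := by
    ext x
    rw [mem_atWorker, heB', mem_workerChoice hins, atWorker_insert]
  have hother : ∀ x y, y ≠ w → ((x, y) ∈ B' ↔ (x, y) ∈ B) := by
    intro x y hy
    have : atWorker (insert (f, w) B) y = atWorker B y := by
      ext z; simp [mem_atWorker, hy]
    rw [heB', mem_workerChoice hins, this, ← mem_workerChoice hBacc, hM.workerChoice.idem]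
  have hPn : (f, w) ∉ P := h.notMem_proposed he hne
  have hcard : (M.acc \ insert (f, w) P).card + 1 = (M.acc \ P).card := by
    rw [← Finset.card_erase_add_one (a := (f, w)) (s := M.acc \ P) (by simp [hacc, hPn])]
    congr 2
    ext x
    simp only [Finset.mem_sdiff, Finset.mem_insert, Finset.mem_erase]
    tauto
  have e8 : s.set 8 w 0 0 ∪ {(f : ℕ)} = toNatSet (insert f (atWorker B w)) := by
    rw [h8 w, ← toNatSet_singleton, toNatSet_union, Finset.union_comm, Finset.insert_eq]
  have hrej : ∀ x, x ∈ insert f (atWorker B w) \ atWorker B' w ↔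
      (x, w) ∈ insert (f, w) B \ B' := by
    intro x
    simp [mem_atWorker]
  have hrejw : ∀ x y, (x, y) ∈ insert (f, w) B \ B' → y = w := by
    intro x y hxy
    by_contra hy
    rw [Finset.mem_sdiff, hother x y hy, Finset.mem_insert] at hxy
    rcases hxy.1 with h1 | h1
    · exact hy (Prod.ext_iff.1 h1).2
    · exact hxy.2 h1
  simp only [proposeProgram, Program.wp, NumExp.eval, SetExp.eval, Cond.eval, Memory.setSet_num,
    Memory.setSet_set, Memory.setNum_set, hf, hw, lt_max_firm, if_true, and_self]
  refine ⟨w, insert f (atWorker B w), rfl, e8, ?_, ?_⟩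
  · intro x hx
    rw [mem_atWorker]
    rcases Finset.mem_insert.1 hx with rfl | hx
    · exact hacc
    · exact hBacc (mem_atWorker.1 hx)
  simp only [Nat.reduceEqDiff, false_and, if_false, if_true, and_true, true_and, e8, hrow, hw,
    Memory.setSet_num, Memory.setNum_num, toNatSet_sdiff, lt_max_worker]
  have hval : ∀ {k : ℕ} (x y : Fin k), (x : ℕ) = y ↔ x = y := fun x y => Fin.val_inj
  constructor
  · intro hR
    rw [toNatSet_eq_empty] at hR
    have hR' : insert (f, w) B \ B' = ∅ := by
      rw [Finset.eq_empty_iff_forall_notMem]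
      rintro ⟨x, y⟩ hxy
      obtain rfl := hrejw x y hxy
      rw [← hrej, hR] at hxy
      exact absurd hxy (Finset.notMem_empty _)
    have hBB' : B' = insert (f, w) B :=
      Finset.Subset.antisymm hB'sub (Finset.sdiff_eq_empty_iff_subset.1 hR')
    have hinv := h.propose he subset_rfl (by rw [← hB, ← hB', hR']; simp)
    rw [← hB, ← hB', hR', Finset.sdiff_empty] at hinv
    refine ⟨v - 1, by omega, A, insert (f, w) P, D, hinv, ?_, ?_, ?_, ?_, by omega⟩
    · intro f'
      simp only [Memory.setSet_set, Nat.reduceEqDiff, false_and, if_false]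
      exact h6 f'
    · intro f'
      rw [← hB', hBB']
      simp only [Memory.setSet_set, Nat.reduceEqDiff, false_and, if_false, true_and, and_true, hval]
      split_ifs with hff
      · subst hff
        rw [h7, ← toNatSet_singleton, toNatSet_union, atFirm_insert, Finset.union_comm,
          Finset.insert_eq]
      · rw [h7]
        congr 1
        ext y
        simp [mem_atFirm, hff]
    · intro w'
      rw [← hB']
      simp only [Memory.setSet_set, Nat.reduceEqDiff, false_and, if_false, true_and, and_true, hval]
      split_ifs with hww
      · rw [hww]
      · rw [h8]
        congr 1
        ext x
        rw [mem_atWorker, mem_atWorker, hother x w' hww]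
    · simp only [Memory.setSet_set, Nat.reduceEqDiff, false_and, if_false]
      exact h9
  · intro hR
    rw [toNatSet_eq_empty, ← Ne, ← Finset.nonempty_iff_ne_empty] at hR
    obtain ⟨g, hg, hge⟩ := sInf_toNatSet hR
    simp only [hge, hval, lt_max_firm, if_true]
    rw [hrej] at hg
    -- The least displaced firm is the only one, so treating `g` alone suffices.
    have hR' : insert (f, w) B \ B' = {(g, w)} :=
      Finset.eq_singleton_iff_unique_mem.2 ⟨hg, fun x hx =>
        Finset.card_le_one.1 (DAInv.card_rejected_le (hM := hM) (f, w) P) x hx _ hg⟩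
    have hB'mem : ∀ x y, (x, y) ∈ B' ↔ ((x, y) = (f, w) ∨ (x, y) ∈ B) ∧ ¬ (x = g ∧ y = w) := by
      intro x y
      have h1 := Finset.ext_iff.1 hR' (x, y)
      rw [Finset.mem_sdiff, Finset.mem_insert, Finset.mem_singleton, Prod.mk.injEq x y g w] at h1
      have h2 := @hB'sub (x, y)
      rw [Finset.mem_insert] at h2
      exact ⟨fun hb => ⟨h2 hb, fun hgw => (h1.2 hgw).2 hb⟩,
        fun ⟨ha, hn⟩ => by_contra fun hb => hn (h1.1 ⟨ha, hb⟩)⟩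
    have hinv := h.propose he (Finset.subset_insert g D) (by
      rw [← hB, ← hB', hR']; simp)
    rw [← hB, ← hB', hR'] at hinv
    have hD := Finset.card_insert_le g D
    refine ⟨v - 1, by omega, _, insert (f, w) P, insert g D, hinv, ?_, ?_, ?_, ?_, by omega⟩
    · intro f'
      simp only [Memory.setSet_set, Memory.setNum_set, Nat.reduceEqDiff, false_and, if_false,
        true_and, and_true, hval]
      split_ifs with hff
      · subst hff
        rw [h6, ← toNatSet_singleton, toNatSet_sdiff]
        congr 1
        ext y
        simp [mem_atFirm]
      · rw [h6]
        congr 1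
        ext y
        simp [mem_atFirm, hff]
    · intro f'
      rw [← hB']
      simp only [Memory.setSet_set, Memory.setNum_set, Nat.reduceEqDiff, false_and, if_false,
        true_and, and_true, hval]
      simp only [h7 _, ← toNatSet_singleton, toNatSet_union]
      rw [← apply_ite toNatSet, toNatSet_sdiff, ← apply_ite toNatSet, ← apply_ite toNatSet,
        toNatSet_inj]
      ext y
      rw [mem_atFirm, hB'mem, Prod.mk.injEq]
      clear hB'mem hinv hR' hrej hrejw hg hge e8 hrow hother
      by_cases h1 : f' = g
      · rw [if_pos h1, Finset.mem_sdiff, Finset.mem_singleton]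
        by_cases h2 : g = f
        · rw [if_pos h2, Finset.mem_union, Finset.mem_singleton, mem_atFirm, h1, h2]
          tauto
        · rw [if_neg h2, mem_atFirm, h1]
          tauto
      · rw [if_neg h1]
        by_cases h2 : f' = f
        · rw [if_pos h2, Finset.mem_union, Finset.mem_singleton, mem_atFirm, h2]
          rw [h2] at h1
          tauto
        · rw [if_neg h2, mem_atFirm]
          tauto
    · intro w'
      rw [← hB']
      simp only [Memory.setSet_set, Memory.setNum_set, Nat.reduceEqDiff, false_and, if_false,
        true_and, and_true, hval]
      split_ifs with hww
      · rw [hww]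
      · rw [h8]
        congr 1
        ext x
        rw [mem_atWorker, mem_atWorker, hother x w' hww]
    · simp only [Memory.setSet_set, and_true, if_true]
      rw [h9, ← toNatSet_singleton, toNatSet_union, Finset.union_comm, Finset.insert_eq]

theorem wp_examineProgram {p : M.StableLattice hM → Prop} {Z : Finset (Fin n × Fin m)}
    {v : ℕ} {s : Memory} (h : HoldsDA hM p Z v s) (hne : s.set 9 0 0 0 ≠ ∅) :
    examineProgram.wp M (fun s' => ∃ v' < v, HoldsDA hM p Z v' s') s := by
  obtain ⟨A, P, D, h, h6, h7, h8, h9, hv⟩ := h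
  rw [h9, Ne, toNatSet_eq_empty, ← Ne, ← Finset.nonempty_iff_ne_empty] at hne
  obtain ⟨f, hfD, hf⟩ := sInf_toNatSet hne
  have hval : ∀ {k : ℕ} (x y : Fin k), (x : ℕ) = y ↔ x = y := fun x y => Fin.val_inj
  simp only [examineProgram, Program.wp, NumExp.eval, SetExp.eval, Cond.eval, Memory.setSet_num,
    Memory.setSet_set, Memory.setNum_set, Memory.setNum_num, h9, hf, lt_max_firm, if_true, and_self,
    Nat.reduceEqDiff, false_and, if_false, and_true]
  refine ⟨f, atFirm A f, rfl, h6 f, atFirm_mono h.avail_subset f, ?_⟩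
  rw [h7, toNatSet_sdiff]
  have hmem : ∀ w, w ∈ M.choiceF f (atFirm A f) \ atFirm (M.workerChoice P) f ↔
      (f, w) ∈ M.firmChoice A ∧ (f, w) ∉ M.workerChoice P := by
    intro w
    rw [Finset.mem_sdiff, mem_atFirm, mem_firmChoice h.avail_subset]
  constructor
  · intro hS
    rw [toNatSet_eq_empty] at hS
    have hD := Finset.card_erase_add_one hfD
    refine ⟨v - 1, by omega, A, P, D.erase f, h.erase ?_, ?_, ?_, ?_, ?_, by omega⟩
    · rintro ⟨f', w⟩ he rfl
      by_contra hn
      have := (hmem w).2 ⟨he, hn⟩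
      rw [hS] at this
      exact absurd this (Finset.notMem_empty _)
    · intro f'
      simp only [Memory.setSet_set, Memory.setNum_set, Nat.reduceEqDiff, false_and, if_false]
      exact h6 f'
    · intro f'
      simp only [Memory.setSet_set, Memory.setNum_set, Nat.reduceEqDiff, false_and, if_false]
      exact h7 f'
    · intro f'
      simp only [Memory.setSet_set, Memory.setNum_set, Nat.reduceEqDiff, false_and, if_false]
      exact h8 f'
    · simp only [Memory.setSet_set, and_true, if_true]
      rw [← toNatSet_singleton, toNatSet_sdiff, Finset.erase_eq]
  · intro hS
    rw [toNatSet_eq_empty, ← Ne, ← Finset.nonempty_iff_ne_empty] at hS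
    obtain ⟨w, hwS, hw⟩ := sInf_toNatSet hS
    rw [hmem] at hwS
    refine wp_proposeProgram h ?_ ?_ ?_ ?_ hv (f := f) (w := w) ?_ ?_ hwS.1 hwS.2
    · exact h6
    · exact h7
    · exact h8
    · exact h9
    · rfl
    · simp [Memory.setNum_num, hw]

theorem run_deferredAcceptance (hT : 1 ≤ T) {p : M.StableLattice hM → Prop}
    {Z : Finset (Fin n × Fin m)} {v : ℕ} {s : Memory} (h : HoldsDA hM p Z v s) :
    Run M T deferredAcceptance s (v * 24 + 1) fun s' =>
      ∃ A P, DAInv hM p Z A P ∅ ∧ FirmRows s' 6 A ∧ FirmRows s' 7 (M.workerChoice P) := by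
  have := Run.loop (M := M) (b := .not (.setEq (.var 9) .empty)) (P := examineProgram)
    -- `23` bounds the steps of one examination; the test of the loop makes it `24`.
    (c := 23) hT (HoldsDA hM p Z) (fun v s h hb => ?_) h
  · refine this.mono le_rfl fun s' h' => ?_
    obtain ⟨⟨v', A, P, D, h1, h6, h7, h8, h9, hv⟩, hb⟩ := h'
    simp only [Cond.eval, SetExp.eval, NumExp.eval, not_not, h9, toNatSet_eq_empty] at hb
    subst hb
    exact ⟨A, P, h1, h6, h7⟩
  · refine (Run.of_wp hT (wp_examineProgram h ?_)).mono (by decide) fun _ h => h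
    simpa [Cond.eval, SetExp.eval, NumExp.eval] using hb

end OracleMachine

/-! ## The stable matchings obtained by forced proposals -/

namespace Market

open PathIndependent IsSetLattice AffineRep

variable {F W : Type*} [DecidableEq F] [DecidableEq W] [Fintype F] [Fintype W] {M : Market F W}
  (hM : M.IsCM)

/-- The outcome of deferred acceptance after the forced proposal `b`: the available pairs `A` and
the pairs `V` that are held. -/
structure IsForcedOutcome (b : F × W) (A V : Finset (F × W)) : Prop where
  notMem_avail : b ∉ A
  notMem_held : ∀ ν, b ∈ passed (pairsOf hM) ν → b ∉ V
  exists_stable : b ∉ V → ∃ η, pairsOf hM η = V ∧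
    (∀ e ∈ M.stablePairs, e ∉ A ↔ e ∈ passed (pairsOf hM) η) ∧
    ∀ ν, b ∈ passed (pairsOf hM) ν → ν ≤ η

variable {hM}

/-- Only `b` can be held without being available, so the held pairs are stable as soon as `b` is not
held; and `b` is not held if there is a target, by `disjoint_of_target`. -/
theorem DAInv.isForcedOutcome {b : F × W} {A T : Finset (F × W)}
    (h : DAInv hM (fun ν => b ∈ passed (pairsOf hM) ν) {b} A T ∅) :
    IsForcedOutcome hM b A (M.workerChoice T) where
  notMem_avail := h.forced_disjoint b (Finset.mem_singleton_self b)
  notMem_held ν hν hb := h.forced_disjoint b (Finset.mem_singleton_self b)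
    (h.disjoint_of_target hν hb)
  exists_stable hb := by
    have hV : M.workerChoice T ⊆ A := fun e he =>
      (Finset.mem_union.1 (h.held_subset he)).resolve_right fun h' =>
        hb (Finset.mem_singleton.1 h' ▸ he)
    exact ⟨ofStab hM (h.stab_workerChoice hV), rfl, fun e he => h.notMem_avail_iff hV he,
      fun ν hν => h.target_le hV hν⟩

theorem DAInv.eq_top {A T : Finset (F × W)} (h : DAInv hM (fun _ => True) ∅ A T ∅) :
    M.workerChoice T = pairsOf hM ⊤ := by
  have hV : M.workerChoice T ⊆ A := fun e he =>
    (Finset.mem_union.1 (h.held_subset he)).resolve_right (Finset.notMem_empty e)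
  exact congrArg (pairsOf hM) (top_le_iff.1 (h.target_le hV (ν := ⊤) trivial))

variable (hM)

theorem passed_subset_stablePairs {μ : M.StableLattice hM} {b : F × W}
    (hb : b ∈ passed (pairsOf hM) μ) : b ∈ M.stablePairs := by
  obtain ⟨η, -, h⟩ := hb.1
  exact (mem_stablePairs hM).2 ⟨η, h⟩

/-- The pairs that leave the matching in some rotation. -/
noncomputable def passedPairs : Finset (F × W) := by
  classical exact Finset.univ.filter fun b => ∃ μ, b ∈ passed (pairsOf hM) μ

theorem mem_passedPairs {b : F × W} : b ∈ passedPairs hM ↔ ∃ μ, b ∈ passed (pairsOf hM) μ := by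
  simp [passedPairs]

theorem passedPairs_subset : passedPairs hM ⊆ M.stablePairs := fun _ hb => by
  obtain ⟨μ, hμ⟩ := (mem_passedPairs hM).1 hb
  exact passed_subset_stablePairs hM hμ

include hM in
theorem stablePairs_subset_acc : M.stablePairs ⊆ M.acc := fun _ hb => by
  obtain ⟨μ, hμ⟩ := (mem_stablePairs hM).1 hb
  exact pairsOf_subset_acc hM μ hμ

theorem exists_rotation_of_mem_passedPairs {b : F × W} (hb : b ∈ passedPairs hM) :
    ∃ ρ : M.Rotation, b ∈ ρ.1.2 := by
  obtain ⟨μ, hμ⟩ := (mem_passedPairs hM).1 hb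
  obtain ⟨ρ, hρ, hbρ⟩ := (isSetLattice hM).exists_isRotation_minus hμ
  exact ⟨⟨ρ, (isRotation_iff hM ρ).2 hρ⟩, hbρ⟩

theorem mem_passedPairs_of_mem_minus {ρ : M.Rotation} {b : F × W} (hb : b ∈ ρ.1.2) :
    b ∈ passedPairs hM :=
  (mem_passedPairs hM).2 ⟨_, (((rotationBase_spec hM ρ).minus_iff b).1 hb _).2 le_rfl⟩

/-- The rotation in which the pair leaves the matching. -/
noncomputable def rotationOf (b : F × W) (hb : b ∈ passedPairs hM) : M.Rotation :=
  (exists_rotation_of_mem_passedPairs hM hb).choose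

theorem mem_rotationOf (b : F × W) (hb : b ∈ passedPairs hM) : b ∈ (rotationOf hM b hb).1.2 :=
  (exists_rotation_of_mem_passedPairs hM hb).choose_spec

theorem mem_passed_iff {b : F × W} {ρ : M.Rotation} (hb : b ∈ ρ.1.2) (ν : M.StableLattice hM) :
    b ∈ passed (pairsOf hM) ν ↔ ν ≤ rotationBase hM ρ :=
  ((rotationBase_spec hM ρ).minus_iff b).1 hb ν

include hM in
theorem rotation_eq_of_mem_minus {b : F × W} {ρ ρ' : M.Rotation} (hb : b ∈ ρ.1.2)
    (hb' : b ∈ ρ'.1.2) : ρ = ρ' := by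
  have h1 := mem_passed_iff hM hb
  have h2 := mem_passed_iff hM hb'
  exact rotationBase_injective hM (le_antisymm ((h2 _).1 ((h1 _).2 le_rfl))
    ((h1 _).1 ((h2 _).2 le_rfl)))

/-- Since `b` is unavailable, the outcome has passed `b` and hence lies below the base. The base has
passed `b` as well, and the outcome is above every such matching. -/
theorem IsForcedOutcome.eq_base {b : F × W} {A V : Finset (F × W)}
    (h : IsForcedOutcome hM b A V) {ρ : M.Rotation} (hb : b ∈ ρ.1.2) :
    b ∉ V ∧ pairsOf hM (rotationBase hM ρ) = V ∧
      ∀ e ∈ M.stablePairs, e ∉ A ↔ e ∈ passed (pairsOf hM) (rotationBase hM ρ) := by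
  have hbp := (mem_passed_iff hM hb _).2 le_rfl
  have hbV := h.notMem_held _ hbp
  obtain ⟨η, hη, h1, h2⟩ := h.exists_stable hbV
  have h3 := (h1 b (passed_subset_stablePairs hM hbp)).1 h.notMem_avail
  obtain rfl := le_antisymm ((mem_passed_iff hM hb _).1 h3) (h2 _ hbp)
  exact ⟨hbV, hη, h1⟩

/-- A test for leaving in some rotation. It needs `b` to be a stable pair, because only then does
unavailability mean having been passed. -/
theorem IsForcedOutcome.mem_passedPairs {b : F × W} {A V : Finset (F × W)}
    (h : IsForcedOutcome hM b A V) (hb : b ∈ M.stablePairs) : b ∉ V ↔ b ∈ passedPairs hM := by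
  constructor
  · intro hV
    obtain ⟨η, hη, h1, h2⟩ := h.exists_stable hV
    exact (Market.mem_passedPairs hM).2 ⟨η, (h1 b hb).1 h.notMem_avail⟩
  · intro hG
    obtain ⟨ν, hν⟩ := (Market.mem_passedPairs hM).1 hG
    exact h.notMem_held ν hν

/-- The stable pairs are those of the firm-optimal stable matching and of the bases of the
rotations. -/
theorem mem_top_or_exists_base {e : F × W} (he : e ∈ M.stablePairs) :
    e ∈ pairsOf hM ⊤ ∨ ∃ ρ : M.Rotation, e ∈ pairsOf hM (rotationBase hM ρ) := by
  obtain ⟨μ, hμ⟩ := (mem_stablePairs hM).1 he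
  by_cases ht : e ∈ pairsOf hM ⊤
  · exact Or.inl ht
  · obtain ⟨ρ, hρ, heρ⟩ := (isSetLattice hM).exists_isRotation_plus (subset_above μ hμ) ht
    exact Or.inr ⟨⟨ρ, (isRotation_iff hM ρ).2 hρ⟩, (rotationBase_spec hM _).plus_subset heρ⟩

end Market

/-! ### Programs for forced proposals -/

namespace OracleMachine

open Market PathIndependent IsSetLattice

variable {n m : ℕ} {M : Market (Fin n) (Fin m)} {T : ℕ} {hM : M.IsCM}

open Program

/-- Make all pairs available and all proposals void. -/
def freshProgram : Program :=
  .seq (assignVar 9 .empty) <|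
  .seq
    (.forUpTo 12 .nF <|
      .seq (assignRow 6 (.var 12) (.row 0 (.var 12))) <|
      .seq (assignRow 7 (.var 12) .empty) <|
      assignVar 9 (.union (.var 9) (.singleton (.var 12)))) <|
  .forUpTo 12 .nW (assignRow 8 (.var 12) .empty)

/-- The memory contains the initial state of the deferred acceptance procedure. -/
structure HoldsFresh (M : Market (Fin n) (Fin m)) (s : Memory) : Prop where
  avail : FirmRows s 6 M.acc
  held : FirmRows s 7 (∅ : Finset (Fin n × Fin m))
  heldW : WorkerRows s 8 (∅ : Finset (Fin n × Fin m))
  dirty : s.set 9 0 0 0 = toNatSet (Finset.univ : Finset (Fin n))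

theorem atFirm_empty (f : Fin n) : atFirm (∅ : Finset (Fin n × Fin m)) f = ∅ := by
  ext; simp [mem_atFirm]

theorem atWorker_empty (w : Fin m) : atWorker (∅ : Finset (Fin n × Fin m)) w = ∅ := by
  ext; simp [mem_atWorker]

theorem run_freshProgram (hT : 1 ≤ T) {s : Memory} (h0 : FirmRows s 0 M.acc) :
    Run M T freshProgram s (5 * n + 3 * m + 5) (HoldsFresh M) := by
  refine (((Run.of_wp hT (P := assignVar 9 .empty) (Q := fun s => s.set 9 0 0 0 = ∅) ?_).seq
    (b := 1) (c := (n * (3 + 2) + 2) + (m * (1 + 2) + 2)) fun s₁ h1 a1 =>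
    (Run.forUpTo (N := n) hT (c := 3)
      (fun i s => (∀ f : Fin n, (f : ℕ) < i → s.set 6 f 0 0 = toNatSet (atFirm M.acc f) ∧
        s.set 7 f 0 0 = ∅) ∧ s.set 9 0 0 0 =
          toNatSet (Finset.univ.filter fun f : Fin n => (f : ℕ) < i))
      (by decide) (fun _ _ => rfl) (fun _ _ _ h => h) ?_ ?_).seq fun s₂ h2 a2 =>
    (Run.forUpTo (N := m) hT (c := 1) (fun i s => ∀ w : Fin m, (w : ℕ) < i → s.set 8 w 0 0 = ∅)
      (by decide) (fun _ _ => rfl) (fun _ _ _ h => h) ?_ ?_).agree.mono le_rfl ?_)).mono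
        (by omega) fun _ h => h
  · simp [Program.wp, Memory.setSet_set, SetExp.eval, NumExp.eval]
  · refine ⟨fun f hf => absurd hf (Nat.not_lt_zero _), ?_⟩
    rw [h1]
    simp [toNatSet_empty]
  · intro i s' hi ha hv h
    have h0' : FirmRows s' 0 M.acc :=
      h0.congr ((ha.set 0 (by decide)).trans (a1.set 0 (by decide)))
    refine (Run.of_wp hT ?_).mono (show _ ≤ 3 by decide) fun _ h => h
    simp only [Program.wp, NumExp.eval, SetExp.eval, Memory.setSet_num, Memory.setSet_set, hv,
      Nat.reduceEqDiff, false_and, if_false, true_and, and_true, if_true,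
      show i < max n m from lt_max_of_lt_left hi]
    constructor
    · intro f hf
      rcases Nat.lt_succ_iff_lt_or_eq.1 hf with hf | hf
      · simp [hf.ne, h.1 f hf]
      · subst hf
        simp [h0' f]
    · rw [h.2, ← toNatSet_singleton (⟨i, hi⟩ : Fin n), toNatSet_union]
      congr 1
      ext f
      simp [Fin.ext_iff]
      omega
  · exact fun w hw => absurd hw (Nat.not_lt_zero _)
  · intro i s' hi ha hv h
    refine (Run.of_wp hT ?_).mono (show _ ≤ 1 by decide) fun _ h => h
    simp only [Program.wp, NumExp.eval, SetExp.eval, Memory.setSet_set, hv, true_and, and_true]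
    intro w hw
    split_ifs with hwi
    · rfl
    · exact h w (by omega)
  · rintro s₃ ⟨h3, a3⟩
    have e6 := a3.set 6 (by decide)
    have e7 := a3.set 7 (by decide)
    have e9 := a3.set 9 (by decide)
    refine ⟨fun f => ?_, fun f => ?_, fun w => ?_, ?_⟩
    · rw [e6, (h2.1 f f.2).1]
    · rw [e7, (h2.1 f f.2).2, atFirm_empty, toNatSet_empty]
    · rw [h3 w w.2, atWorker_empty, toNatSet_empty]
    · rw [e9, h2.2]
      congr 1
      ext f
      simp

theorem HoldsFresh.holdsDA {s : Memory} (h : HoldsFresh M s) :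
    HoldsDA hM (fun _ => True) ∅ (2 * (n * m) + n) s := by
  refine ⟨M.acc, ∅, Finset.univ, DAInv.init, h.avail, ?_, ?_, h.dirty, ?_⟩
  · rw [Finset.subset_empty.1 (hM.workerChoice.subset ∅)]
    exact h.held
  · rw [Finset.subset_empty.1 (hM.workerChoice.subset ∅)]
    exact h.heldW
  · have := Finset.card_le_univ M.acc
    simp at this ⊢
    exact this

/-- Force the proposal of the firm `var 10` to the worker `var 11`. -/
def forceProgram : Program :=
  .seq (.queryW 10 (.const 0) (.const 0) (.const 0) (.var 11) (.singleton (.var 10))) <|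
  .seq (assignRow 8 (.var 11) (.var 10)) <|
  .seq (assignRow 6 (.var 10) (.sdiff (.row 6 (.var 10)) (.singleton (.var 11)))) <|
  -- Numbers and sets have separate variables: the number `10` is the proposing firm, the set `10`
  -- is the answer of the worker.
  .ite (.mem (.var 10) (.var 10)) (assignRow 7 (.var 10) (.singleton (.var 11)))
    (assignVar 11 .empty)

theorem wp_forceProgram {s : Memory} (h : HoldsFresh M s) {b : Fin n × Fin m} (hb : b ∈ M.acc)
    (hx : s.num 10 0 0 0 = b.1) (hy : s.num 11 0 0 0 = b.2) :
    forceProgram.wp M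
      (HoldsDA hM (fun ν => b ∈ passed (pairsOf hM) ν) {b} (2 * (n * m) + n)) s := by
  obtain ⟨x, y⟩ := b
  have hval : ∀ {k : ℕ} (x y : Fin k), (x : ℕ) = y ↔ x = y := fun x y => Fin.val_inj
  have hsub : ({(x, y)} : Finset (Fin n × Fin m)) ⊆ M.acc := by simpa using hb
  have hself : atWorker ({(x, y)} : Finset (Fin n × Fin m)) y = {x} := by
    ext; simp [mem_atWorker]
  have hmem : (x, y) ∈ M.workerChoice {(x, y)} ↔ x ∈ M.choiceW y {x} := by
    rw [mem_workerChoice hsub, hself]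
  have hsing : ∀ e ∈ M.workerChoice {(x, y)}, e = (x, y) := fun e he =>
    Finset.mem_singleton.1 (hM.workerChoice.subset _ he)
  have hcol : atWorker (M.workerChoice {(x, y)}) y = M.choiceW y {x} := by
    ext z
    rw [mem_atWorker, mem_workerChoice hsub, hself]
  have hres : ∀ s' : Memory, FirmRows s' 6 (M.acc.erase (x, y)) →
      FirmRows s' 7 (M.workerChoice {(x, y)}) → WorkerRows s' 8 (M.workerChoice {(x, y)}) →
      s'.set 9 0 0 0 = toNatSet (Finset.univ : Finset (Fin n)) →
      HoldsDA hM (fun ν => (x, y) ∈ passed (pairsOf hM) ν) {(x, y)} (2 * (n * m) + n) s' := by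
    intro s' h6 h7 h8 h9
    refine ⟨_, {(x, y)}, _, DAInv.init_forced hb, h6, h7, h8, h9, ?_⟩
    have h1 := Finset.card_le_univ (M.acc \ {(x, y)})
    simp only [Finset.card_univ, Fintype.card_prod, Fintype.card_fin] at h1 ⊢
    omega
  have e6 : ∀ f : Fin n, (if (f : ℕ) = x then s.set 6 x 0 0 \ {(y : ℕ)} else s.set 6 f 0 0) =
      toNatSet (atFirm (M.acc.erase (x, y)) f) := by
    intro f
    simp only [hval]
    split_ifs with hf
    · subst hf
      rw [h.avail, ← toNatSet_singleton, toNatSet_sdiff]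
      congr 1
      ext z
      simp [mem_atFirm, and_comm]
    · rw [h.avail]
      congr 1
      ext z
      simp [mem_atFirm, hf]
  have e8 : ∀ w : Fin m, (if (w : ℕ) = y then toNatSet (M.choiceW y {x}) else s.set 8 w 0 0) =
      toNatSet (atWorker (M.workerChoice {(x, y)}) w) := by
    intro w
    simp only [hval]
    split_ifs with hw
    · rw [hw, hcol]
    · rw [h.heldW, atWorker_empty]
      congr 1
      ext z
      rw [mem_atWorker]
      refine ⟨fun h' => absurd h' (Finset.notMem_empty _), fun h' => ?_⟩
      exact absurd (Prod.ext_iff.1 (hsing _ h')).2 hw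
  simp only [forceProgram, Program.wp, NumExp.eval, SetExp.eval, Cond.eval, Memory.setSet_num,
    Memory.setSet_set, hx, hy, lt_max_firm, lt_max_worker, if_true, Nat.reduceEqDiff, false_and,
    if_false, and_true]
  refine ⟨y, {x}, rfl, (toNatSet_singleton x).symm, ?_, ?_⟩
  · simpa [mem_atWorker] using hb
  rw [mem_toNatSet, ← hmem]
  constructor
  · intro hin
    refine hres _ ?_ ?_ ?_ ?_
    · intro f
      simpa only [Memory.setSet_set, Nat.reduceEqDiff, false_and, if_false, and_true, true_and]
        using e6 f
    · intro f
      simp only [Memory.setSet_set, Nat.reduceEqDiff, false_and, if_false, and_true, true_and, hval]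
      split_ifs with hf
      · rw [← toNatSet_singleton]
        congr 1
        ext z
        rw [mem_atFirm, Finset.mem_singleton, hf]
        exact ⟨fun hz => hz ▸ hin, fun hz => (Prod.ext_iff.1 (hsing _ hz)).2⟩
      · rw [h.held, atFirm_empty]
        congr 1
        ext z
        rw [mem_atFirm]
        exact ⟨fun h' => absurd h' (Finset.notMem_empty _),
          fun h' => absurd (Prod.ext_iff.1 (hsing _ h')).1 hf⟩
    · intro w
      simpa only [Memory.setSet_set, Nat.reduceEqDiff, false_and, if_false, and_true, true_and]
        using e8 w
    · simpa only [Memory.setSet_set, Nat.reduceEqDiff, false_and, if_false] using h.dirty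
  · intro hin
    refine hres _ ?_ ?_ ?_ ?_
    · intro f
      simpa only [Memory.setSet_set, Nat.reduceEqDiff, false_and, if_false, and_true, true_and]
        using e6 f
    · intro f
      simp only [Memory.setSet_set, Nat.reduceEqDiff, false_and, if_false]
      rw [h.held, atFirm_empty]
      congr 1
      ext z
      rw [mem_atFirm]
      exact ⟨fun h' => absurd h' (Finset.notMem_empty _),
        fun h' => absurd (hsing _ h' ▸ h') hin⟩
    · intro w
      simpa only [Memory.setSet_set, Nat.reduceEqDiff, false_and, if_false, and_true, true_and]
        using e8 w
    · simpa only [Memory.setSet_set, Nat.reduceEqDiff, false_and, if_false] using h.dirty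

end OracleMachine

namespace OracleMachine

open Market PathIndependent IsSetLattice Program

variable {n m : ℕ} {M : Market (Fin n) (Fin m)} {T : ℕ} {hM : M.IsCM}

/-! ### All forced proposals -/

/-- The set array `a` contains, with the index `b`, the pairs `X`. -/
def PairRows (s : Memory) (a : ℕ) (b : Fin n × Fin m) (X : Finset (Fin n × Fin m)) : Prop :=
  ∀ f : Fin n, s.set a b.1 b.2 f = toNatSet (atFirm X f)

/-- Store the result of deferred acceptance after the forced proposal of the firm `var 10` to the
worker `var 11`. -/
def storeProgram : Program :=
  .seq
    (.forUpTo 12 .nF <|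
      .seq (.assignSet 15 (.var 10) (.var 11) (.var 12) (.row 6 (.var 12))) <|
      .seq (.assignSet 16 (.var 10) (.var 11) (.var 12) (.row 7 (.var 12))) <|
      -- If the forced pair is still held, no stable matching has passed it, and the held pairs are
      -- not added to the stable pairs.
      .ite (.mem (.var 11) (.row 7 (.var 10))) (assignVar 11 .empty)
        (assignRow 12 (.var 12) (.union (.row 12 (.var 12)) (.row 7 (.var 12))))) <|
  .ite (.mem (.var 11) (.row 7 (.var 10)))
    (assignRow 13 (.var 10) (.sdiff (.row 13 (.var 10)) (.singleton (.var 11))))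
    (assignRow 13 (.var 10) (.union (.row 13 (.var 10)) (.singleton (.var 11))))

theorem run_storeProgram (hT : 1 ≤ T) {s : Memory} {b : Fin n × Fin m}
    (hx : s.num 10 0 0 0 = b.1) (hy : s.num 11 0 0 0 = b.2) {A V S R : Finset (Fin n × Fin m)}
    (h6 : FirmRows s 6 A) (h7 : FirmRows s 7 V) (h12 : FirmRows s 12 S) (h13 : FirmRows s 13 R) :
    Run M T storeProgram s (7 * n + 5) fun s' =>
      PairRows s' 15 b A ∧ PairRows s' 16 b V ∧
      (∀ b' ≠ b, ∀ f : Fin n, s'.set 15 b'.1 b'.2 f = s.set 15 b'.1 b'.2 f ∧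
        s'.set 16 b'.1 b'.2 f = s.set 16 b'.1 b'.2 f) ∧
      FirmRows s' 12 (if b ∈ V then S else S ∪ V) ∧
      FirmRows s' 13 (if b ∈ V then R.erase b else insert b R) := by
  have hval : ∀ {k : ℕ} (x y : Fin k), (x : ℕ) = y ↔ x = y := fun x y => Fin.val_inj
  have hbV : ∀ s' : Memory, FirmRows s' 7 V → ((b.2 : ℕ) ∈ s'.set 7 b.1 0 0 ↔ b ∈ V) := by
    intro s' h
    rw [h b.1, mem_toNatSet, mem_atFirm]
  refine ((Run.forUpTo (N := n) hT (c := 5)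
    (fun i s' => (∀ f : Fin n, (f : ℕ) < i → s'.set 15 b.1 b.2 f = toNatSet (atFirm A f) ∧
        s'.set 16 b.1 b.2 f = toNatSet (atFirm V f)) ∧
      (∀ b' ≠ b, ∀ f : Fin n, s'.set 15 b'.1 b'.2 f = s.set 15 b'.1 b'.2 f ∧
        s'.set 16 b'.1 b'.2 f = s.set 16 b'.1 b'.2 f) ∧
      ∀ f : Fin n, s'.set 12 f 0 0 = toNatSet (atFirm (if (f : ℕ) < i ∧ b ∉ V then S ∪ V else S) f))
    (by decide) (fun _ _ => rfl) (fun _ _ _ h => h) ?_ ?_).seq (c := 3) fun s₁ h1 a1 =>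
      (Run.of_wp hT (P := .ite _ _ _) ?_).mono (show _ ≤ 3 by decide) fun _ h => h).mono
        (by omega) fun _ h => h
  · exact ⟨fun f hf => absurd hf (Nat.not_lt_zero _), fun _ _ _ => ⟨rfl, rfl⟩, fun f => by
      simp [h12 f]⟩
  · intro i s' hi ha hv ⟨h15, hne, h12'⟩
    have hx' : s'.num 10 0 0 0 = b.1 := by rw [ha.num 10 (by decide), hx]
    have hy' : s'.num 11 0 0 0 = b.2 := by rw [ha.num 11 (by decide), hy]
    have h6' : FirmRows s' 6 A := h6.congr (ha.set 6 (by decide))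
    have h7' : FirmRows s' 7 V := h7.congr (ha.set 7 (by decide))
    have hpair : ∀ b' : Fin n × Fin m, b' ≠ b → ∀ f : Fin n,
        ¬ ((b'.1 : ℕ) = b.1 ∧ (b'.2 : ℕ) = b.2 ∧ (f : ℕ) = i) := fun b' hb' f h =>
      hb' (Prod.ext (Fin.ext h.1) (Fin.ext h.2.1))
    refine (Run.of_wp hT ?_).mono (show _ ≤ 5 by decide) fun _ h => h
    simp only [Program.wp, NumExp.eval, SetExp.eval, Cond.eval, Memory.setSet_num,
      Memory.setSet_set, hv, hx', hy', hbV s' h7', Nat.reduceEqDiff, false_and, if_false, true_and,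
      and_true]
    have key1 : ∀ f : Fin n, (f : ℕ) < i + 1 →
        (if (f : ℕ) = i then s'.set 6 i 0 0 else s'.set 15 b.1 b.2 f) = toNatSet (atFirm A f) ∧
        (if (f : ℕ) = i then s'.set 7 i 0 0 else s'.set 16 b.1 b.2 f) = toNatSet (atFirm V f) := by
      intro f hf
      by_cases hfi : (f : ℕ) = i
      · simp only [hfi, if_true]
        rw [← hfi]
        exact ⟨h6' f, h7' f⟩
      · simp only [hfi, if_false]
        exact h15 f (by omega)
    constructor
    · intro hbV'
      refine ⟨key1, fun b' hb' f => ?_, fun f => ?_⟩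
      · rw [if_neg (hpair b' hb' f), if_neg (hpair b' hb' f)]
        exact hne b' hb' f
      · rw [h12' f]
        simp [hbV']
    · intro hbV'
      refine ⟨key1, fun b' hb' f => ?_, fun f => ?_⟩
      · rw [if_neg (hpair b' hb' f), if_neg (hpair b' hb' f)]
        exact hne b' hb' f
      · by_cases hfi : (f : ℕ) = i
        · simp only [hfi, if_true, hbV', lt_add_iff_pos_right, Nat.one_pos, not_false_eq_true,
            and_self]
          rw [← hfi, h12' f, h7' f, toNatSet_union, toNatSet_inj]
          ext z
          simp [mem_atFirm, hfi]
        · have : (f : ℕ) < i + 1 ↔ (f : ℕ) < i := by omega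
          rw [if_neg hfi, h12' f]
          simp only [this]
  · obtain ⟨h15, hne, h12'⟩ := h1
    have hx' : s₁.num 10 0 0 0 = b.1 := by rw [a1.num 10 (by decide), hx]
    have hy' : s₁.num 11 0 0 0 = b.2 := by rw [a1.num 11 (by decide), hy]
    have h7' : FirmRows s₁ 7 V := h7.congr (a1.set 7 (by decide))
    have h13' : FirmRows s₁ 13 R := h13.congr (a1.set 13 (by decide))
    have hrows : FirmRows s₁ 12 (if b ∈ V then S else S ∪ V) := by
      intro f
      rw [h12' f]
      by_cases hb : b ∈ V <;> simp [hb]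
    simp only [Program.wp, NumExp.eval, SetExp.eval, Cond.eval, hx', hy', hbV s₁ h7',
      lt_max_worker, if_true]
    constructor
    · intro hb
      rw [if_pos hb] at hrows
      rw [if_pos hb, if_pos hb]
      refine ⟨fun f => ?_, fun f => ?_, fun b' hb' f => ?_, fun f => ?_, fun f => ?_⟩
      · exact (h15 f f.2).1
      · exact (h15 f f.2).2
      · exact hne b' hb' f
      · exact hrows f
      · simp only [Memory.setSet_set, and_true, true_and, hval]
        split_ifs with hf
        · rw [h13', hf, ← toNatSet_singleton, toNatSet_sdiff, toNatSet_inj]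
          ext z
          simp [mem_atFirm, Prod.ext_iff, and_comm]
        · rw [h13', toNatSet_inj]
          ext z
          simp [mem_atFirm, Prod.ext_iff, hf]
    · intro hb
      rw [if_neg hb] at hrows
      rw [if_neg hb, if_neg hb]
      refine ⟨fun f => ?_, fun f => ?_, fun b' hb' f => ?_, fun f => ?_, fun f => ?_⟩
      · exact (h15 f f.2).1
      · exact (h15 f f.2).2
      · exact hne b' hb' f
      · exact hrows f
      · simp only [Memory.setSet_set, and_true, true_and, hval]
        split_ifs with hf
        · rw [h13', hf, ← toNatSet_singleton, toNatSet_union, toNatSet_inj]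
          ext z
          simp [mem_atFirm, Prod.ext_iff]
        · rw [h13', toNatSet_inj]
          ext z
          simp [mem_atFirm, Prod.ext_iff, hf]

/-- Compute the outcome of the forced proposal of the firm `var 10` to the worker `var 11`. -/
def outcomeProgram : Program :=
  .ite (.mem (.var 11) (.row 0 (.var 10)))
    (.seq freshProgram <| .seq forceProgram <| .seq deferredAcceptance storeProgram)
    (assignVar 11 .empty)

/-- Compute the firm-optimal stable matching and the outcomes of all forced proposals. -/
def outcomesProgram : Program :=
  .seq freshProgram <|
  .seq deferredAcceptance <|
  .seq
    (.forUpTo 12 .nF <|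
      .seq (assignRow 17 (.var 12) (.row 7 (.var 12))) <|
      .seq (assignRow 12 (.var 12) (.row 7 (.var 12))) <|
      assignRow 13 (.var 12) .empty) <|
  .forPairs 10 11 outcomeProgram

/-- The memory contains the outcomes of the forced proposals in the list `L`. -/
def HoldsOutcomes (hM : M.IsCM) (L : List (Fin n × Fin m)) (s : Memory) : Prop :=
  ∃ S R : Finset (Fin n × Fin m), FirmRows s 12 S ∧ FirmRows s 13 R ∧
    -- During the computation `S` is only known to consist of stable pairs; it is complete once the
    -- bases of all rotations have been added.
    pairsOf hM ⊤ ⊆ S ∧ S ⊆ M.stablePairs ∧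
    ∀ b ∈ L, b ∈ M.acc → ∃ A V, PairRows s 15 b A ∧ PairRows s 16 b V ∧
      IsForcedOutcome hM b A V ∧ (b ∈ R ↔ b ∉ V) ∧ (b ∉ V → V ⊆ S)

theorem run_outcomeProgram (hT : 1 ≤ T) {L : List (Fin n × Fin m)} {b : Fin n × Fin m} {s : Memory}
    (h0 : FirmRows s 0 M.acc) (hx : s.num 10 0 0 0 = b.1) (hy : s.num 11 0 0 0 = b.2)
    (h : HoldsOutcomes hM L s) :
    Run M T outcomeProgram s (48 * (n * m) + 36 * n + 3 * m + 20) (HoldsOutcomes hM (L ++ [b])) := by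
  obtain ⟨S, R, h12, h13, htop, hS, hL⟩ := h
  have hcond : (Cond.mem (.var 11) (.row 0 (.var 10))).eval n m s ↔ b ∈ M.acc := by
    simp only [Cond.eval, NumExp.eval, SetExp.eval, hx, hy]
    rw [h0 b.1, mem_toNatSet, mem_atFirm]
  refine (Run.ite (c := 48 * (n * m) + 36 * n + 3 * m + 19) hT (fun hb => ?_) fun hb => ?_).mono
    (by omega) fun _ h => h
  · rw [hcond] at hb
    refine ((run_freshProgram hT h0).seq (c := 48 * (n * m) + 31 * n + 14) fun s₁ h1 a1 => ?_).mono
      (by omega) fun _ h => h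
    have hx1 : s₁.num 10 0 0 0 = b.1 := by rw [a1.num 10 (by decide), hx]
    have hy1 : s₁.num 11 0 0 0 = b.2 := by rw [a1.num 11 (by decide), hy]
    refine (((Run.of_wp hT (wp_forceProgram (hM := hM) h1 hb hx1 hy1)).mono (show _ ≤ 8 by decide)
      fun _ h => h).seq (c := 48 * (n * m) + 31 * n + 6) fun s₂ h2 a2 => ?_).mono
      (by omega) fun _ h => h
    refine ((run_deferredAcceptance hT h2).seq (c := 7 * n + 5) fun s₃ h3 a3 => ?_).mono
      (by ring_nf; omega) fun _ h => h
    obtain ⟨A, P, hinv, h6, h7⟩ := h3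
    have hset : ∀ a, a ∉ freshProgram.sets → a ∉ forceProgram.sets → a ∉ deferredAcceptance.sets →
        s₃.set a = s.set a := fun a ha hb hc => by
      rw [a3.set a hc, a2.set a hb, a1.set a ha]
    refine (run_storeProgram (b := b) hT ?_ ?_ h6 h7
      (h12.congr (hset 12 (by decide) (by decide) (by decide)))
      (h13.congr (hset 13 (by decide) (by decide) (by decide)))).mono le_rfl ?_
    · rw [a3.num 10 (by decide), a2.num 10 (by decide), hx1]
    · rw [a3.num 11 (by decide), a2.num 11 (by decide), hy1]
    · rintro s₄ ⟨hA, hV, hother, h12', h13'⟩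
      have hout := hinv.isForcedOutcome
      set V := M.workerChoice P
      refine ⟨_, _, h12', h13', ?_, ?_, ?_⟩
      · split_ifs
        · exact htop
        · exact htop.trans Finset.subset_union_left
      · split_ifs with hbV
        · exact hS
        · refine Finset.union_subset hS fun e he => ?_
          obtain ⟨η, hη, -⟩ := hout.exists_stable hbV
          exact (mem_stablePairs hM).2 ⟨η, hη ▸ he⟩
      · intro b' hb' hacc
        by_cases hbb : b' = b
        · subst hbb
          refine ⟨A, V, hA, hV, hout, ?_, fun hbV => ?_⟩
          · split_ifs with hbV <;> simp [hbV]
          · rw [if_neg hbV]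
            exact Finset.subset_union_right
        · have hb'L : b' ∈ L := by simpa [hbb] using hb'
          obtain ⟨A', V', h15, h16, hout', hR, hVS⟩ := hL b' hb'L hacc
          refine ⟨A', V', fun f => ?_, fun f => ?_, hout', ?_, fun hbV => (hVS hbV).trans ?_⟩
          · rw [(hother b' hbb f).1, hset 15 (by decide) (by decide) (by decide), h15 f]
          · rw [(hother b' hbb f).2, hset 16 (by decide) (by decide) (by decide), h16 f]
          · rw [← hR]
            split_ifs <;> simp [hbb]
          · split_ifs
            · exact subset_rfl
            · exact Finset.subset_union_left
  · rw [hcond] at hb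
    refine (Run.of_wp hT (P := assignVar 11 .empty) ?_).mono (by simp [Program.steps])
      fun _ h => h
    refine ⟨S, R, h12, h13, htop, hS, fun b' hb' hacc => hL b' ?_ hacc⟩
    rcases List.mem_append.1 hb' with h | h
    · exact h
    · exact absurd (List.mem_singleton.1 h ▸ hacc) hb

/-- The memory contains the stable pairs, the firm-optimal stable matching, and the outcomes of the
forced proposals of the pairs that leave the matching in some rotation. -/
structure HoldsTables (hM : M.IsCM) (s : Memory) : Prop where
  stable : FirmRows s 12 M.stablePairs
  forced : ∃ R, FirmRows s 13 R ∧ ∀ b ∈ M.stablePairs, b ∈ R ↔ b ∈ passedPairs hM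
  top : FirmRows s 17 (pairsOf hM ⊤)
  base : ∀ b (ρ : M.Rotation), b ∈ ρ.1.2 → PairRows s 16 b (pairsOf hM (rotationBase hM ρ))
  avail : ∀ b (ρ : M.Rotation), b ∈ ρ.1.2 → ∃ A, PairRows s 15 b A ∧
    ∀ e ∈ M.stablePairs, e ∉ A ↔ e ∈ passed (pairsOf hM) (rotationBase hM ρ)

/-- All stable pairs have been found because each of them is in the top or in the base of a
rotation, and every base is the outcome of a forced proposal. -/
theorem HoldsOutcomes.holdsTables {s : Memory} (h : HoldsOutcomes hM (allPairs n m) s)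
    (h17 : FirmRows s 17 (pairsOf hM ⊤)) : HoldsTables hM s := by
  obtain ⟨S, R, h12, h13, htop, hS, hL⟩ := h
  have hL' : ∀ b ∈ M.stablePairs, ∃ A V, PairRows s 15 b A ∧ PairRows s 16 b V ∧
      IsForcedOutcome hM b A V ∧ (b ∈ R ↔ b ∉ V) ∧ (b ∉ V → V ⊆ S) := fun b hb =>
    hL b (mem_allPairs b) (stablePairs_subset_acc hM hb)
  have hminus : ∀ {b} {ρ : M.Rotation}, b ∈ ρ.1.2 → b ∈ M.stablePairs := fun hb =>
    passedPairs_subset hM (mem_passedPairs_of_mem_minus hM hb)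
  have hSeq : S = M.stablePairs := by
    refine Finset.Subset.antisymm hS fun e he => ?_
    rcases mem_top_or_exists_base hM he with h | ⟨ρ, hρ⟩
    · exact htop h
    · obtain ⟨b, hb⟩ := (rotationBase_spec hM ρ).minus_nonempty
      obtain ⟨A, V, -, -, hout, -, hVS⟩ := hL' b (hminus hb)
      obtain ⟨hbV, hη, -⟩ := hout.eq_base hM hb
      exact hVS hbV (hη ▸ hρ)
  refine ⟨hSeq ▸ h12, ⟨R, h13, fun b hb => ?_⟩, h17, fun b ρ hb => ?_, fun b ρ hb => ?_⟩
  · obtain ⟨A, V, -, -, hout, hR, -⟩ := hL' b hb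
    rw [hR, hout.mem_passedPairs hM hb]
  · obtain ⟨A, V, -, h16, hout, -⟩ := hL' b (hminus hb)
    rw [(hout.eq_base hM hb).2.1]
    exact h16
  · obtain ⟨A, V, h15, -, hout, -⟩ := hL' b (hminus hb)
    exact ⟨A, h15, (hout.eq_base hM hb).2.2⟩

/-- The measure of deferred acceptance starts at `2nm + n`, so each of the `nm` forced proposals
costs `O(nm)` steps. -/
theorem run_outcomesProgram (hT : 1 ≤ T) (hn : 1 ≤ n) (hm : 1 ≤ m) {s : Memory}
    (h0 : FirmRows s 0 M.acc) :
    Run M T outcomesProgram s (300 * (n * m) ^ 2) (HoldsTables hM) := by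
  have hnN : n ≤ n * m := Nat.le_mul_of_pos_right n hm
  have hmN : m ≤ n * m := Nat.le_mul_of_pos_left m hn
  have hN : n * m ≤ (n * m) ^ 2 := Nat.le_self_pow (by decide) _
  refine ((run_freshProgram hT h0).seq (c := 287 * (n * m) ^ 2) fun s₁ h1 a1 => ?_).mono
    (by omega) fun _ h => h
  refine ((run_deferredAcceptance hT (h1.holdsDA (hM := hM))).seq (c := 214 * (n * m) ^ 2)
    fun s₂ h2 a2 => ?_).mono (by ring_nf at hnN hmN hN ⊢; omega) fun _ h => h
  obtain ⟨A, P, hinv, -, h7⟩ := h2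
  rw [hinv.eq_top] at h7
  refine ((Run.forUpTo (N := n) hT (c := 3) (s := s₂)
    (fun i s' => ∀ f : Fin n, (f : ℕ) < i → s'.set 17 f 0 0 = toNatSet (atFirm (pairsOf hM ⊤) f) ∧
      s'.set 12 f 0 0 = toNatSet (atFirm (pairsOf hM ⊤) f) ∧ s'.set 13 f 0 0 = ∅)
    (by decide) (fun _ _ => rfl) (fun _ _ _ h => h) ?_ ?_).seq (c := 200 * (n * m) ^ 2)
      fun s₃ h3 a3 => ?_).mono (by omega) fun _ h => h
  · exact fun f hf => absurd hf (Nat.not_lt_zero _)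
  · intro i s' hi ha hv h
    have h7' := h7.congr (ha.set 7 (by decide))
    refine (Run.of_wp hT ?_).mono (show _ ≤ 3 by decide) fun _ h => h
    simp only [Program.wp, NumExp.eval, SetExp.eval, Memory.setSet_num, Memory.setSet_set, hv,
      Nat.reduceEqDiff, false_and, if_false, true_and, and_true]
    intro f hf
    by_cases hfi : (f : ℕ) = i
    · simp only [hfi, if_true]
      rw [← hfi]
      exact ⟨h7' f, h7' f, trivial⟩
    · simp only [hfi, if_false]
      exact h f (by omega)
  · have h0' : FirmRows s₃ 0 M.acc := h0.congr (by
      rw [a3.set 0 (by decide), a2.set 0 (by decide), a1.set 0 (by decide)])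
    refine (Run.forPairs (c := 48 * (n * m) + 36 * n + 3 * m + 20) hT (HoldsOutcomes hM)
      (by decide) (by decide) (by decide) (fun _ _ _ _ h _ => h) ?_ ?_).agree.mono ?_ ?_
    · refine ⟨pairsOf hM ⊤, ∅, fun f => (h3 f f.2).2.1, fun f => ?_, subset_rfl, fun e he =>
        (mem_stablePairs hM).2 ⟨_, he⟩, by simp⟩
      rw [(h3 f f.2).2.2, atFirm_empty, toNatSet_empty]
    · intro L e s' ha hx hy h
      exact run_outcomeProgram hT (h0'.congr (ha.set 0 (by decide))) hx hy h
    · refine (pairs_bound_le hn hm).trans ?_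
      rw [sq, mul_comm 200, mul_assoc (n * m)]
      exact Nat.mul_le_mul_left _ (by omega)
    · rintro s₄ ⟨h4, a4⟩
      exact h4.holdsTables fun f => by rw [a4.set 17 (by decide), (h3 f f.2).1]

end OracleMachine

/-! ## Listing the rotations -/

namespace Market

open PathIndependent IsSetLattice

variable {F W : Type*} [DecidableEq F] [DecidableEq W] [Fintype F] [Fintype W] {M : Market F W}
  (hM : M.IsCM)

/-- Each pair being passed at the base of the other means that the two bases lie below each other.
-/
theorem mem_minus_iff {ρ ρ' : M.Rotation} {b b' : F × W} (hb : b ∈ ρ.1.2) (hb' : b' ∈ ρ'.1.2) :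
    b' ∈ ρ.1.2 ↔ b' ∈ passed (pairsOf hM) (rotationBase hM ρ) ∧
      b ∈ passed (pairsOf hM) (rotationBase hM ρ') := by
  constructor
  · intro h
    obtain rfl := rotation_eq_of_mem_minus hM h hb'
    exact ⟨(mem_passed_iff hM hb' _).2 le_rfl, (mem_passed_iff hM hb _).2 le_rfl⟩
  · rintro ⟨h1, h2⟩
    obtain rfl := rotationBase_injective hM (le_antisymm ((mem_passed_iff hM hb' _).1 h1)
      ((mem_passed_iff hM hb _).1 h2))
    exact hb'

/-- The pair `a` enters in a rotation `ρ'` whose base contains it. The condition on `b` gives that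
the base of `ρ'` is below that of `ρ`, and `a` being in the base of `ρ` gives the converse. So `ρ⁺`
is the base of `ρ` without the top and without the bases that are not below it. -/
theorem mem_plus_iff {ρ : M.Rotation} {a b : F × W} (hb : b ∈ ρ.1.2) :
    a ∈ ρ.1.1 ↔ a ∈ pairsOf hM (rotationBase hM ρ) ∧ a ∉ pairsOf hM ⊤ ∧
      ∀ ρ' : M.Rotation, b ∉ passed (pairsOf hM) (rotationBase hM ρ') →
        a ∉ pairsOf hM (rotationBase hM ρ') := by
  have hs := rotationBase_spec hM ρ
  constructor
  · intro ha
    refine ⟨hs.plus_subset ha, hs.notMem_top ha, fun ρ' hρ' h => hρ' ?_⟩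
    exact (mem_passed_iff hM hb _).2 (((hs.plus_iff a).1 ha _).1 (subset_above _ h))
  · rintro ⟨h1, h2, h3⟩
    obtain ⟨r, hr, har⟩ := (isSetLattice hM).exists_isRotation_plus (subset_above _ h1) h2
    obtain ⟨ρ', rfl⟩ : ∃ ρ' : M.Rotation, ρ'.1 = r := ⟨⟨r, (isRotation_iff hM r).2 hr⟩, rfl⟩
    have hs' := rotationBase_spec hM ρ'
    have h4 : b ∈ passed (pairsOf hM) (rotationBase hM ρ') := by
      by_contra h
      exact h3 ρ' h (hs'.plus_subset har)
    obtain rfl := rotationBase_injective hM (le_antisymm ((mem_passed_iff hM hb _).1 h4)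
      (((hs'.plus_iff a).1 har _).1 (subset_above _ h1)))
    exact har

open Classical in
/-- The rotations in which pairs of a list leave the matching, in the order of the first such
pairs. -/
noncomputable def listRotations (L : List (F × W)) : List M.Rotation :=
  L.foldl (fun Λ b => if h : b ∈ passedPairs hM ∧ ∀ ρ ∈ Λ, b ∉ ρ.1.2 then
    Λ ++ [rotationOf hM b h.1] else Λ) []

theorem listRotations_append_pos {L : List (F × W)} {b : F × W} (hb : b ∈ passedPairs hM)
    (hn : ∀ ρ ∈ listRotations hM L, b ∉ ρ.1.2) :
    listRotations hM (L ++ [b]) = listRotations hM L ++ [rotationOf hM b hb] := by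
  rw [listRotations, List.foldl_append]
  exact dif_pos ⟨hb, hn⟩

theorem listRotations_append_neg {L : List (F × W)} {b : F × W}
    (hb : ¬ (b ∈ passedPairs hM ∧ ∀ ρ ∈ listRotations hM L, b ∉ ρ.1.2)) :
    listRotations hM (L ++ [b]) = listRotations hM L := by
  rw [listRotations, List.foldl_append]
  exact dif_neg hb

theorem nodup_listRotations (L : List (F × W)) : (listRotations hM L).Nodup := by
  induction L using List.reverseRecOn with
  | nil => exact List.nodup_nil
  | append_singleton L b ih =>
    by_cases hb : b ∈ passedPairs hM ∧ ∀ ρ ∈ listRotations hM L, b ∉ ρ.1.2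
    · rw [listRotations_append_pos hM hb.1 hb.2]
      refine List.Nodup.append ih (List.nodup_singleton _) ?_
      rw [List.disjoint_singleton]
      exact fun h => hb.2 _ h (mem_rotationOf hM b hb.1)
    · rwa [listRotations_append_neg hM hb]

theorem exists_mem_listRotations (L : List (F × W)) :
    ∀ b ∈ L, b ∈ passedPairs hM → ∃ ρ ∈ listRotations hM L, b ∈ ρ.1.2 := by
  induction L using List.reverseRecOn with
  | nil => simp
  | append_singleton L b ih =>
    intro b' hb' hG
    have hmono : ∀ ρ ∈ listRotations hM L, ρ ∈ listRotations hM (L ++ [b]) := by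
      intro ρ hρ
      by_cases hb : b ∈ passedPairs hM ∧ ∀ ρ ∈ listRotations hM L, b ∉ ρ.1.2
      · rw [listRotations_append_pos hM hb.1 hb.2]
        exact List.mem_append_left _ hρ
      · rwa [listRotations_append_neg hM hb]
    rcases List.mem_append.1 hb' with h | h
    · obtain ⟨ρ, hρ, h'⟩ := ih b' h hG
      exact ⟨ρ, hmono ρ hρ, h'⟩
    · obtain rfl := List.mem_singleton.1 h
      by_cases hb : ∀ ρ ∈ listRotations hM L, b' ∉ ρ.1.2
      · exact ⟨rotationOf hM b' hG, by rw [listRotations_append_pos hM hG hb]; simp,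
          mem_rotationOf hM b' hG⟩
      · push Not at hb
        obtain ⟨ρ, hρ, h'⟩ := hb
        exact ⟨ρ, hmono ρ hρ, h'⟩

theorem mem_listRotations {L : List (F × W)} (hL : ∀ b, b ∈ L) (ρ : M.Rotation) :
    ρ ∈ listRotations hM L := by
  obtain ⟨b, hb⟩ := (rotationBase_spec hM ρ).minus_nonempty
  obtain ⟨ρ', hρ', hb'⟩ := exists_mem_listRotations hM L b (hL b)
    (mem_passedPairs_of_mem_minus hM hb)
  rwa [rotation_eq_of_mem_minus hM hb hb']

end Market

/-! ### Programs that list the rotations -/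

namespace OracleMachine

open Market PathIndependent IsSetLattice Program

variable {n m : ℕ} {M : Market (Fin n) (Fin m)} {T : ℕ} {hM : M.IsCM}

/-- Compare the pair `(var 10, var 11)`, which leaves the matching in the current rotation, with
the pair `(var 13, var 14)`. -/
def comparePairProgram : Program :=
  -- Set array `13` is reliable only on stable pairs, hence the intersection with array `12`.
  .ite (.mem (.var 14) (.inter (.row 12 (.var 13)) (.row 13 (.var 13))))
    -- If the current pair is still available in the outcome of the other pair, that outcome is a
    -- base not below the current one, and its pairs are deleted as `mem_plus_iff` demands.
    (.ite (.mem (.var 11) (.cell 15 (.var 13) (.var 14) (.var 10)))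
      (.forUpTo 12 .nF <| .assignSet 3 (.var 1) (.var 12) (.const 0)
        (.sdiff (.cell 3 (.var 1) (.var 12) (.const 0)) (.cell 16 (.var 13) (.var 14) (.var 12))))
      -- Here the current pair has been passed at the other base; if the converse holds too, both
      -- pairs leave in the same rotation.
      (.ite (.mem (.var 14) (.cell 15 (.var 10) (.var 11) (.var 13)))
        (assignVar 11 .empty)
        (.seq (.assignSet 4 (.var 1) (.var 13) (.const 0)
            (.union (.cell 4 (.var 1) (.var 13) (.const 0)) (.singleton (.var 14))))
          (assignRow 14 (.var 13) (.union (.row 14 (.var 13)) (.singleton (.var 14)))))))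
    (assignVar 11 .empty)

/-- List the rotation in which the pair `(var 10, var 11)` leaves the matching, unless it has been
listed before. -/
def listRotationProgram : Program :=
  .ite (.and (.mem (.var 11) (.inter (.row 12 (.var 10)) (.row 13 (.var 10))))
      (.not (.mem (.var 11) (.row 14 (.var 10)))))
    (.seq
      (.forUpTo 12 .nF <|
        .seq (.assignSet 3 (.var 1) (.var 12) (.const 0)
          (.sdiff (.cell 16 (.var 10) (.var 11) (.var 12)) (.row 17 (.var 12))))
        (.assignSet 4 (.var 1) (.var 12) (.const 0) .empty)) <|
    .seq (.forPairs 13 14 comparePairProgram) <|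
    .seq (.assignNum 20 (.var 1) (.const 0) (.const 0) (.var 10)) <|
    .seq (.assignNum 21 (.var 1) (.const 0) (.const 0) (.var 11)) <|
    assignNumVar 1 (.succ (.var 1)))
    (assignVar 11 .empty)

/-- List all rotations. -/
def rotationsProgram : Program :=
  .seq (assignNumVar 1 (.const 0)) <|
  .seq (.forUpTo 12 .nF (assignRow 14 (.var 12) .empty)) <|
  .forPairs 10 11 listRotationProgram

/-- The memory contains the rotation `ρ` with index `i`. -/
structure HoldsRotation (s : Memory) (i : ℕ) (ρ : M.Rotation) : Prop where
  plus : ∀ f : Fin n, s.set 3 i f 0 = toNatSet (atFirm ρ.1.1 f)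
  minus : ∀ f : Fin n, s.set 4 i f 0 = toNatSet (atFirm ρ.1.2 f)
  rep : ∃ b ∈ ρ.1.2, s.num 20 i 0 0 = b.1 ∧ s.num 21 i 0 0 = b.2

/-- The memory contains the rotations in the list `Λ`. -/
structure HoldsRotations (Λ : List M.Rotation) (s : Memory) : Prop where
  count : s.num 1 0 0 0 = Λ.length
  rotation : ∀ (i : ℕ) (h : i < Λ.length), HoldsRotation s i Λ[i]
  listed : ∃ X : Finset (Fin n × Fin m), FirmRows s 14 X ∧ ∀ e, e ∈ X ↔ ∃ ρ ∈ Λ, e ∈ ρ.1.2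

/-- The state of the computation of the rotation `ρ`, in which `b` leaves the matching, after the
comparison of `b` with the pairs in `L`. The pairs in `X₀` have been listed before. -/
structure HoldsPartial (hM : M.IsCM) (s₀ : Memory) (k : ℕ) (ρ : M.Rotation) (b : Fin n × Fin m)
    (X₀ : Finset (Fin n × Fin m)) (L : List (Fin n × Fin m)) (s : Memory) : Prop where
  plus : ∃ X : Finset (Fin n × Fin m), (∀ f : Fin n, s.set 3 k f 0 = toNatSet (atFirm X f)) ∧
    ∀ a, a ∈ X ↔ a ∈ pairsOf hM (rotationBase hM ρ) ∧ a ∉ pairsOf hM ⊤ ∧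
      ∀ b' ∈ L, ∀ ρ' : M.Rotation, b' ∈ ρ'.1.2 →
        b ∉ passed (pairsOf hM) (rotationBase hM ρ') → a ∉ pairsOf hM (rotationBase hM ρ')
  minus : ∃ X : Finset (Fin n × Fin m), (∀ f : Fin n, s.set 4 k f 0 = toNatSet (atFirm X f)) ∧
    ∀ e, e ∈ X ↔ e ∈ L ∧ e ∈ ρ.1.2
  listed : ∃ X : Finset (Fin n × Fin m), FirmRows s 14 X ∧ ∀ e, e ∈ X ↔ e ∈ X₀ ∨ e ∈ L ∧ e ∈ ρ.1.2
  others : ∀ i < k, s.set 3 i = s₀.set 3 i ∧ s.set 4 i = s₀.set 4 i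

theorem HoldsTables.congr {s s' : Memory} (h : HoldsTables hM s)
    (he : ∀ a ∈ [12, 13, 15, 16, 17], s'.set a = s.set a) : HoldsTables hM s' := by
  obtain ⟨h1, ⟨R, h2, h2'⟩, h3, h4, h5⟩ := h
  refine ⟨h1.congr (he _ (by simp)), ⟨R, h2.congr (he _ (by simp)), h2'⟩, h3.congr (he _ (by simp)),
    fun b ρ hb f => ?_, fun b ρ hb => ?_⟩
  · rw [he 16 (by simp), h4 b ρ hb f]
  · obtain ⟨A, h6, h7⟩ := h5 b ρ hb
    exact ⟨A, fun f => by rw [he 15 (by simp), h6 f], h7⟩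

theorem HoldsTables.mem_forced_iff {s : Memory} (h : HoldsTables hM s) (b : Fin n × Fin m) :
    (b.2 : ℕ) ∈ s.set 12 b.1 0 0 ∩ s.set 13 b.1 0 0 ↔ b ∈ passedPairs hM := by
  obtain ⟨R, hR, hRG⟩ := h.forced
  rw [h.stable, hR, toNatSet_inter, mem_toNatSet, Finset.mem_inter, mem_atFirm, mem_atFirm]
  exact ⟨fun h' => (hRG b h'.1).1 h'.2, fun h' => ⟨passedPairs_subset hM h',
    (hRG b (passedPairs_subset hM h')).2 h'⟩⟩

theorem HoldsTables.mem_avail_iff {s : Memory} (h : HoldsTables hM s) {b e : Fin n × Fin m}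
    {ρ : M.Rotation} (hb : b ∈ ρ.1.2) (he : e ∈ M.stablePairs) :
    (e.2 : ℕ) ∈ s.set 15 b.1 b.2 e.1 ↔ e ∉ passed (pairsOf hM) (rotationBase hM ρ) := by
  obtain ⟨A, hA, hAe⟩ := h.avail b ρ hb
  rw [hA, mem_toNatSet, mem_atFirm, ← hAe e he, not_not]

theorem run_comparePairProgram (hT : 1 ≤ T) {s₀ s : Memory} {k : ℕ} {ρ : M.Rotation}
    {b b' : Fin n × Fin m} {X₀ : Finset (Fin n × Fin m)} {L : List (Fin n × Fin m)}
    (ht : HoldsTables hM s) (hb : b ∈ ρ.1.2) (hk : s.num 1 0 0 0 = k)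
    (h10 : s.num 10 0 0 0 = b.1) (h11 : s.num 11 0 0 0 = b.2) (h13 : s.num 13 0 0 0 = b'.1)
    (h14 : s.num 14 0 0 0 = b'.2) (h : HoldsPartial hM s₀ k ρ b X₀ L s) :
    Run M T comparePairProgram s (3 * n + 8) (HoldsPartial hM s₀ k ρ b X₀ (L ++ [b'])) := by
  have hval : ∀ {k : ℕ} (x y : Fin k), (x : ℕ) = y ↔ x = y := fun x y => Fin.val_inj
  have hstable : ∀ {e} {ρ : M.Rotation}, e ∈ ρ.1.2 → e ∈ M.stablePairs := fun he =>
    passedPairs_subset hM (mem_passedPairs_of_mem_minus hM he)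
  obtain ⟨⟨X, hX, hXm⟩, ⟨Y, hY, hYm⟩, ⟨Z, hZ, hZm⟩, hoth⟩ := h
  -- nothing changes
  have hskip : (∀ ρ' : M.Rotation, b' ∈ ρ'.1.2 → b ∈ passed (pairsOf hM) (rotationBase hM ρ')) →
      b' ∉ ρ.1.2 → (assignVar 11 .empty : Program).wp M
        (HoldsPartial hM s₀ k ρ b X₀ (L ++ [b'])) s := by
    intro hp hm
    refine ⟨⟨X, hX, fun a => ?_⟩, ⟨Y, hY, fun e => ?_⟩, ⟨Z, hZ, fun e => ?_⟩, hoth⟩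
    · rw [hXm]
      refine and_congr_right fun _ => and_congr_right fun _ => ⟨fun h c hc ρ' hρ' hn => ?_,
        fun h c hc => h c (List.mem_append_left _ hc)⟩
      rcases List.mem_append.1 hc with hc | hc
      · exact h c hc ρ' hρ' hn
      · exact absurd (hp ρ' (List.mem_singleton.1 hc ▸ hρ')) hn
    · rw [hYm, List.mem_append, List.mem_singleton]
      exact ⟨fun h => ⟨Or.inl h.1, h.2⟩, fun ⟨h1, h2⟩ =>
        ⟨h1.resolve_right fun h => hm (h ▸ h2), h2⟩⟩
    · rw [hZm, List.mem_append, List.mem_singleton]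
      exact or_congr_right ⟨fun h => ⟨Or.inl h.1, h.2⟩, fun ⟨h1, h2⟩ =>
        ⟨h1.resolve_right fun h => hm (h ▸ h2), h2⟩⟩
  refine (Run.ite (c := 3 * n + 7) hT (fun hc => ?_) fun hc => ?_).mono le_rfl fun _ h => h
  · simp only [Cond.eval, NumExp.eval, SetExp.eval, h13, h14, ht.mem_forced_iff] at hc
    obtain ⟨ρ', hρ'⟩ := exists_rotation_of_mem_passedPairs hM hc
    have huniq : ∀ ρ'' : M.Rotation, b' ∈ ρ''.1.2 → ρ'' = ρ' := fun ρ'' h'' =>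
      rotation_eq_of_mem_minus hM h'' hρ'
    have hminus := mem_minus_iff hM hb hρ'
    refine (Run.ite (c := 3 * n + 6) hT (fun hc' => ?_) fun hc' => ?_).mono le_rfl fun _ h => h
    · simp only [Cond.eval, NumExp.eval, SetExp.eval, h10, h11, h13, h14,
        ht.mem_avail_iff hρ' (hstable hb)] at hc'
      have hm : b' ∉ ρ.1.2 := fun h' => hc' (hminus.1 h').2
      refine (Run.forUpTo (N := n) hT (c := 1) (s := s)
        (fun i s' => (∀ f : Fin n, s'.set 3 k f 0 = toNatSet (if (f : ℕ) < i then
            atFirm X f \ atFirm (pairsOf hM (rotationBase hM ρ')) f else atFirm X f)) ∧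
          ∀ i < k, s'.set 3 i = s₀.set 3 i)
        (by decide) (fun _ _ => rfl) (fun _ _ _ h => h) ?_ ?_).agree.mono (by omega) ?_
      · exact ⟨fun f => by rw [hX, if_neg (Nat.not_lt_zero _)], fun i hi => (hoth i hi).1⟩
      · intro i s' hi ha hv ⟨h3, h3'⟩
        have h13' : s'.num 13 0 0 0 = b'.1 := by rw [ha.num 13 (by decide), h13]
        have h14' : s'.num 14 0 0 0 = b'.2 := by rw [ha.num 14 (by decide), h14]
        have hk' : s'.num 1 0 0 0 = k := by rw [ha.num 1 (by decide), hk]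
        have h16 : ∀ f : Fin n, s'.set 16 b'.1 b'.2 f =
            toNatSet (atFirm (pairsOf hM (rotationBase hM ρ')) f) := fun f => by
          rw [ha.set 16 (by decide), ht.base b' ρ' hρ' f]
        refine (Run.of_wp hT ?_).mono (show _ ≤ 1 by decide) fun _ h => h
        simp only [Program.wp, NumExp.eval, SetExp.eval, Memory.setSet_set, hv, h13', h14', hk',
          true_and, and_true]
        refine ⟨fun f => ?_, fun j hj => ?_⟩
        · by_cases hfi : (f : ℕ) = i
          · rw [if_pos hfi, if_pos (by omega), ← hfi, h3, if_neg (by omega), h16, toNatSet_sdiff]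
          · rw [if_neg hfi, h3]
            congr 1
            exact if_congr (by omega) rfl rfl
        · rw [← h3' j hj]
          funext f c
          rw [Memory.setSet_set, if_neg (by omega)]
      · rintro s' ⟨⟨h3, h3'⟩, ha⟩
        have e4 : s'.set 4 = s.set 4 := ha.set 4 (by decide)
        refine ⟨⟨X \ pairsOf hM (rotationBase hM ρ'), fun f => ?_, fun a => ?_⟩,
          ⟨Y, fun f => by rw [e4, hY], fun e => ?_⟩, ⟨Z, hZ.congr (ha.set 14 (by decide)),
          fun e => ?_⟩, fun i hi => ⟨h3' i hi, by rw [e4, (hoth i hi).2]⟩⟩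
        · rw [h3, if_pos f.2, toNatSet_inj]
          ext z
          simp [mem_atFirm]
        · rw [Finset.mem_sdiff, hXm]
          constructor
          · rintro ⟨⟨h1, h2, h3⟩, h4⟩
            refine ⟨h1, h2, fun c hc ρ'' hρ'' hn => ?_⟩
            rcases List.mem_append.1 hc with hc | hc
            · exact h3 c hc ρ'' hρ'' hn
            · rw [List.mem_singleton.1 hc] at hρ''
              rwa [huniq ρ'' hρ'']
          · rintro ⟨h1, h2, h3⟩
            exact ⟨⟨h1, h2, fun c hc => h3 c (List.mem_append_left _ hc)⟩,
              h3 b' (by simp) ρ' hρ' hc'⟩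
        · rw [hYm, List.mem_append, List.mem_singleton]
          exact ⟨fun h => ⟨Or.inl h.1, h.2⟩, fun ⟨h1, h2⟩ =>
            ⟨h1.resolve_right fun h => hm (h ▸ h2), h2⟩⟩
        · rw [hZm, List.mem_append, List.mem_singleton]
          exact or_congr_right ⟨fun h => ⟨Or.inl h.1, h.2⟩, fun ⟨h1, h2⟩ =>
            ⟨h1.resolve_right fun h => hm (h ▸ h2), h2⟩⟩
    · simp only [Cond.eval, NumExp.eval, SetExp.eval, h10, h11, h13, h14,
        ht.mem_avail_iff hρ' (hstable hb), not_not] at hc'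
      have hp : ∀ ρ'' : M.Rotation, b' ∈ ρ''.1.2 →
          b ∈ passed (pairsOf hM) (rotationBase hM ρ'') := fun ρ'' h'' => by
        rwa [huniq ρ'' h'']
      refine (Run.of_wp hT (P := .ite _ _ _) ⟨fun hc2 => hskip hp ?_, fun hc2 => ?_⟩).mono
        (show 4 ≤ _ by omega) fun _ h => h
      · simp only [Cond.eval, NumExp.eval, SetExp.eval, h10, h11, h13, h14,
          ht.mem_avail_iff hb (hstable hρ')] at hc2
        exact fun h' => hc2 (hminus.1 h').1
      · simp only [Cond.eval, NumExp.eval, SetExp.eval, h10, h11, h13, h14,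
          ht.mem_avail_iff hb (hstable hρ'), not_not] at hc2
        have hm : b' ∈ ρ.1.2 := hminus.2 ⟨hc2, hc'⟩
        have hins : ∀ (V : Finset (Fin n × Fin m)) (f : Fin n),
            (if (f : ℕ) = b'.1 then toNatSet (atFirm V b'.1) ∪ {(b'.2 : ℕ)} else
              toNatSet (atFirm V f)) = toNatSet (atFirm (insert b' V) f) := by
          intro V f
          simp only [hval]
          split_ifs with hf
          · rw [← toNatSet_singleton, toNatSet_union, toNatSet_inj]
            ext z
            simp [mem_atFirm, hf, Prod.ext_iff]
          · rw [toNatSet_inj]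
            ext z
            simp [mem_atFirm, hf, Prod.ext_iff]
        simp only [Program.wp, NumExp.eval, SetExp.eval, Memory.setSet_num, Memory.setSet_set,
          h13, h14, hk, Nat.reduceEqDiff, false_and, if_false, lt_max_worker, if_true]
        refine ⟨⟨X, hX, fun a => ?_⟩, ⟨insert b' Y, fun f => ?_, fun e => ?_⟩,
          ⟨insert b' Z, fun f => ?_, fun e => ?_⟩, fun i hi => ⟨(hoth i hi).1, ?_⟩⟩
        · rw [hXm]
          refine and_congr_right fun _ => and_congr_right fun _ => ⟨fun h c hc ρ'' hρ'' hn => ?_,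
            fun h c hc => h c (List.mem_append_left _ hc)⟩
          rcases List.mem_append.1 hc with hc | hc
          · exact h c hc ρ'' hρ'' hn
          · exact absurd (hp ρ'' (List.mem_singleton.1 hc ▸ hρ'')) hn
        · simp only [Memory.setSet_set, Nat.reduceEqDiff, false_and, if_false, true_and, and_true,
            hY]
          exact hins Y f
        · rw [Finset.mem_insert, hYm, List.mem_append, List.mem_singleton]
          constructor
          · rintro (rfl | h1)
            · exact ⟨Or.inr rfl, hm⟩
            · exact ⟨Or.inl h1.1, h1.2⟩
          · rintro ⟨h1 | h1, h2⟩
            · exact Or.inr ⟨h1, h2⟩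
            · exact Or.inl h1
        · simp only [Memory.setSet_set, true_and, and_true, hZ _]
          exact hins Z f
        · rw [Finset.mem_insert, hZm, List.mem_append, List.mem_singleton]
          constructor
          · rintro (rfl | h1 | h1)
            · exact Or.inr ⟨Or.inr rfl, hm⟩
            · exact Or.inl h1
            · exact Or.inr ⟨Or.inl h1.1, h1.2⟩
          · rintro (h1 | ⟨h1 | h1, h2⟩)
            · exact Or.inr (Or.inl h1)
            · exact Or.inr (Or.inr ⟨h1, h2⟩)
            · exact Or.inl h1
        · rw [← (hoth i hi).2]
          funext f c
          simp only [Memory.setSet_set]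
          rw [if_neg (by omega), if_neg (by omega)]
  · simp only [Cond.eval, NumExp.eval, SetExp.eval, h13, h14, ht.mem_forced_iff] at hc
    have hn : ∀ ρ' : M.Rotation, b' ∉ ρ'.1.2 := fun ρ' h' =>
      hc (mem_passedPairs_of_mem_minus hM h')
    exact (Run.of_wp hT (hskip (fun ρ' h' => absurd h' (hn ρ')) (hn ρ))).mono
      (show 1 ≤ _ by omega) fun _ h => h

end OracleMachine

namespace OracleMachine

open Market PathIndependent IsSetLattice Program

variable {n m : ℕ} {M : Market (Fin n) (Fin m)} {T : ℕ} {hM : M.IsCM}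

theorem HoldsRotation.congr {s s' : Memory} {i : ℕ} {ρ : M.Rotation} (h : HoldsRotation s i ρ)
    (h3 : s'.set 3 i = s.set 3 i) (h4 : s'.set 4 i = s.set 4 i)
    (h20 : s'.num 20 i 0 0 = s.num 20 i 0 0) (h21 : s'.num 21 i 0 0 = s.num 21 i 0 0) :
    HoldsRotation s' i ρ := by
  obtain ⟨hp, hm, b, hb, hb1, hb2⟩ := h
  exact ⟨fun f => by rw [h3, hp], fun f => by rw [h4, hm], b, hb, by rw [h20, hb1], by rw [h21, hb2]⟩

theorem HoldsRotations.congr {Λ : List M.Rotation} {s s' : Memory} (h : HoldsRotations Λ s)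
    (hn : ∀ a ∈ [1, 20, 21], s'.num a = s.num a) (hs : ∀ a ∈ [3, 4, 14], s'.set a = s.set a) :
    HoldsRotations Λ s' := by
  obtain ⟨hc, hr, X, hX, hXm⟩ := h
  refine ⟨by rw [hn 1 (by simp), hc], fun i hi => (hr i hi).congr ?_ ?_ ?_ ?_, X,
    hX.congr (hs _ (by simp)), hXm⟩
  · rw [hs 3 (by simp)]
  · rw [hs 4 (by simp)]
  · rw [hn 20 (by simp)]
  · rw [hn 21 (by simp)]

/-- Every rotation has a leaving pair, so running through all pairs has compared `ρ` with every
rotation. -/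
theorem HoldsPartial.plus_eq {s₀ s : Memory} {k : ℕ} {ρ : M.Rotation} {b : Fin n × Fin m}
    {X₀ : Finset (Fin n × Fin m)} (h : HoldsPartial hM s₀ k ρ b X₀ (allPairs n m) s)
    (hb : b ∈ ρ.1.2) (f : Fin n) : s.set 3 k f 0 = toNatSet (atFirm ρ.1.1 f) := by
  obtain ⟨X, hX, hXm⟩ := h.plus
  rw [hX]
  congr 2
  ext a
  rw [hXm, mem_plus_iff hM hb]
  refine and_congr_right fun _ => and_congr_right fun _ => ⟨fun h ρ' hn => ?_,
    fun h _ _ ρ' _ hn => h ρ' hn⟩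
  obtain ⟨b', hb'⟩ := (rotationBase_spec hM ρ').minus_nonempty
  exact h b' (mem_allPairs b') ρ' hb' hn

theorem HoldsPartial.minus_eq {s₀ s : Memory} {k : ℕ} {ρ : M.Rotation} {b : Fin n × Fin m}
    {X₀ : Finset (Fin n × Fin m)} (h : HoldsPartial hM s₀ k ρ b X₀ (allPairs n m) s)
    (f : Fin n) : s.set 4 k f 0 = toNatSet (atFirm ρ.1.2 f) := by
  obtain ⟨X, hX, hXm⟩ := h.minus
  rw [hX]
  congr 2
  ext e
  rw [hXm]
  exact and_iff_right (mem_allPairs e)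

theorem run_listRotationProgram (hT : 1 ≤ T) {s : Memory} {b : Fin n × Fin m}
    {L : List (Fin n × Fin m)} (ht : HoldsTables hM s)
    (h10 : s.num 10 0 0 0 = b.1) (h11 : s.num 11 0 0 0 = b.2)
    (h : HoldsRotations (listRotations hM L) s) :
    Run M T listRotationProgram s (n * (m * (3 * n + 10) + 4) + 4 * n + 8)
      (HoldsRotations (listRotations hM (L ++ [b]))) := by
  obtain ⟨hc, hr, X₀, hX₀, hXm₀⟩ := h
  set Λ := listRotations hM L with hΛ
  have hcond : (Cond.and (.mem (.var 11) (.inter (.row 12 (.var 10)) (.row 13 (.var 10))))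
      (.not (.mem (.var 11) (.row 14 (.var 10))))).eval n m s ↔
      b ∈ passedPairs hM ∧ ∀ ρ ∈ Λ, b ∉ ρ.1.2 := by
    simp only [Cond.eval, NumExp.eval, SetExp.eval, h10, h11, ht.mem_forced_iff]
    rw [hX₀ b.1, mem_toNatSet, mem_atFirm, hXm₀]
    push Not
    rfl
  refine (Run.ite (c := n * (m * (3 * n + 10) + 4) + 4 * n + 7) hT (fun hb => ?_)
    fun hb => ?_).mono le_rfl fun _ h => h
  · obtain ⟨hbG, hbΛ⟩ := hcond.1 hb
    rw [listRotations_append_pos hM hbG hbΛ, ← hΛ]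
    set ρ := rotationOf hM b hbG
    have hbρ : b ∈ ρ.1.2 := mem_rotationOf hM b hbG
    refine ((Run.forUpTo (N := n) hT (c := 2) (s := s)
      (fun i s' => (∀ f : Fin n, (f : ℕ) < i → s'.set 3 Λ.length f 0 =
          toNatSet (atFirm (pairsOf hM (rotationBase hM ρ) \ pairsOf hM ⊤) f) ∧
          s'.set 4 Λ.length f 0 = ∅) ∧
        ∀ j < Λ.length, s'.set 3 j = s.set 3 j ∧ s'.set 4 j = s.set 4 j)
      (by decide) (fun _ _ => rfl) (fun _ _ _ h => h) ?_ ?_).seq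
        (c := n * (m * (3 * n + 10) + 4) + 5) fun s₁ h1 a1 => ?_).mono (by omega) fun _ h => h
    · exact ⟨fun f hf => absurd hf (Nat.not_lt_zero _), fun _ _ => ⟨rfl, rfl⟩⟩
    · intro i s' hi ha hv ⟨h3, h3'⟩
      have h10' : s'.num 10 0 0 0 = b.1 := by rw [ha.num 10 (by decide), h10]
      have h11' : s'.num 11 0 0 0 = b.2 := by rw [ha.num 11 (by decide), h11]
      have hc' : s'.num 1 0 0 0 = Λ.length := by rw [ha.num 1 (by decide), hc]
      have h16 : ∀ f : Fin n, s'.set 16 b.1 b.2 f =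
          toNatSet (atFirm (pairsOf hM (rotationBase hM ρ)) f) := fun f => by
        rw [ha.set 16 (by decide), ht.base b ρ hbρ f]
      have h17 := ht.top.congr (ha.set 17 (by decide))
      refine (Run.of_wp hT ?_).mono (show _ ≤ 2 by decide) fun _ h => h
      simp only [Program.wp, NumExp.eval, SetExp.eval, Memory.setSet_set, Memory.setSet_num, hv,
        h10', h11', hc', Nat.reduceEqDiff, false_and, if_false, true_and, and_true]
      refine ⟨fun f hf => ?_, fun j hj => ?_⟩
      · by_cases hfi : (f : ℕ) = i
        · rw [if_pos hfi, if_pos hfi, ← hfi, h16, h17, toNatSet_sdiff, toNatSet_inj]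
          refine ⟨?_, rfl⟩
          ext z
          simp [mem_atFirm]
        · rw [if_neg hfi, if_neg hfi]
          exact h3 f (by omega)
      · rw [← (h3' j hj).1, ← (h3' j hj).2]
        constructor <;> funext f c <;> rw [Memory.setSet_set]
        · rw [if_neg (by omega), Memory.setSet_set, if_neg (by omega)]
        · rw [if_neg (by omega), Memory.setSet_set, if_neg (by omega)]
    obtain ⟨h1a, h1b⟩ := h1
    have ht1 : HoldsTables hM s₁ := ht.congr fun a ha => a1.set a (by
      revert a
      decide)
    have hP : HoldsPartial hM s Λ.length ρ b X₀ [] s₁ := by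
      refine ⟨⟨pairsOf hM (rotationBase hM ρ) \ pairsOf hM ⊤, fun f => (h1a f f.2).1, fun a => by
        simp⟩, ⟨∅, fun f => ?_, by simp⟩, ⟨X₀, hX₀.congr (a1.set 14 (by decide)), by simp⟩, h1b⟩
      rw [(h1a f f.2).2, atFirm_empty, toNatSet_empty]
    refine ((Run.forPairs (c := 3 * n + 8) hT (HoldsPartial hM s Λ.length ρ b X₀)
      (by decide) (by decide) (by decide)
      (fun _ _ _ _ ⟨p1, p2, p3, p4⟩ _ => ⟨p1, p2, p3, p4⟩) hP ?_).seq (c := 3)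
        fun s₂ h2 a2 => ?_).mono le_rfl fun _ h => h
    · intro L e s' ha hx hy h'
      have ht' : HoldsTables hM s' := ht1.congr fun a h => ha.set a (by
        revert a
        decide)
      refine run_comparePairProgram hT ht' hbρ ?_ ?_ ?_ hx hy h'
      · rw [ha.num 1 (by decide), a1.num 1 (by decide), hc]
      · rw [ha.num 10 (by decide), a1.num 10 (by decide), h10]
      · rw [ha.num 11 (by decide), a1.num 11 (by decide), h11]
    · have hnum : ∀ a, a ∉ [12, 13, 14] → s₂.num a = s.num a := fun a ha => by
        have e1 := a1.num a
        have e2 := a2.num a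
        simp only [Program.forPairs, Program.forUpTo, Program.nums, comparePairProgram,
          List.mem_append, List.mem_cons, List.not_mem_nil] at e1 e2 ha
        rw [e2 (by tauto), e1 (by tauto)]
      have k10 : s₂.num 10 0 0 0 = b.1 := by rw [hnum 10 (by decide), h10]
      have k11 : s₂.num 11 0 0 0 = b.2 := by rw [hnum 11 (by decide), h11]
      have k1 : s₂.num 1 0 0 0 = Λ.length := by rw [hnum 1 (by decide), hc]
      refine (Run.of_wp hT ?_).mono (show _ ≤ 3 by decide) fun _ h => h
      simp only [Program.wp, NumExp.eval, Memory.setNum_num, Nat.reduceEqDiff, false_and, if_false,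
        k10, k11, k1]
      refine ⟨by simp [Memory.setNum_num], fun i hi => ?_, ?_⟩
      · by_cases hil : i < Λ.length
        · rw [List.getElem_append_left hil]
          refine (hr i hil).congr (h2.others i hil).1 (h2.others i hil).2 ?_ ?_
          · simp only [Memory.setNum_num, Nat.reduceEqDiff, false_and, if_false, hil.ne, and_false]
            rw [hnum 20 (by decide)]
          · simp only [Memory.setNum_num, Nat.reduceEqDiff, false_and, if_false, hil.ne, and_false]
            rw [hnum 21 (by decide)]
        · obtain rfl : i = Λ.length := by simp at hi; omega
          rw [List.getElem_append_right le_rfl]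
          simp only [Nat.sub_self, List.getElem_singleton]
          exact ⟨h2.plus_eq hbρ, h2.minus_eq, b, hbρ, by simp [Memory.setNum_num],
            by simp [Memory.setNum_num]⟩
      · obtain ⟨X, hX, hXm⟩ := h2.listed
        refine ⟨X, hX, fun e => ?_⟩
        rw [hXm, hXm₀]
        simp only [mem_allPairs, true_and, List.mem_append, List.mem_singleton, or_and_right,
          exists_or, exists_eq_left]
  · rw [hcond] at hb
    rw [listRotations_append_neg hM hb]
    refine (Run.of_wp hT (P := assignVar 11 .empty) ?_).mono (show 1 ≤ _ by omega) fun _ h => h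
    refine HoldsRotations.congr (s := s) ⟨hc, hr, X₀, hX₀, hXm₀⟩ (fun _ _ => rfl) fun a ha =>
      Memory.setSet_set_of_ne _ ?_ _ _ _ _
    rintro rfl
    simp at ha

/-- For each of the `nm` pairs there are at most `nm` comparisons of `O(n)` steps, and `(nm)² n ≤
(nm)³`. This is the source of the cubic bound. -/
theorem run_rotationsProgram (hT : 1 ≤ T) (hn : 1 ≤ n) (hm : 1 ≤ m) {s : Memory}
    (ht : HoldsTables hM s) :
    Run M T rotationsProgram s (50 * (n * m) ^ 3)
      fun s' => HoldsTables hM s' ∧ HoldsRotations (listRotations hM (allPairs n m)) s' := by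
  have hnN : n ≤ n * m := Nat.le_mul_of_pos_right n hm
  have hN1 : 1 ≤ n * m := hn.trans hnN
  have hN2 : n * m ≤ (n * m) ^ 2 := Nat.le_self_pow (by decide) _
  have hN3 : n * m ≤ (n * m) ^ 3 := Nat.le_self_pow (by decide) _
  have hbound : (n * (m * (3 * n + 10) + 4) + 4 * n + 8) + 8 ≤ 37 * (n * m) ^ 2 := by
    have hN0 : 1 ≤ (n * m) ^ 2 := hN1.trans hN2
    have : n * m * n ≤ (n * m) ^ 2 := by rw [sq]; exact Nat.mul_le_mul_left _ hnN
    have e : n * (m * (3 * n + 10) + 4) = 3 * (n * m * n) + 10 * (n * m) + 4 * n := by ring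
    rw [e]
    omega
  refine ((Run.of_wp hT (P := assignNumVar 1 (.const 0))
    (Q := fun s' => HoldsTables hM s' ∧ s'.num 1 0 0 0 = 0)
    ⟨ht.congr fun _ _ => rfl, by simp [NumExp.eval, Memory.setNum_num]⟩).seq
      (c := 49 * (n * m) ^ 3) fun s₁ h1 a1 => ?_).mono ?_ fun _ h => h
  · refine ((Run.forUpTo (N := n) hT (c := 1) (s := s₁)
      (fun i s' => ∀ f : Fin n, (f : ℕ) < i → s'.set 14 f 0 0 = ∅)
      (by decide) (fun _ _ => rfl) (fun _ _ _ h => h) ?_ ?_).seq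
        (c := 37 * (n * m) ^ 3) fun s₂ h2 a2 => ?_).mono (by omega) fun _ h => h
    · exact fun f hf => absurd hf (Nat.not_lt_zero _)
    · intro i s' hi ha hv h'
      refine (Run.of_wp hT ?_).mono (show _ ≤ 1 by decide) fun _ h => h
      simp only [Program.wp, NumExp.eval, SetExp.eval, Memory.setSet_set, hv, true_and, and_true]
      intro f hf
      split_ifs with hfi
      · rfl
      · exact h' f (by omega)
    · have ht2 : HoldsTables hM s₂ := h1.1.congr fun a h => a2.set a (by revert a; decide)
      refine ((Run.forPairs (c := n * (m * (3 * n + 10) + 4) + 4 * n + 8) hT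
        (fun L => HoldsRotations (listRotations hM L))
        (by decide) (by decide) (by decide) ?_ ?_ ?_).agree.mono ?_ ?_)
      · rintro L s i v h' hi
        refine h'.congr (fun a ha => Memory.setNum_num_of_ne _ ?_ _ _ _ _) fun _ _ => rfl
        rintro rfl
        rcases hi with rfl | rfl <;> simp at ha
      · refine ⟨by rw [a2.num 1 (by decide), h1.2]; rfl, fun i hi => absurd hi (Nat.not_lt_zero _),
          ∅, fun f => ?_, fun e => by simp [listRotations]⟩
        rw [h2 f f.2, atFirm_empty, toNatSet_empty]
      · intro L e s' ha hx hy h'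
        exact run_listRotationProgram hT (ht2.congr fun a h => ha.set a (by revert a; decide)) hx hy h'
      · refine (pairs_bound_le hn hm).trans ((Nat.mul_le_mul_left _ hbound).trans (le_of_eq ?_))
        ring
      · rintro s₃ ⟨h3, a3⟩
        exact ⟨ht2.congr fun a h => a3.set a (by revert a; decide), h3⟩
  · simp only [Program.steps]
    omega

/-- Compute the rotations. -/
def coreProgram : Program := .seq outcomesProgram rotationsProgram

theorem run_coreProgram (hM : M.IsCM) (hT : 1 ≤ T) (hn : 1 ≤ n) (hm : 1 ≤ m) {s : Memory}
    (h0 : FirmRows s 0 M.acc) :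
    Run M T coreProgram s (350 * (n * m) ^ 3)
      fun s' => HoldsTables hM s' ∧ HoldsRotations (listRotations hM (allPairs n m)) s' := by
  refine ((run_outcomesProgram hT hn hm h0).seq fun s' h _ => run_rotationsProgram hT hn hm h).mono
    ?_ fun _ h => h
  have : (n * m) ^ 2 ≤ (n * m) ^ 3 := Nat.pow_le_pow_right (Nat.mul_pos hn hm) (by decide)
  omega

end OracleMachine

/-! ## The programs -/

namespace Market

open PathIndependent IsSetLattice

variable {F W : Type*} [DecidableEq F] [DecidableEq W] [Fintype F] [Fintype W] {M : Market F W}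
  (hM : M.IsCM)

-- The rotation has been performed at `μ` iff `μ` has passed `b`, so one query of a firm decides it.
include hM in
theorem mem_rotationSet_iff_mem_choiceF {ρ : M.Rotation} {b : F × W} (hb : b ∈ ρ.1.2)
    (μ : M.StableMatching) :
    ρ ∈ M.rotationSet μ ↔ b ∉ μ.1 ∧ b.2 ∈ M.choiceF b.1 (insert b.2 (atFirm μ.1 b.1)) := by
  obtain ⟨ν, hν⟩ := (mem_stablePairs hM).1
    (passedPairs_subset hM (mem_passedPairs_of_mem_minus hM hb))
  rw [mem_rotationSet_iff hM, ← mem_passed_iff hM hb]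
  change b ∈ above (pairsOf hM) (toLattice hM μ) ∧ b ∉ μ.1 ↔ _
  rw [← pSet_eq hM, and_comm]
  exact and_congr_right fun _ => and_iff_right ⟨ν, hν⟩

/-- A pair of `above` is missing from `μ` iff it has been passed, that is, leaves in a performed
rotation. A pair that has left never returns, so the order in which the rotations are performed is
irrelevant. -/
theorem mem_stableMatching_iff (μ : M.StableMatching) (e : F × W) :
    e ∈ μ.1 ↔ (e ∈ pairsOf hM ⊤ ∨ ∃ ρ ∈ M.rotationSet μ, e ∈ ρ.1.1) ∧
      ∀ ρ ∈ M.rotationSet μ, e ∉ ρ.1.2 := by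
  simp only [mem_rotationSet_iff hM]
  constructor
  · intro he
    have hab : e ∈ above (pairsOf hM) (toLattice hM μ) := subset_above (m := pairsOf hM) _ he
    refine ⟨or_iff_not_imp_left.2 fun ht => ?_, fun ρ hρ hm =>
      ((mem_passed_iff hM hm _).2 hρ).2 he⟩
    obtain ⟨r, hr, her⟩ := (isSetLattice hM).exists_isRotation_plus hab ht
    exact ⟨⟨r, (isRotation_iff hM r).2 hr⟩,
      (((rotationBase_spec hM _).plus_iff e).1 her _).1 hab, her⟩
  · rintro ⟨h1, h2⟩
    by_contra he
    have hab : e ∈ above (pairsOf hM) (toLattice hM μ) := by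
      rcases h1 with h | ⟨ρ, hρ, hp⟩
      · exact ⟨⊤, le_top, h⟩
      · exact (((rotationBase_spec hM ρ).plus_iff e).1 hp _).2 hρ
    obtain ⟨r, hr, her⟩ := (isSetLattice hM).exists_isRotation_minus (μ := toLattice hM μ) ⟨hab, he⟩
    exact h2 ⟨r, (isRotation_iff hM r).2 hr⟩ ((mem_passed_iff hM her _).1 ⟨hab, he⟩) her

end Market

/-! ### Programs for the order, the matrix and the representation function -/

namespace OracleMachine

open Market PathIndependent IsSetLattice Program AffineRep

variable {n m : ℕ} {M : Market (Fin n) (Fin m)} {T : ℕ} {hM : M.IsCM}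

/-- Compute the order of the rotations. -/
def orderProgram : Program :=
  .forUpTo 22 (.var 1) <| .forUpTo 23 (.var 1) <|
    -- The first rotation is above the second iff its representative has been passed at the base of
    -- the second, that is, is unavailable there.
    .ite (.mem (.cell 21 (.var 22) (.const 0) (.const 0))
        (.cell 15 (.cell 20 (.var 23) (.const 0) (.const 0)) (.cell 21 (.var 23) (.const 0) (.const 0))
          (.cell 20 (.var 22) (.const 0) (.const 0))))
      (.assignNum 2 (.var 22) (.var 23) (.const 0) (.const 0))
      (.assignNum 2 (.var 22) (.var 23) (.const 0) (.const 1))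

/-- Compute the matrix of the rotations. -/
def matrixProgram : Program :=
  .forPairs 10 11 <| .forUpTo 22 (.var 1) <|
    .ite (.mem (.var 11) (.cell 3 (.var 22) (.var 10) (.const 0)))
      (.assignNum 3 (.var 10) (.var 11) (.var 22) (.const 1)) <|
    .ite (.mem (.var 11) (.cell 4 (.var 22) (.var 10) (.const 0)))
      (.assignNum 3 (.var 10) (.var 11) (.var 22) (.const 2))
      (.assignNum 3 (.var 10) (.var 11) (.var 22) (.const 0))

/-- Compute the characteristic vector of the firm-optimal stable matching. -/
def offsetProgram : Program :=
  .forPairs 10 11 <|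
    .ite (.mem (.var 11) (.row 17 (.var 10)))
      (.assignNum 4 (.var 10) (.var 11) (.const 0) (.const 1))
      (.assignNum 4 (.var 10) (.var 11) (.const 0) (.const 0))

/-- Compute the rotation poset and the affine function. -/
def buildProgram : Program :=
  .seq coreProgram <| .seq orderProgram <| .seq matrixProgram offsetProgram

/-- Compute the representation function. -/
def psiProgram : Program :=
  .seq coreProgram <| .forUpTo 22 (.var 1) <|
    .ite (.mem (.cell 21 (.var 22) (.const 0) (.const 0))
        (.row 2 (.cell 20 (.var 22) (.const 0) (.const 0))))
      (.assignNum 5 (.var 22) (.const 0) (.const 0) (.const 0)) <|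
    .seq (.queryF 10 (.const 0) (.const 0) (.const 0) (.cell 20 (.var 22) (.const 0) (.const 0))
      (.union (.row 2 (.cell 20 (.var 22) (.const 0) (.const 0)))
        (.singleton (.cell 21 (.var 22) (.const 0) (.const 0))))) <|
    .ite (.mem (.cell 21 (.var 22) (.const 0) (.const 0)) (.var 10))
      (.assignNum 5 (.var 22) (.const 0) (.const 0) (.const 1))
      (.assignNum 5 (.var 22) (.const 0) (.const 0) (.const 0))

/-- Compute the inverse of the representation function. -/
def psiInvProgram : Program :=
  .seq coreProgram <| .forUpTo 12 .nF <|
    -- Set `18` collects the partners that the firm has at the top or gains, set `19` those that it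
    -- loses.
    .seq (assignVar 18 (.row 17 (.var 12))) <|
    .seq (assignVar 19 .empty) <|
    .seq (.forUpTo 22 (.var 1) <|
      .ite (.eq (.cell 0 (.var 22) (.const 0) (.const 0)) (.const 1))
        (.seq (assignVar 18 (.union (.var 18) (.cell 3 (.var 22) (.var 12) (.const 0))))
          (assignVar 19 (.union (.var 19) (.cell 4 (.var 22) (.var 12) (.const 0)))))
        (assignVar 11 .empty)) <|
    assignRow 5 (.var 12) (.sdiff (.var 18) (.var 19))

open Classical in
theorem run_orderProgram (hT : 1 ≤ T) {s : Memory} {Λ : List M.Rotation} (ht : HoldsTables hM s)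
    (h : HoldsRotations Λ s) :
    Run M T orderProgram s (Λ.length * (Λ.length * 5 + 4) + 2) fun s' =>
      ∀ (i j : ℕ) (hi : i < Λ.length) (hj : j < Λ.length),
        s'.num 2 i j 0 = if M.RotationGE Λ[i] Λ[j] then 1 else 0 := by
  refine (Run.forUpTo (N := Λ.length) hT (c := Λ.length * 5 + 2) (s := s)
    (fun x s' => ∀ (i j : ℕ) (hi : i < Λ.length) (hj : j < Λ.length), i < x →
      s'.num 2 i j 0 = if M.RotationGE Λ[i] Λ[j] then 1 else 0)
    (by decide) (fun s' ha => ?_) ?_ ?_ ?_).mono (by ring_nf; omega) fun s' h i j hi hj =>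
      h i j hi hj hi
  · simp only [NumExp.eval]
    rw [ha.num 1 (by decide), h.count]
  · intro x s' v h' i j hi hj hx
    rw [Memory.setNum_num, if_neg (by omega), h' i j hi hj hx]
  · exact fun i j hi hj hx => absurd hx (Nat.not_lt_zero _)
  · intro x s₁ hx a1 hv1 h1
    refine (Run.forUpTo (N := Λ.length) hT (c := 3) (s := s₁)
      (fun y s' => ∀ (i j : ℕ) (hi : i < Λ.length) (hj : j < Λ.length), (i < x ∨ i = x ∧ j < y) →
        s'.num 2 i j 0 = if M.RotationGE Λ[i] Λ[j] then 1 else 0)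
      (by decide) (fun s' ha => ?_) ?_ ?_ ?_).mono le_rfl fun s' h i j hi hj hx' =>
        h i j hi hj (by omega)
    · simp only [NumExp.eval]
      rw [ha.num 1 (by decide), a1.num 1 (by decide), h.count]
    · intro y s' v h' i j hi hj hx
      rw [Memory.setNum_num, if_neg (by omega), h' i j hi hj hx]
    · exact fun i j hi hj hx => h1 i j hi hj (by omega)
    · intro y s₂ hy a2 hv2 h2
      have ht2 : HoldsTables hM s₂ := ht.congr fun a h => by
        rw [a2.set a (by revert a; decide), a1.set a (by revert a; decide)]
      have hv1' : s₂.num 22 0 0 0 = x := by rw [a2.num 22 (by decide), hv1]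
      have hrot : ∀ i (hi : i < Λ.length), HoldsRotation s₂ i Λ[i] := fun i hi =>
        (h.rotation i hi).congr (by rw [a2.set 3 (by decide), a1.set 3 (by decide)])
          (by rw [a2.set 4 (by decide), a1.set 4 (by decide)])
          (by rw [a2.num 20 (by decide), a1.num 20 (by decide)])
          (by rw [a2.num 21 (by decide), a1.num 21 (by decide)])
      obtain ⟨b, hb, hb1, hb2⟩ := (hrot x hx).rep
      obtain ⟨b', hb', hb1', hb2'⟩ := (hrot y hy).rep
      have hge : M.RotationGE Λ[x] Λ[y] ↔ ¬ (b.2 : ℕ) ∈ s₂.set 15 b'.1 b'.2 b.1 := by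
        rw [ht2.mem_avail_iff hb' (passedPairs_subset hM (mem_passedPairs_of_mem_minus hM hb)),
          not_not, mem_passed_iff hM hb, rotationGE_iff hM]
      refine (Run.of_wp hT (P := .ite _ _ _) ⟨fun hc => ?_, fun hc => ?_⟩).mono
        (show _ ≤ 3 by decide) fun _ h => h
      all_goals
        simp only [Cond.eval, NumExp.eval, SetExp.eval, hv1', hv2, hb1, hb2, hb1', hb2'] at hc
        simp only [Program.wp, NumExp.eval, hv1', hv2]
        intro i j hi hj hij
        by_cases he : i = x ∧ j = y
        · obtain ⟨rfl, rfl⟩ := he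
          simp [Memory.setNum_num, hge, hc]
        · rw [Memory.setNum_num, if_neg (by omega), h2 i j hi hj (by omega)]

theorem run_matrixProgram (hT : 1 ≤ T) {s : Memory} {Λ : List M.Rotation}
    (h : HoldsRotations Λ s) :
    Run M T matrixProgram s (n * (m * (Λ.length * 7 + 4) + 4) + 2) fun s' =>
      ∀ (e : Fin n × Fin m) (i : ℕ) (hi : i < Λ.length),
        s'.num 3 e.1 e.2 i = if e ∈ Λ[i].1.1 then 1 else if e ∈ Λ[i].1.2 then 2 else 0 := by
  refine (Run.forPairs hT (c := Λ.length * 7 + 2) (s := s)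
    (fun L s' => ∀ e ∈ L, ∀ (i : ℕ) (hi : i < Λ.length),
      s'.num 3 e.1 e.2 i = if e ∈ Λ[i].1.1 then 1 else if e ∈ Λ[i].1.2 then 2 else 0)
    (by decide) (by decide) (by decide) ?_ (by simp) ?_).mono le_rfl
      fun s' h e => h e (mem_allPairs e)
  · intro L s' i v h' hi e he j hj
    rw [Memory.setNum_num, if_neg (by omega), h' e he j hj]
  · intro L e s₁ a1 hx hy h1
    refine (Run.forUpTo (N := Λ.length) hT (c := 5) (s := s₁)
      (fun x s' => ∀ e' ∈ L ++ [e], ∀ (i : ℕ) (hi : i < Λ.length), (e' ∈ L ∨ i < x) →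
        s'.num 3 e'.1 e'.2 i = if e' ∈ Λ[i].1.1 then 1 else if e' ∈ Λ[i].1.2 then 2 else 0)
      (by decide) (fun s' ha => ?_) ?_ ?_ ?_).mono le_rfl fun s' h e' he' i hi =>
        h e' he' i hi (Or.inr hi)
    · simp only [NumExp.eval]
      rw [ha.num 1 (by decide), a1.num 1 (by decide), h.count]
    · intro x s' v h' e' he' i hi hx
      rw [Memory.setNum_num, if_neg (by omega), h' e' he' i hi hx]
    · exact fun e' he' i hi hx => h1 e' (hx.resolve_right (Nat.not_lt_zero _)) i hi
    · intro x s₂ hx' a2 hv h2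
      have hv1 : s₂.num 10 0 0 0 = e.1 := by rw [a2.num 10 (by decide), hx]
      have hv2 : s₂.num 11 0 0 0 = e.2 := by rw [a2.num 11 (by decide), hy]
      have hp : (e.2 : ℕ) ∈ s₂.set 3 x e.1 0 ↔ e ∈ Λ[x].1.1 := by
        rw [a2.set 3 (by decide), a1.set 3 (by decide), (h.rotation x hx').plus, mem_toNatSet,
          mem_atFirm]
      have hm : (e.2 : ℕ) ∈ s₂.set 4 x e.1 0 ↔ e ∈ Λ[x].1.2 := by
        rw [a2.set 4 (by decide), a1.set 4 (by decide), (h.rotation x hx').minus, mem_toNatSet,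
          mem_atFirm]
      have key : ∀ v : ℕ, v = (if e ∈ Λ[x].1.1 then 1 else if e ∈ Λ[x].1.2 then 2 else 0) →
          ∀ e' ∈ L ++ [e], ∀ (i : ℕ) (hi : i < Λ.length), (e' ∈ L ∨ i < x + 1) →
            (s₂.setNum 3 e.1 e.2 x v).num 3 e'.1 e'.2 i =
              if e' ∈ Λ[i].1.1 then 1 else if e' ∈ Λ[i].1.2 then 2 else 0 := by
        intro v hv e' he' i hi hxi
        by_cases hc : e' = e ∧ i = x
        · obtain ⟨rfl, rfl⟩ := hc
          rw [Memory.setNum_num, if_pos ⟨rfl, rfl, rfl, rfl⟩, hv]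
        · rw [Memory.setNum_num, if_neg fun h =>
            hc ⟨Prod.ext (Fin.ext h.2.1) (Fin.ext h.2.2.1), h.2.2.2⟩]
          refine h2 e' he' i hi (or_iff_not_imp_left.2 fun hL => ?_)
          have hi' := hxi.resolve_left hL
          have he : e' = e := by simpa [hL] using he'
          have : i ≠ x := fun h => hc ⟨he, h⟩
          omega
      refine (Run.of_wp hT (P := .ite _ _ (.ite _ _ _))
        ⟨fun hc => ?_, fun hc => ⟨fun hc' => ?_, fun hc' => ?_⟩⟩).mono
        (show _ ≤ 5 by decide) fun _ h => h
      all_goals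
        simp only [Cond.eval, NumExp.eval, SetExp.eval, hv, hv1, hv2, hp] at hc
        try simp only [Cond.eval, NumExp.eval, SetExp.eval, hv, hv1, hv2, hm] at hc'
        simp only [Program.wp, NumExp.eval, hv, hv1, hv2]
        exact key _ (by simp [*])

theorem run_offsetProgram (hT : 1 ≤ T) {s : Memory} (ht : FirmRows s 17 (pairsOf hM ⊤)) :
    Run M T offsetProgram s (n * (m * 5 + 4) + 2) fun s' =>
      ∀ e : Fin n × Fin m, s'.num 4 e.1 e.2 0 = if e ∈ pairsOf hM ⊤ then 1 else 0 := by
  refine (Run.forPairs hT (c := 3) (s := s)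
    (fun L s' => ∀ e ∈ L, s'.num 4 e.1 e.2 0 = if e ∈ pairsOf hM ⊤ then 1 else 0)
    (by decide) (by decide) (by decide) ?_ (by simp) ?_).mono le_rfl
      fun s' h e => h e (mem_allPairs e)
  · intro L s' i v h' hi e he
    rw [Memory.setNum_num, if_neg (by omega), h' e he]
  · intro L e s₁ a1 hx hy h1
    have hp : (e.2 : ℕ) ∈ s₁.set 17 e.1 0 0 ↔ e ∈ pairsOf hM ⊤ := by
      rw [a1.set 17 (by decide), ht, mem_toNatSet, mem_atFirm]
    refine (Run.of_wp hT (P := .ite _ _ _) ⟨fun hc => ?_, fun hc => ?_⟩).mono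
      (show _ ≤ 3 by decide) fun _ h => h
    all_goals
      simp only [Cond.eval, NumExp.eval, SetExp.eval, hx, hy, hp] at hc
      simp only [Program.wp, NumExp.eval, hx, hy]
      intro e' he'
      by_cases hee : e' = e
      · subst hee
        simp [Memory.setNum_num, hc]
      · rw [Memory.setNum_num, if_neg, h1 e' (by simpa [hee] using he')]
        exact fun h => hee (Prod.ext (Fin.ext h.2.1) (Fin.ext h.2.2.1))

end OracleMachine

/-! ### Correctness of the three programs, and the theorem -/

namespace OracleMachine

open Market PathIndependent IsSetLattice Program AffineRep

variable {n m : ℕ} {M : Market (Fin n) (Fin m)} {T : ℕ}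

theorem firmRow_fin (X : Finset (Fin n × Fin m)) (f : Fin n) :
    firmRow X f = toNatSet (atFirm X f) := by
  simp [firmRow]

theorem firmRows_acc_input (μ : Finset (Fin n × Fin m)) (U : Set ℕ) :
    FirmRows (input M μ U) 0 M.acc := fun f => by
  simp [input, firmRow_fin]

theorem firmRows_input (μ : Finset (Fin n × Fin m)) (U : Set ℕ) :
    FirmRows (input M μ U) 2 μ := fun f => by
  simp [input, firmRow_fin]

theorem input_num_eq_one (μ : Finset (Fin n × Fin m)) (U : Set ℕ) (i : ℕ) :
    (input M μ U).num 0 i 0 0 = 1 ↔ i ∈ U := by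
  simp [input]

section

variable (hM : M.IsCM)

/-- The list of all rotations that is computed by the programs. -/
noncomputable abbrev allRotations : List M.Rotation := listRotations hM (allPairs n m)

open Classical in
/-- The numbering of the rotations that is computed by the programs. -/
noncomputable def rotationEquiv : Fin (allRotations hM).length ≃ M.Rotation :=
  (nodup_listRotations hM _).getEquivOfForallMemList _ (mem_listRotations hM mem_allPairs)

theorem length_allRotations_le : (allRotations hM).length ≤ n * m := by
  have := card_rotation_le hM
  rwa [← Fintype.card_congr (rotationEquiv hM), Fintype.card_fin, Fintype.card_fin,
    Fintype.card_fin] at this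

/-- The firm-optimal stable matching. -/
noncomputable def firmOptimal : M.StableMatching := (⊤ : M.StableLattice hM)

theorem isFirmOptimal_firmOptimal : M.IsFirmOptimal (firmOptimal hM) := fun ν =>
  (dominates_iff_le hM).2 (le_top (a := toLattice hM ν))

theorem run_buildProgram (hT : 1 ≤ T) (hn : 1 ≤ n) (hm : 1 ≤ m) {s : Memory}
    (h0 : FirmRows s 0 M.acc) :
    Run M T buildProgram s (400 * (n * m) ^ 3)
      (HoldsRepresentation M (firmOptimal hM) (rotationEquiv hM)) := by
  have hk := length_allRotations_le hM
  have hN1 : 1 ≤ n * m := Nat.mul_pos hn hm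
  have hN2 : n * m ≤ (n * m) ^ 2 := Nat.le_self_pow (by decide) _
  have hN3 : (n * m) ^ 2 ≤ (n * m) ^ 3 := Nat.pow_le_pow_right hN1 (by decide)
  have hb1 : (allRotations hM).length * ((allRotations hM).length * 5 + 4) + 2 ≤
      11 * (n * m) ^ 2 := by nlinarith
  have hb2 : n * (m * ((allRotations hM).length * 7 + 4) + 4) + 2 ≤ 17 * (n * m) ^ 2 := by
    refine (pairs_bound_le (c := (allRotations hM).length * 7 + 2) hn hm).trans ?_
    nlinarith
  have hb3 : n * (m * 5 + 4) + 2 ≤ 11 * (n * m) := by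
    have : n * (m * 5 + 4) + 2 ≤ n * m * 11 := pairs_bound_le (c := 3) hn hm
    omega
  refine ((run_coreProgram hM hT hn hm h0).seq (c := 50 * (n * m) ^ 3)
    fun s₁ ⟨ht, (hr : HoldsRotations (allRotations hM) s₁)⟩ _ => ?_).mono (by omega) fun _ h => h
  refine ((run_orderProgram hT ht hr).seq (c := 28 * (n * m) ^ 2) fun s₂ h2 a2 => ?_).mono
    (by omega) fun _ h => h
  have hr2 := hr.congr (s' := s₂) (fun a h => a2.num a (by revert a; decide))
    (fun a h => a2.set a (by revert a; decide))
  refine ((run_matrixProgram hT hr2).seq (c := n * (m * 5 + 4) + 2) fun s₃ h3 a3 =>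
    (run_offsetProgram (hM := hM) hT (ht.top.congr (s' := s₃) ?_)).agree.mono le_rfl ?_).mono
    (by omega) fun _ h => h
  · rw [a3.set 17 (by decide), a2.set 17 (by decide)]
  rintro s₄ ⟨h4, a4⟩
  have hr4 := hr2.congr (s' := s₄)
    (fun a h => by rw [a4.num a (by revert a; decide), a3.num a (by revert a; decide)])
    (fun a h => by rw [a4.set a (by revert a; decide), a3.set a (by revert a; decide)])
  refine ⟨hr4.count, fun i => (hr4.rotation i i.2).plus, fun i => (hr4.rotation i i.2).minus,
    fun i j => ?_, fun e i => ?_, fun e => ?_⟩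
  · rw [a4.num 2 (by decide), a3.num 2 (by decide), h2 i j i.2 j.2]
    rfl
  · rw [a4.num 3 (by decide), h3 e.1 i i.2, rotationMatrix, Matrix.of_apply]
    -- A pair does not both enter and leave in one rotation, so testing `ρ⁺` before `ρ⁻` stores the
    -- right sign.
    have hd := (rotationBase_spec hM (rotationEquiv hM i)).disjoint (a := e.1)
    change decodeSign (if e.1 ∈ (rotationEquiv hM i).1.1 then 1 else
      if e.1 ∈ (rotationEquiv hM i).1.2 then 2 else 0) = _
    by_cases hp : e.1 ∈ (rotationEquiv hM i).1.1
    · simp [charVec, edgeSet, decodeSign, hp, hd hp]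
    · by_cases hm : e.1 ∈ (rotationEquiv hM i).1.2 <;>
        simp [charVec, edgeSet, decodeSign, hp, hm]
  · rw [h4 e.1]
    by_cases h : e.1 ∈ pairsOf hM ⊤
    · rw [if_pos h, charVec, Set.indicator_of_mem (show e ∈ M.edgeSet (firmOptimal hM).1 from h)]
      simp
    · rw [if_neg h, charVec, Set.indicator_of_notMem (show e ∉ M.edgeSet (firmOptimal hM).1 from h)]
      simp

theorem run_psiProgram (hT : 1 ≤ T) (hn : 1 ≤ n) (hm : 1 ≤ m) {s : Memory}
    (h0 : FirmRows s 0 M.acc) (μ : M.StableMatching) (hμ : FirmRows s 2 μ.1) :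
    Run M T psiProgram s (400 * (n * m) ^ 3)
      (HoldsRotationSet M (rotationEquiv hM) (M.rotationSet μ)) := by
  classical
  have hk := length_allRotations_le hM
  have hN1 : 1 ≤ n * m := Nat.mul_pos hn hm
  have hN3 : n * m ≤ (n * m) ^ 3 := Nat.le_self_pow (by decide) _
  refine ((run_coreProgram hM hT hn hm h0).seq (c := 50 * (n * m) ^ 3)
    fun s₁ ⟨ht, (hr : HoldsRotations (allRotations hM) s₁)⟩ a1 => ?_).mono (by omega) fun _ h => h
  refine (Run.forUpTo (N := (allRotations hM).length) hT (c := 6) (s := s₁)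
    (fun x s' => ∀ (i : ℕ) (hi : i < (allRotations hM).length), i < x →
      s'.num 5 i 0 0 = if (allRotations hM)[i] ∈ M.rotationSet μ then 1 else 0)
    (by decide) (fun s' ha => ?_) ?_ ?_ ?_).mono (by omega) fun s' h i => h i i.2 i.2
  · simp only [NumExp.eval]
    rw [ha.num 1 (by decide), hr.count]
  · intro x s' v h' i hi hx
    rw [Memory.setNum_num, if_neg (by omega), h' i hi hx]
  · exact fun i hi hx => absurd hx (Nat.not_lt_zero _)
  · intro x s₂ hx a2 hv h2
    obtain ⟨b, hb, hb1, hb2⟩ := (hr.rotation x hx).rep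
    rw [← a2.num 20 (by decide)] at hb1
    rw [← a2.num 21 (by decide)] at hb2
    have hμ2 : FirmRows s₂ 2 μ.1 := hμ.congr (by rw [a2.set 2 (by decide), a1.set 2 (by decide)])
    have hmem : (b.2 : ℕ) ∈ s₂.set 2 b.1 0 0 ↔ b ∈ μ.1 := by rw [hμ2, mem_toNatSet, mem_atFirm]
    have hψ := mem_rotationSet_iff_mem_choiceF hM hb μ
    have key : ∀ (s' : Memory) (v : ℕ), (s'.num = s₂.num) →
        (v = if (allRotations hM)[x] ∈ M.rotationSet μ then 1 else 0) →
        ∀ (i : ℕ) (hi : i < (allRotations hM).length), i < x + 1 →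
          (s'.setNum 5 x 0 0 v).num 5 i 0 0 =
            if (allRotations hM)[i] ∈ M.rotationSet μ then 1 else 0 := by
      intro s' v hs' hv' i hi hix
      by_cases he : i = x
      · subst he
        rw [Memory.setNum_num, if_pos ⟨rfl, rfl, rfl, rfl⟩, hv']
      · rw [Memory.setNum_num, if_neg fun h => he h.2.1, hs', h2 i hi (by omega)]
    refine (Run.of_wp hT (P := .ite _ _ _) ⟨fun hc => ?_, fun hc => ?_⟩).mono
      (show _ ≤ 6 by decide) fun _ h => h
    · simp only [Cond.eval, NumExp.eval, SetExp.eval, hv, hb1, hb2, hmem] at hc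
      simp only [Program.wp, NumExp.eval, hv]
      exact key _ _ rfl (by rw [if_neg fun h => (hψ.1 h).1 hc])
    · simp only [Cond.eval, NumExp.eval, SetExp.eval, hv, hb1, hb2, hmem] at hc
      simp only [Program.wp, Cond.eval, NumExp.eval, SetExp.eval, hv, hb1, hb2, lt_max_worker,
        if_true, Memory.setSet_num, Memory.setSet_set, and_self]
      have hacc : b ∈ M.acc := stablePairs_subset_acc hM
        (passedPairs_subset hM (mem_passedPairs_of_mem_minus hM hb))
      refine ⟨b.1, insert b.2 (atFirm μ.1 b.1), rfl, ?_, ?_, fun hc' => ?_, fun hc' => ?_⟩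
      · rw [hμ2, ← toNatSet_singleton, toNatSet_union, toNatSet_inj, Finset.insert_eq,
          Finset.union_comm]
      · exact Finset.insert_subset (mem_atFirm.2 hacc) (atFirm_mono μ.2.subset_acc _)
      · rw [mem_toNatSet] at hc'
        exact key _ _ rfl (by rw [if_pos (hψ.2 ⟨hc, hc'⟩)])
      · rw [mem_toNatSet] at hc'
        exact key _ _ rfl (by rw [if_neg fun h => hc' (hψ.1 h).2])

theorem run_psiInvProgram (hT : 1 ≤ T) (hn : 1 ≤ n) (hm : 1 ≤ m) {s : Memory}
    (h0 : FirmRows s 0 M.acc) (μ : M.StableMatching)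
    (hU : ∀ i, s.num 0 i 0 0 = 1 ↔ i ∈ indexSet M (rotationEquiv hM) (M.rotationSet μ)) :
    Run M T psiInvProgram s (400 * (n * m) ^ 3) (HoldsMatching μ.1) := by
  have hk := length_allRotations_le hM
  have hnN : n ≤ n * m := Nat.le_mul_of_pos_right n hm
  have hN1 : 1 ≤ n * m := Nat.mul_pos hn hm
  have hN2 : n * m ≤ (n * m) ^ 2 := Nat.le_self_pow (by decide) _
  have hN3 : (n * m) ^ 2 ≤ (n * m) ^ 3 := Nat.pow_le_pow_right hN1 (by decide)
  have hU' : ∀ x (hx : x < (allRotations hM).length),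
      s.num 0 x 0 0 = 1 ↔ (allRotations hM)[x] ∈ M.rotationSet μ := fun x hx => by
    rw [hU]
    exact ⟨fun ⟨_, h⟩ => h, fun h => ⟨hx, h⟩⟩
  refine ((run_coreProgram hM hT hn hm h0).seq (c := 50 * (n * m) ^ 3)
    fun s₁ ⟨ht, (hr : HoldsRotations (allRotations hM) s₁)⟩ a1 => ?_).mono (by omega) fun _ h => h
  refine (Run.forUpTo (N := n) hT (c := (allRotations hM).length * 6 + 5) (s := s₁)
    (fun x s' => ∀ f : Fin n, (f : ℕ) < x → s'.set 5 f 0 0 = toNatSet (atFirm μ.1 f))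
    (by decide) (fun _ _ => rfl) (fun _ _ _ h => h) ?_ ?_).mono (by nlinarith) fun s' h f => h f f.2
  · exact fun f hf => absurd hf (Nat.not_lt_zero _)
  · intro x s₂ hx a2 hv h2
    set f₀ : Fin n := ⟨x, hx⟩
    refine ((Run.of_wp hT (P := .assignSet _ _ _ _ _) (Q := fun s' =>
      s'.set 18 0 0 0 = toNatSet (atFirm (pairsOf hM ⊤) f₀)) ?_).seq
        (c := (allRotations hM).length * 6 + 4) fun s₃ h3 a3 => ?_).mono (by
          simp only [Program.steps]; omega) fun _ h => h
    · simp only [Program.wp, NumExp.eval, SetExp.eval, hv, Memory.setSet_set, and_self, if_true]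
      rw [a2.set 17 (by decide)]
      exact ht.top f₀
    refine ((Run.of_wp hT (P := .assignSet _ _ _ _ _) (Q := fun s' => s'.set 19 0 0 0 = ∅)
      (by simp [Program.wp, NumExp.eval, SetExp.eval, Memory.setSet_set])).seq
        (c := (allRotations hM).length * 6 + 3) fun s₄ h4 a4 => ?_).mono (by
          simp only [Program.steps]; omega) fun _ h => h
    refine ((Run.forUpTo (N := (allRotations hM).length) hT (c := 4) (s := s₄)
      (fun y s' => ∃ X Y : Finset (Fin m), s'.set 18 0 0 0 = toNatSet X ∧
        s'.set 19 0 0 0 = toNatSet Y ∧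
        ∀ w, (w ∈ X ↔ (f₀, w) ∈ pairsOf hM ⊤ ∨ ∃ (i : ℕ) (hi : i < (allRotations hM).length),
          i < y ∧ (allRotations hM)[i] ∈ M.rotationSet μ ∧ (f₀, w) ∈ (allRotations hM)[i].1.1) ∧
        (w ∈ Y ↔ ∃ (i : ℕ) (hi : i < (allRotations hM).length),
          i < y ∧ (allRotations hM)[i] ∈ M.rotationSet μ ∧ (f₀, w) ∈ (allRotations hM)[i].1.2))
      (by decide) (fun s' ha => ?_) (fun _ _ _ h => h) ?_ ?_).seq (c := 1) fun s₅ h5 a5 => ?_).mono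
        (by omega) fun _ h => h
    · simp only [NumExp.eval]
      rw [ha.num 1 (by decide), a4.num 1 (by decide), a3.num 1 (by decide), a2.num 1 (by decide),
        hr.count]
    · refine ⟨atFirm (pairsOf hM ⊤) f₀, ∅, ?_, by rw [h4, toNatSet_empty], fun w => ⟨?_, by simp⟩⟩
      · rw [a4.set 18 (by decide), h3]
      · simp [mem_atFirm]
    · rintro y s' hy ha hvy ⟨X, Y, hX, hY, hXY⟩
      have h3' : s'.set 3 y x 0 = toNatSet (atFirm (allRotations hM)[y].1.1 f₀) := by
        rw [ha.set 3 (by decide), a4.set 3 (by decide), a3.set 3 (by decide), a2.set 3 (by decide)]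
        exact (hr.rotation y hy).plus f₀
      have h4' : s'.set 4 y x 0 = toNatSet (atFirm (allRotations hM)[y].1.2 f₀) := by
        rw [ha.set 4 (by decide), a4.set 4 (by decide), a3.set 4 (by decide), a2.set 4 (by decide)]
        exact (hr.rotation y hy).minus f₀
      have hv' : s'.num 12 0 0 0 = x := by
        rw [ha.num 12 (by decide), a4.num 12 (by decide), a3.num 12 (by decide), hv]
      have hn0 : s'.num 0 y 0 0 = 1 ↔ (allRotations hM)[y] ∈ M.rotationSet μ := by
        rw [ha.num 0 (by decide), a4.num 0 (by decide), a3.num 0 (by decide), a2.num 0 (by decide),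
          a1.num 0 (by decide), hU' y hy]
      have hstep : ∀ p : ∀ i, i < (allRotations hM).length → Prop,
          (∃ (i : ℕ) (hi : i < (allRotations hM).length), i < y + 1 ∧ p i hi) ↔
            (∃ (i : ℕ) (hi : i < (allRotations hM).length), i < y ∧ p i hi) ∨ p y hy := by
        intro p
        constructor
        · rintro ⟨i, hi, hiy, hp⟩
          rcases Nat.lt_succ_iff_lt_or_eq.1 hiy with h | rfl
          · exact Or.inl ⟨i, hi, h, hp⟩
          · exact Or.inr hp
        · rintro (⟨i, hi, hiy, hp⟩ | hp)
          · exact ⟨i, hi, by omega, hp⟩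
          · exact ⟨y, hy, by omega, hp⟩
      refine (Run.of_wp hT (P := .ite _ _ _) ⟨fun hc => ?_, fun hc => ?_⟩).mono
        (show _ ≤ 4 by decide) fun _ h => h
      · simp only [Cond.eval, NumExp.eval, hvy, hn0] at hc
        simp only [Program.wp, NumExp.eval, SetExp.eval, hvy, hv', Memory.setSet_set,
          Memory.setSet_num, Nat.reduceEqDiff, false_and, if_false, and_self, if_true, hX, hY, h3',
          h4', toNatSet_union]
        refine ⟨_, _, rfl, rfl, fun w => ⟨?_, ?_⟩⟩
        · rw [Finset.mem_union, (hXY w).1, mem_atFirm, hstep, or_assoc, and_iff_right hc]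
        · rw [Finset.mem_union, (hXY w).2, mem_atFirm, hstep, and_iff_right hc]
      · simp only [Cond.eval, NumExp.eval, hvy, hn0] at hc
        refine ⟨X, Y, ?_, ?_, fun w => ⟨?_, ?_⟩⟩
        · simpa [Memory.setSet_set] using hX
        · simpa [Memory.setSet_set] using hY
        · rw [(hXY w).1, hstep]
          simp only [hc, false_and, or_false]
        · rw [(hXY w).2, hstep]
          simp only [hc, false_and, or_false]
    · obtain ⟨X, Y, hX, hY, hXY⟩ := h5
      have hv5 : s₅.num 12 0 0 0 = x := by
        rw [a5.num 12 (by decide), a4.num 12 (by decide), a3.num 12 (by decide), hv]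
      have hset : s₅.set 5 = s₂.set 5 := by
        rw [a5.set 5 (by decide), a4.set 5 (by decide), a3.set 5 (by decide)]
      refine (Run.of_wp hT (P := .assignSet _ _ _ _ _) ?_).mono le_rfl fun _ h => h
      simp only [Program.wp, NumExp.eval, SetExp.eval, hv5, hX, hY, toNatSet_sdiff]
      intro f hf
      rw [Memory.setSet_set]
      by_cases hfx : (f : ℕ) = x
      · obtain rfl : f = f₀ := Fin.ext hfx
        rw [if_pos ⟨rfl, rfl, rfl, rfl⟩, toNatSet_inj]
        have hall : ∀ p : M.Rotation → Prop, (∃ (i : ℕ) (hi : i < (allRotations hM).length),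
            i < (allRotations hM).length ∧ (allRotations hM)[i] ∈ M.rotationSet μ ∧
              p (allRotations hM)[i]) ↔ ∃ ρ ∈ M.rotationSet μ, p ρ := by
          intro p
          constructor
          · rintro ⟨i, hi, -, h⟩
            exact ⟨_, h⟩
          · rintro ⟨ρ, h⟩
            obtain ⟨i, hi, rfl⟩ := List.getElem_of_mem (mem_listRotations hM mem_allPairs ρ)
            exact ⟨i, hi, hi, h⟩
        ext w
        rw [Finset.mem_sdiff, (hXY w).1, (hXY w).2, mem_atFirm, mem_stableMatching_iff hM μ,
          hall fun ρ => (f₀, w) ∈ ρ.1.1, hall fun ρ => (f₀, w) ∈ ρ.1.2]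
        push Not
        rfl
      · rw [if_neg fun h => hfx h.2.1, hset]
        exact h2 f (by omega)

end

theorem Run.haltsWithin {P : Program} {s : Memory} {c : ℕ} {Q : Memory → Prop}
    (h : Run M T P s (c * (n * m) ^ 3) Q) : HaltsWithin M T P s (c * (n ^ 3 * m ^ 3 * T)) Q := by
  have he : c * (n * m) ^ 3 * T = c * (n ^ 3 * m ^ 3 * T) := by ring
  rwa [Run, he] at h

end OracleMachine

theorem theorem1p1 :
    -- affine representation by the rotation poset, in the CM-Model
    (∀ (F W : Type*) [DecidableEq F] [DecidableEq W] [Fintype F] [Fintype W] (M : Market F W),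
      M.IsCM →
        (∃ L : DistribLattice M.StableMatching,
          ∀ μ ν : M.StableMatching, L.le ν μ ↔ M.Dominates μ ν) ∧
        IsPartialOrder M.Rotation M.RotationGE ∧
        (∃ μF : M.StableMatching, M.IsFirmOptimal μF ∧
          ∃ g : (M.Rotation → ℝ) →ᵃ[ℝ] (M.Edge → ℝ),
            (∀ u, g u = M.rotationMatrix *ᵥ u + AffineRep.charVec (M.edgeSet μF.1)) ∧
            AffineRep.AffinelyRepresents (fun μ : M.StableMatching => M.edgeSet μ.1)
              M.Dominates M.RotationGE M.rotationSet g) ∧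
        Fintype.card M.Rotation ≤ Fintype.card F * Fintype.card W ∧
        M.rotationMatrix.rank = Fintype.card M.Rotation) ∧
    -- its computation, in the CM-QF-Model
    (∃ (build evalPsi evalPsiInv : OracleMachine.Program) (C : ℕ),
      ∀ (n m : ℕ), 1 ≤ n → 1 ≤ m → ∀ M : Market (Fin n) (Fin m), M.IsCMQF →
        ∃ (μF : M.StableMatching) (k : ℕ) (ρ : Fin k ≃ M.Rotation), M.IsFirmOptimal μF ∧
          ∀ T : ℕ, 1 ≤ T →
            OracleMachine.HaltsWithin M T build (OracleMachine.input M ∅ ∅)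
              (C * (n ^ 3 * m ^ 3 * T)) (OracleMachine.HoldsRepresentation M μF ρ) ∧
            (∀ μ : M.StableMatching,
              OracleMachine.HaltsWithin M T evalPsi (OracleMachine.input M μ.1 ∅)
                (C * (n ^ 3 * m ^ 3 * T))
                (OracleMachine.HoldsRotationSet M ρ (M.rotationSet μ)) ∧
              OracleMachine.HaltsWithin M T evalPsiInv
                (OracleMachine.input M ∅ (OracleMachine.indexSet M ρ (M.rotationSet μ)))
                (C * (n ^ 3 * m ^ 3 * T))
                (OracleMachine.HoldsMatching μ.1))) := by
  refine ⟨fun F W _ _ _ _ M hM => ⟨Market.exists_distribLattice hM,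
    Market.isPartialOrder_rotationGE hM, Market.affinelyRepresents hM, Market.card_rotation_le hM,
    Market.rank_rotationMatrix hM⟩, OracleMachine.buildProgram, OracleMachine.psiProgram,
    -- Of the `400`, `350` are for `coreProgram`, which all three programs run, and `50` for what
    -- each does with its tables.
    OracleMachine.psiInvProgram, 400, fun n m hn hm M hM => ?_⟩
  refine ⟨OracleMachine.firmOptimal hM.toIsCM, _, OracleMachine.rotationEquiv hM.toIsCM,
    OracleMachine.isFirmOptimal_firmOptimal hM.toIsCM, fun T hT => ⟨?_, fun μ => ⟨?_, ?_⟩⟩⟩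
  · exact (OracleMachine.run_buildProgram hM.toIsCM hT hn hm
      (OracleMachine.firmRows_acc_input ∅ ∅)).haltsWithin
  · exact (OracleMachine.run_psiProgram hM.toIsCM hT hn hm
      (OracleMachine.firmRows_acc_input μ.1 ∅) μ (OracleMachine.firmRows_input μ.1 ∅)).haltsWithin
  · exact (OracleMachine.run_psiInvProgram hM.toIsCM hT hn hm
      (OracleMachine.firmRows_acc_input ∅ _) μ
      (OracleMachine.input_num_eq_one ∅ _)).haltsWithin
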